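/- **Setting.** Let $\mathcal A\subseteq M_d(\mathbb C)$ be a unital $*$-subalgebra with a self-adjoint basis $Z_1,\dots,Z_q$ satisfying $\operatorname{Tr}[Z_aZ_b]=\delta_{ab}$, and consider a chain of $N\ge 1$ sites with algebra $\mathcal A^{\otimes N}$. States are identified with density operators in $\mathcal A^{\otimes N}$, $d_{\mathrm{Tr}}(\rho,\sigma)=\frac12\|\rho-\sigma\|_1$, $\|\cdot\|_2$ is the Hilbert–Schmidt norm, and intervals of sites are always intersected with $[1,N]$. For a state $\omega$ let $\Omega^{[i,j,k]}:\mathcal A_{[j+1,k]}\to\mathcal A_{[i,j]}^*$, $\Omega^{[i,j,k]}(X)(Y)=\omega(\mathbb 1\otimes Y\otimes X\otimes\mathbb 1)$, and $\Omega^{[i,j,k]}_A(X)=\Omega^{[i,j,k]}(A\otimes X)$ with $A$ on site $j+1$; they are written as real matrices in the product bases built from the $Z_a$. The state $\omega$ is $(l,r,m)$-finitely correlated if $\operatorname{rank}\Omega^{[1,j,N]}=\operatorname{rank}\Omega^{[j-l+1,j,j+r]}=:m_j\le m$ for all $0\le j\le N$. Write $\Omega_j=\Omega^{[j-l+1,j,j+r]}$,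 and $\sigma_{m_j}(\Omega_j)$ for its smallest nonzero singular value. **Algorithm.** The input is a threshold $\eta>0$ and self-adjoint estimates of the marginals of a state $\sigma$ on $[j-l+1,j+r]$ (for $1\le j\le N-1$) and on $[j-l,j+r]$ (for $1\le j\le N$). Let $\hat\Omega_j$ and $\hat\Omega^{[j-l,j-1,j+r]}_A$ be the maps above computed from these estimates. For $1\le j\le N-1$ let the columns of $\hat U_j$ be orthonormal left singular vectors of $\hat\Omega_j$ for its singular values that are $\ge\eta$; put $\hat U_0=1$. With $\hat{\mathbb K}^{(j)}_A=\hat U_{j-1}^{\intercal}\hat\Omega_A^{[j-l,j-1,j+r]}(\hat U_j^{\intercal}\hat\Omega_j)^+$ for $1\le j<N$ and $\hat{\mathbb K}^{(N)}_A=\hat U_{N-1}^{\intercal}\hat\Omega_A^{[N-l,N-1,N]}$ (where $^+$ is the Moore–Penrose pseudoinverse), the output $\hat\sigma\in\mathcal A^{\otimes N}$ is defined by $\operatorname{Tr}[\hat\sigma\,(X_1\otimes\cdots\otimes X_N)]=\hat{\mathbb K}^{(1)}_{X_1}\cdots\hat{\mathbb K}^{(N)}_{X_N}$. It need not be positive.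 **Proposition.** There is a universal constant $D>0$ such that the following holds for all $\mathcal A,d,N,l,r,m$. Let $\omega$ be an $(l,r,m)$-finitely correlated state and $\sigma$ a state whose marginals on any $t$ consecutive sites ($1\le t\le N$) satisfy $d_{\mathrm{Tr}}(\sigma_t,\omega_t)\le\xi(t)$. Below, $\xi(l+r)$ and $\xi(l+r+1)$ are read as $\xi(N)$ if the argument exceeds $N$. Suppose that the estimates given to the algorithm are within $\varepsilon$ of the marginals of $\sigma$ in Hilbert–Schmidt distance, that $\xi(l+r)\le\sigma_{m_j}(\Omega_j)/8$ for $j=0,\dots,N$, and that, for some $0<\epsilon<1$, $$\varepsilon+\xi(l+r+1)\le\min_{0\le j\le N}\frac{\epsilon\,\sigma_{m_j}(\Omega_j)^3}{20\,N\,m\,\sqrt d}.$$ Let the threshold satisfy $\eta>0$ and $2(\varepsilon+\xi(l+r+1))\le\eta\le\min_{0\le j\le N}\sigma_{m_j}(\Omega_j)/2$. Then for every $1\le j\le N-1$ the algorithm keeps exactly $m_j$ singular vectors, and every output $\hat\sigma$ satisfies $$d_{\mathrm{Tr}}(\sigma,\hat\sigma)\le\xi(N)+d_{\mathrm{Tr}}(\omega,\hat\sigma),\qquad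 d_{\mathrm{Tr}}(\omega,\hat\sigma)<D\,\epsilon .$$ -/

import Mathlib

open scoped Matrix ComplexOrder

namespace FCS

/-! ### Operators on finite sets of sites -/

/-- Operators on the tensor product, over the sites in `S`, of copies of `ℂ^d`. -/
abbrev Op (S : Type) (d : ℕ) : Type := Matrix (S → Fin d) (S → Fin d) ℂ

/-- The sites of the chain of length `N` lying in the half-open interval `[a, b)`.
Sites are numbered `0, …, N - 1`; intervals are truncated to the chain. -/
abbrev Win (N a b : ℕ) : Type := {i : Fin N // a ≤ i.1 ∧ i.1 < b}

/-- The product operator `⨂ i, X i`. -/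
def prodOp {S : Type} [Fintype S] {d : ℕ} (X : S → Matrix (Fin d) (Fin d) ℂ) : Op S d :=
  fun x y => ∏ i, X i (x i) (y i)

/-- The algebra `⨂_{i ∈ S} 𝒜` as a subspace of the operators on `S`. -/
def localAlg {d : ℕ} (A : StarSubalgebra ℂ (Matrix (Fin d) (Fin d) ℂ)) (S : Type) [Fintype S] :
    Submodule ℂ (Op S d) :=
  Submodule.span ℂ {T | ∃ X : S → Matrix (Fin d) (Fin d) ℂ, (∀ i, X i ∈ A) ∧ T = prodOp X}

/-- `ρ` is (the density operator of) a state of the chain algebra `𝒜^{⊗N}`, acting as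
`X ↦ tr (ρ X)`. -/
structure IsState {d N : ℕ} (A : StarSubalgebra ℂ (Matrix (Fin d) (Fin d) ℂ))
    (ρ : Op (Fin N) d) : Prop where
  mem : ρ ∈ localAlg A (Fin N)
  posSemidef : ρ.PosSemidef
  trace_eq_one : ρ.trace = 1

/-- The marginal on the sites in `[a, b)`: the partial trace over all other sites. -/
def marginal {d N : ℕ} (a b : ℕ) (ρ : Op (Fin N) d) : Op (Win N a b) d :=
  fun x y => ∑ z : ({i : Fin N // ¬ (a ≤ i.1 ∧ i.1 < b)} → Fin d),
    ρ ((Equiv.piEquivPiSubtypeProd (fun i : Fin N => a ≤ i.1 ∧ i.1 < b)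
          (fun _ => Fin d)).symm (x, z))
      ((Equiv.piEquivPiSubtypeProd (fun i : Fin N => a ≤ i.1 ∧ i.1 < b)
          (fun _ => Fin d)).symm (y, z))

/-- `Z` is a self-adjoint basis of `𝒜`, orthonormal for the Hilbert-Schmidt inner product. -/
structure IsSelfAdjointONB {d q : ℕ} (A : StarSubalgebra ℂ (Matrix (Fin d) (Fin d) ℂ))
    (Z : Fin q → Matrix (Fin d) (Fin d) ℂ) : Prop where
  span_eq : Submodule.span ℂ (Set.range Z) = Subalgebra.toSubmodule A.toSubalgebra
  isHermitian : ∀ a, (Z a).IsHermitian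
  trace_mul : ∀ a b, (Z a * Z b).trace = if a = b then 1 else 0

/-! ### Norms and singular values -/

/-- The singular values of a matrix in decreasing order, with index starting at `0`. -/
noncomputable def sing {𝕜 p n : Type} [RCLike 𝕜] [Fintype p] [Fintype n] [DecidableEq n]
    (M : Matrix p n 𝕜) (i : ℕ) : ℝ :=
  (Matrix.toEuclideanLin M).singularValues i

/-- The Schatten `1`-norm: the sum of the singular values. -/
noncomputable def traceNorm {n : Type} [Fintype n] [DecidableEq n] (M : Matrix n n ℂ) : ℝ :=
  ∑ i ∈ Finset.range (Fintype.card n), sing M i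

/-- Trace distance `½ ‖ρ - σ‖₁`. -/
noncomputable def traceDist {n : Type} [Fintype n] [DecidableEq n] (ρ σ : Matrix n n ℂ) : ℝ :=
  traceNorm (ρ - σ) / 2

/-- Hilbert-Schmidt distance `‖ρ - σ‖₂`. -/
noncomputable def hsDist {n : Type} [Fintype n] (ρ σ : Matrix n n ℂ) : ℝ :=
  √(∑ i, ∑ j, ‖(ρ - σ) i j‖ ^ 2)

/-- `P` is the Moore-Penrose pseudoinverse of the real matrix `M` (the four Penrose equations). -/
structure IsPinv {p n : Type} [Fintype p] [Fintype n] (M : Matrix p n ℝ) (P : Matrix n p ℝ) :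
    Prop where
  mul_mul : M * P * M = M
  mul_mul' : P * M * P = P
  symm_left : (M * P)ᵀ = M * P
  symm_right : (P * M)ᵀ = P * M

theorem exists_isPinv {p n : Type} [Fintype p] [Fintype n] (M : Matrix p n ℝ) :
    ∃ P, IsPinv M P := by
  classical
  have hS : (Mᵀ * M).IsHermitian := by
    have h := Matrix.isHermitian_conjTranspose_mul_self M
    rwa [Matrix.conjTranspose_eq_transpose_of_trivial] at h
  set V : Matrix n n ℝ := (hS.eigenvectorUnitary : Matrix n n ℝ) with hV
  set D : n → ℝ := hS.eigenvalues with hD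
  have hVV : Vᵀ * V = 1 := by
    have h := Unitary.coe_star_mul_self hS.eigenvectorUnitary
    rwa [Matrix.star_eq_conjTranspose, Matrix.conjTranspose_eq_transpose_of_trivial] at h
  have hspec : Mᵀ * M = V * Matrix.diagonal D * Vᵀ := by
    have h := hS.spectral_theorem
    rw [Unitary.conjStarAlgAut_apply] at h
    rw [Matrix.star_eq_conjTranspose, Matrix.conjTranspose_eq_transpose_of_trivial] at h
    exact h
  set G : Matrix n n ℝ := V * Matrix.diagonal (fun i => (D i)⁻¹) * Vᵀ with hG
  have key : ∀ a b : n → ℝ, (V * Matrix.diagonal a * Vᵀ) * (V * Matrix.diagonal b * Vᵀ)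
      = V * Matrix.diagonal (fun i => a i * b i) * Vᵀ := by
    intro a b
    calc (V * Matrix.diagonal a * Vᵀ) * (V * Matrix.diagonal b * Vᵀ)
        = V * Matrix.diagonal a * (Vᵀ * V) * Matrix.diagonal b * Vᵀ := by
          simp only [Matrix.mul_assoc]
      _ = _ := by rw [hVV, Matrix.mul_one, Matrix.mul_assoc V, Matrix.diagonal_mul_diagonal]
  have sym : ∀ a : n → ℝ, (V * Matrix.diagonal a * Vᵀ)ᵀ = V * Matrix.diagonal a * Vᵀ := by
    intro a
    simp [Matrix.transpose_mul, Matrix.mul_assoc]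
  have hSG : (Mᵀ * M) * G = V * Matrix.diagonal (fun i => D i * (D i)⁻¹) * Vᵀ := by
    rw [hspec, hG, key]
  have hGS : G * (Mᵀ * M) = V * Matrix.diagonal (fun i => (D i)⁻¹ * D i) * Vᵀ := by
    rw [hspec, hG, key]
  have hSGS : (Mᵀ * M) * G * (Mᵀ * M) = Mᵀ * M := by
    rw [hSG]
    conv_lhs => rw [hspec, key]
    conv_rhs => rw [hspec]
    congr 3
    ext i
    by_cases h : D i = 0 <;> simp [h]
  have hGSG : G * (Mᵀ * M) * G = G := by
    rw [hGS, hG, key]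
    congr 3
    ext i
    by_cases h : D i = 0 <;> simp [h]
  have hGt : Gᵀ = G := sym _
  refine ⟨G * Mᵀ, ?_, ?_, ?_, ?_⟩
  · have h0 : (M * (G * Mᵀ) * M - M)ᵀ * (M * (G * Mᵀ) * M - M) = 0 := by
      have e : M * (G * Mᵀ) * M - M = M * (G * (Mᵀ * M) - 1) := by
        simp only [Matrix.mul_sub, Matrix.mul_assoc, Matrix.mul_one]
      rw [e, Matrix.transpose_mul]
      have e2 : (G * (Mᵀ * M) - 1)ᵀ * Mᵀ * (M * (G * (Mᵀ * M) - 1))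
          = (G * (Mᵀ * M) - 1)ᵀ * ((Mᵀ * M) * G * (Mᵀ * M) - Mᵀ * M) := by
        simp only [Matrix.mul_sub, Matrix.mul_assoc, Matrix.mul_one]
      rw [e2, hSGS, sub_self, Matrix.mul_zero]
    have h1 : (M * (G * Mᵀ) * M - M)ᴴ * (M * (G * Mᵀ) * M - M) = 0 := by
      rw [Matrix.conjTranspose_eq_transpose_of_trivial]
      exact h0
    exact sub_eq_zero.1 (Matrix.conjTranspose_mul_self_eq_zero.1 h1)
  · calc G * Mᵀ * M * (G * Mᵀ) = (G * (Mᵀ * M) * G) * Mᵀ := by simp only [Matrix.mul_assoc]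
      _ = G * Mᵀ := by rw [hGSG]
  · simp [Matrix.transpose_mul, hGt, Matrix.mul_assoc]
  · have e : G * Mᵀ * M = G * (Mᵀ * M) := Matrix.mul_assoc _ _ _
    rw [e, hGS]
    exact sym _

/-- The Moore-Penrose pseudoinverse. -/
noncomputable def pinv {p n : Type} [Fintype p] [Fintype n] (M : Matrix p n ℝ) : Matrix n p ℝ :=
  (exists_isPinv M).choose

theorem pinv_spec {p n : Type} [Fintype p] [Fintype n] (M : Matrix p n ℝ) : IsPinv M (pinv M) :=
  (exists_isPinv M).choose_spec

/-- The Moore-Penrose pseudoinverse is unique. -/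
theorem IsPinv.eq {p n : Type} [Fintype p] [Fintype n] {M : Matrix p n ℝ} {P Q : Matrix n p ℝ}
    (hP : IsPinv M P) (hQ : IsPinv M Q) : P = Q := by
  have h1 : M * P = M * Q := by
    calc M * P = (M * P)ᵀ := hP.symm_left.symm
      _ = (M * Q * (M * P))ᵀ := by
          rw [← Matrix.mul_assoc, hQ.mul_mul]
      _ = M * P * (M * Q) := by rw [Matrix.transpose_mul, hP.symm_left, hQ.symm_left]
      _ = M * Q := by rw [← Matrix.mul_assoc, hP.mul_mul]
  have h2 : P * M = Q * M := by
    calc P * M = (P * M)ᵀ := hP.symm_right.symm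
      _ = (P * M * (Q * M))ᵀ := by
          rw [Matrix.mul_assoc P M, ← Matrix.mul_assoc M Q M, hQ.mul_mul]
      _ = Q * M * (P * M) := by rw [Matrix.transpose_mul, hP.symm_right, hQ.symm_right]
      _ = Q * M := by rw [Matrix.mul_assoc, ← Matrix.mul_assoc M, hP.mul_mul]
  calc P = P * M * P := hP.mul_mul'.symm
    _ = Q * M * Q := by rw [h2, Matrix.mul_assoc, h1, ← Matrix.mul_assoc]
    _ = Q := hQ.mul_mul'

/-- The number of singular values that are at least `η`. -/
noncomputable def thresholdRank {p n : Type} [Fintype p] [Fintype n] [DecidableEq n]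
    (η : ℝ) (M : Matrix p n ℝ) : ℕ :=
  Nat.card {i : ℕ // i < min (Fintype.card p) (Fintype.card n) ∧ η ≤ sing M i}

/-- The columns of `U` are orthonormal left singular vectors of `M` for its `k` largest singular
values, that is, `U` is the left factor of a `k`-truncated singular value decomposition of `M`. -/
def IsTruncatedLeftFactor {p n : Type} [Fintype p] [Fintype n] [DecidableEq n] {k : ℕ}
    (M : Matrix p n ℝ) (U : Matrix p (Fin k) ℝ) : Prop :=
  Uᵀ * U = 1 ∧ M * Mᵀ * U = U * Matrix.diagonal (fun i : Fin k => sing M i ^ 2)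

/-! ### Correlation maps and finitely correlated states on a finite chain -/

/-- For an operator `τ` on the sites `[a, b)`, the matrix, in the product bases built from `Z`, of
the linear map sending `X`, supported on `[j, b)`, to the functional `Y ↦ tr (τ (Y ⊗ X))` on
operators supported on `[a, j)`.  Columns are indexed by the basis products `X` and rows by the
basis products `Y`. -/
noncomputable def corr {d q N : ℕ} (Z : Fin q → Matrix (Fin d) (Fin d) ℂ) (a j b : ℕ)
    (τ : Op (Win N a b) d) : Matrix (Win N a j → Fin q) (Win N j b → Fin q) ℝ :=
  fun Y X => (τ * prodOp fun i : Win N a b =>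
    if h : i.1.1 < j then Z (Y ⟨i.1, i.2.1, h⟩)
    else Z (X ⟨i.1, Nat.le_of_not_lt h, i.2.2⟩)).trace.re

/-- For an operator `τ` on the sites `[a, b)`, a site `s` and a basis element `Z c` placed at `s`,
the matrix of the map sending `X`, supported on `[s + 1, b)`, to the functional
`Y ↦ tr (τ (Y ⊗ Z c ⊗ X))` on operators supported on `[a, s)`. -/
noncomputable def corrAt {d q N : ℕ} (Z : Fin q → Matrix (Fin d) (Fin d) ℂ) (a s b : ℕ)
    (τ : Op (Win N a b) d) (c : Fin q) :
    Matrix (Win N a s → Fin q) (Win N (s + 1) b → Fin q) ℝ :=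
  fun Y X => (τ * prodOp fun i : Win N a b =>
    if h : i.1.1 < s then Z (Y ⟨i.1, i.2.1, h⟩)
    else if h' : i.1.1 = s then Z c
    else Z (X ⟨i.1, Nat.lt_of_le_of_ne (Nat.le_of_not_lt h) (Ne.symm h'), i.2.2⟩)).trace.re

/-- The correlation map of `ω` across the cut between the first `j` sites and the rest, restricted
to the last `l` sites before and the first `r` sites after the cut. -/
noncomputable def cutMap {d q N : ℕ} (Z : Fin q → Matrix (Fin d) (Fin d) ℂ) (l r : ℕ)
    (ω : Op (Fin N) d) (j : ℕ) :
    Matrix (Win N (j - l) j → Fin q) (Win N j (j + r) → Fin q) ℝ :=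
  corr Z (j - l) j (j + r) (marginal (j - l) (j + r) ω)

/-- The correlation map of `ω` across the cut after the first `j` sites, on the whole chain. -/
noncomputable def fullCutMap {d q N : ℕ} (Z : Fin q → Matrix (Fin d) (Fin d) ℂ)
    (ω : Op (Fin N) d) (j : ℕ) : Matrix (Win N 0 j → Fin q) (Win N j N → Fin q) ℝ :=
  corr Z 0 j N (marginal 0 N ω)

/-- `(l, r, m)`-finitely correlated: at each cut `0 ≤ j ≤ N` the full and the restricted
correlation maps have the same rank `m_j`, and `m_j ≤ m`. -/
def IsFinitelyCorrelated {d q N : ℕ} (Z : Fin q → Matrix (Fin d) (Fin d) ℂ) (l r m : ℕ)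
    (ω : Op (Fin N) d) : Prop :=
  ∀ j ≤ N, (fullCutMap Z ω j).rank = (cutMap Z l r ω j).rank ∧ (cutMap Z l r ω j).rank ≤ m

/-- The smallest nonzero singular value `σ_{m_j}`, `m_j` being the rank, of the restricted
correlation map at the cut `j` (the rank is positive for every state). -/
noncomputable def sigmaCut {d q N : ℕ} (Z : Fin q → Matrix (Fin d) (Fin d) ℂ) (l r : ℕ)
    (ω : Op (Fin N) d) (j : ℕ) : ℝ :=
  sing (cutMap Z l r ω j) ((cutMap Z l r ω j).rank - 1)

/-! ### Spectral state reconstruction -/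

/-- Bond dimensions: `1` at the left end of the chain, `k j` at the cut `j ≥ 1`. -/
def bondDim (k : ℕ → ℕ) : ℕ → ℕ
  | 0 => 1
  | j + 1 => k (j + 1)

/-- The maps `Û_j`; at the left end of the chain the one-dimensional identity. -/
def leftMap {N q l : ℕ} {k : ℕ → ℕ} (U : ∀ j, Matrix (Win N (j - l) j → Fin q) (Fin (k j)) ℝ) :
    ∀ j, Matrix (Win N (j - l) j → Fin q) (Fin (bondDim k j)) ℝ
  | 0 => fun _ _ => 1
  | j + 1 => U (j + 1)

/-- `Û_{s}ᵀ Ω̂_{Z c} (Û_{s+1}ᵀ Ω̂)⁺`, the matrix at the site `s` (which is not the last one). -/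
noncomputable def siteMat {d q N l r : ℕ} {k : ℕ → ℕ} (Z : Fin q → Matrix (Fin d) (Fin d) ℂ)
    (cutEst : ∀ j : ℕ, Op (Win N (j - l) (j + r)) d)
    (siteEst : ∀ s : ℕ, Op (Win N (s - l) (s + 1 + r)) d)
    (U : ∀ j, Matrix (Win N (j - l) j → Fin q) (Fin (k j)) ℝ) (s : ℕ) (c : Fin q) :
    Matrix (Fin (bondDim k s)) (Fin (bondDim k (s + 1))) ℝ :=
  (leftMap U s)ᵀ * corrAt Z (s - l) s (s + 1 + r) (siteEst s) c *
    pinv ((leftMap U (s + 1))ᵀ * corr Z (s + 1 - l) (s + 1) (s + 1 + r) (cutEst (s + 1)))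

/-- `Û_{N-1}ᵀ Ω̂_{Z c}`, the matrix at the last site `N - 1`. -/
noncomputable def lastMat {d q N l r : ℕ} {k : ℕ → ℕ} (Z : Fin q → Matrix (Fin d) (Fin d) ℂ)
    (siteEst : ∀ s : ℕ, Op (Win N (s - l) (s + 1 + r)) d)
    (U : ∀ j, Matrix (Win N (j - l) j → Fin q) (Fin (k j)) ℝ) (c : Fin q) :
    Matrix (Fin (bondDim k (N - 1))) (Win N (N - 1 + 1) (N - 1 + 1 + r) → Fin q) ℝ :=
  (leftMap U (N - 1))ᵀ * corrAt Z (N - 1 - l) (N - 1) (N - 1 + 1 + r) (siteEst (N - 1)) c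

/-- The product of the first `s` site matrices along the word `w`. -/
noncomputable def prefixMat {d q N l r : ℕ} {k : ℕ → ℕ} (Z : Fin q → Matrix (Fin d) (Fin d) ℂ)
    (cutEst : ∀ j : ℕ, Op (Win N (j - l) (j + r)) d)
    (siteEst : ∀ s : ℕ, Op (Win N (s - l) (s + 1 + r)) d)
    (U : ∀ j, Matrix (Win N (j - l) j → Fin q) (Fin (k j)) ℝ) (w : Fin N → Fin q) :
    (s : ℕ) → s < N → Matrix (Fin 1) (Fin (bondDim k s)) ℝ
  | 0, _ => fun _ _ => 1
  | s + 1, h => prefixMat Z cutEst siteEst U w s (Nat.lt_of_succ_lt h) *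
      siteMat Z cutEst siteEst U s (w ⟨s, Nat.lt_of_succ_lt h⟩)

/-- The empty word of basis elements to the right of the last site. -/
def emptyWord {N q r : ℕ} : Win N (N - 1 + 1) (N - 1 + 1 + r) → Fin q :=
  fun i => absurd i.1.2 (by have := i.2.1; omega)

/-- The value `K̂_{w 0} K̂_{w 1} ⋯ K̂_{w (N-1)}` of the reconstructed functional on the basis
product `Z (w 0) ⊗ ⋯ ⊗ Z (w (N-1))`. -/
noncomputable def reconstructedValue {d q N l r : ℕ} [NeZero N] {k : ℕ → ℕ}
    (Z : Fin q → Matrix (Fin d) (Fin d) ℂ)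
    (cutEst : ∀ j : ℕ, Op (Win N (j - l) (j + r)) d)
    (siteEst : ∀ s : ℕ, Op (Win N (s - l) (s + 1 + r)) d)
    (U : ∀ j, Matrix (Win N (j - l) j → Fin q) (Fin (k j)) ℝ) (w : Fin N → Fin q) : ℝ :=
  (prefixMat Z cutEst siteEst U w (N - 1) (Nat.sub_one_lt (NeZero.ne N)) *
    lastMat Z siteEst U (w ⟨N - 1, Nat.sub_one_lt (NeZero.ne N)⟩)) 0 emptyWord

/-- The reconstructed operator: the element of `𝒜^{⊗N}` whose functional `X ↦ tr (σ̂ X)` takes the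
reconstructed values on the (self-adjoint orthonormal) basis products. -/
noncomputable def reconstruct {d q N l r : ℕ} [NeZero N] {k : ℕ → ℕ}
    (Z : Fin q → Matrix (Fin d) (Fin d) ℂ)
    (cutEst : ∀ j : ℕ, Op (Win N (j - l) (j + r)) d)
    (siteEst : ∀ s : ℕ, Op (Win N (s - l) (s + 1 + r)) d)
    (U : ∀ j, Matrix (Win N (j - l) j → Fin q) (Fin (k j)) ℝ) : Op (Fin N) d :=
  ∑ w : Fin N → Fin q,
    ((reconstructedValue Z cutEst siteEst U w : ℝ) : ℂ) • prodOp (fun i => Z (w i))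

/-- The number of singular values kept at the cut `j` by the algorithm with threshold `η`. -/
noncomputable def keptRank {d q N l r : ℕ} (Z : Fin q → Matrix (Fin d) (Fin d) ℂ) (η : ℝ)
    (cutEst : ∀ j : ℕ, Op (Win N (j - l) (j + r)) d) (j : ℕ) : ℕ :=
  thresholdRank η (corr Z (j - l) j (j + r) (cutEst j))

/-- `σ'` is an output of the reconstruction algorithm with threshold `η`, run on the estimates
`cutEst` and `siteEst` of the marginals: at each inner cut the singular value decomposition of the
estimated correlation map is truncated to the singular values that are at least `η`. -/
def IsReconstruction {d q N l r : ℕ} [NeZero N] (Z : Fin q → Matrix (Fin d) (Fin d) ℂ) (η : ℝ)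
    (cutEst : ∀ j : ℕ, Op (Win N (j - l) (j + r)) d)
    (siteEst : ∀ s : ℕ, Op (Win N (s - l) (s + 1 + r)) d) (σ' : Op (Fin N) d) : Prop :=
  ∃ U : ∀ j, Matrix (Win N (j - l) j → Fin q) (Fin (keptRank Z η cutEst j)) ℝ,
    (∀ j, 1 ≤ j → j < N →
      IsTruncatedLeftFactor (corr Z (j - l) j (j + r) (cutEst j)) (U j)) ∧
    σ' = reconstruct Z cutEst siteEst U

end FCS

open FCS

/-! The reconstruction is compared with an exact matrix product form of `ω` written in the same
gauge, that is, with the same estimated singular vectors Û_j. Put H_j = Û_jᵀ Ω_j (`compCut`) and let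
Ĥ_j be its estimated counterpart. Every restricted correlation map at a cut is the full one
multiplied on both sides by fixed matrices (`corr_marginal`). If H_j H_j⁺ = 1 and H_j has as many
rows as the rank of the full map, compression loses nothing (`mul_eq_of_right_inverse`), and the
matrices K built from the exact marginals (`exactMat`) reproduce `ω` exactly (`tailOp_eq`).

Let μ be the smallest of the σ_{m_j}(Ω_j) and E the Hilbert-Schmidt error of the estimates relative
to `ω`. By Weyl's inequality the threshold keeps m_j vectors, and both H_j and Ĥ_j have right
inverses of norm at most C = 5/(4μ). With V the left compression and Ω_A the site map, K̂ − K =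
Vᵀ(Ω̂_A − Ω_A)Ĥ⁺ + K(H − Ĥ)Ĥ⁺, which bounds the errors of all the matrices at one site jointly by E
C (1 + C) (`hsNorm_stack_siteMat_sub_le`).

The errors are added up over hybrids: estimated matrices on the first s sites, the exact tail of `ω`
afterwards. Bounding the estimated prefix by a product of matrix norms would cost a factor
exponential in N. Instead, the tail operators T_a have dual operators L_a of norm at most C, with
tr(T_a L_b) = δ_ab, read off from the columns of H⁺ (`exists_lift`). Pairing the hybrid Σ P_a ⊗ T_a
with L_a returns the prefix P_a, so ‖P_a‖₁ ≤ C ‖hybrid‖₁ (`traceNorm_sum_tens_le`). Hence replacing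
one more matrix changes the hybrid by at most δ times its own trace norm, where δ = C · m√d · E C (1
+ C), and the total error is at most (1 + δ)^N − 1 (`traceNorm_reconstruct_sub_le`). The assumed
budget gives Nδ ≤ ϵ/2, so the trace norm error is at most ϵ and D = 1 suffices. -/

namespace FCS

open scoped Matrix.Norms.L2Operator Kronecker

/-! ### Singular values and the trace norm -/

section SingularValues

variable {𝕜 E F : Type*} [RCLike 𝕜]
  [NormedAddCommGroup E] [InnerProductSpace 𝕜 E] [FiniteDimensional 𝕜 E]
  [NormedAddCommGroup F] [InnerProductSpace 𝕜 F] [FiniteDimensional 𝕜 F]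

/-- The right singular vectors of `T`. -/
noncomputable def rightBasis (T : E →ₗ[𝕜] F) :
    OrthonormalBasis (Fin (Module.finrank 𝕜 E)) 𝕜 E :=
  T.isSymmetric_adjoint_comp_self.eigenvectorBasis rfl

theorem inner_apply_rightBasis (T : E →ₗ[𝕜] F) (i : Fin (Module.finrank 𝕜 E)) (x : E) :
    inner 𝕜 (T (rightBasis T i)) (T x)
      = ((T.singularValues i ^ 2 : ℝ) : 𝕜) * inner 𝕜 (rightBasis T i) x := by
  have h := T.isSymmetric_adjoint_comp_self.apply_eigenvectorBasis rfl i
  rw [← LinearMap.adjoint_inner_left]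
  have h2 : (LinearMap.adjoint T) (T (rightBasis T i))
      = ((T.singularValues i ^ 2 : ℝ) : 𝕜) • rightBasis T i := by
    rw [T.sq_singularValues_fin rfl i]
    exact h
  rw [h2, inner_smul_left, RCLike.conj_ofReal]

theorem norm_apply_rightBasis (T : E →ₗ[𝕜] F) (i : Fin (Module.finrank 𝕜 E)) :
    ‖T (rightBasis T i)‖ = T.singularValues i := by
  have h := inner_apply_rightBasis T i (rightBasis T i)
  rw [inner_self_eq_norm_sq_to_K, inner_self_eq_norm_sq_to_K,
    (rightBasis T).orthonormal.1 i] at h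
  have h' : ‖T (rightBasis T i)‖ ^ 2 = T.singularValues i ^ 2 := by
    have : ((‖T (rightBasis T i)‖ ^ 2 : ℝ) : 𝕜) = ((T.singularValues i ^ 2 : ℝ) : 𝕜) := by
      push_cast at h ⊢
      simpa using h
    exact_mod_cast this
  exact (sq_eq_sq₀ (norm_nonneg _) (T.singularValues_nonneg _)).1 h'

theorem inner_apply_rightBasis_ne (T : E →ₗ[𝕜] F) {i j : Fin (Module.finrank 𝕜 E)}
    (h : i ≠ j) : inner 𝕜 (T (rightBasis T i)) (T (rightBasis T j)) = 0 := by
  rw [inner_apply_rightBasis, (rightBasis T).orthonormal.2 h, mul_zero]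

/-- The images of the right singular vectors are pairwise orthogonal, with the singular values as
lengths, so this is Pythagoras. -/
theorem norm_apply_sq (T : E →ₗ[𝕜] F) (x : E) :
    ‖T x‖ ^ 2 = ∑ i : Fin (Module.finrank 𝕜 E),
      T.singularValues i ^ 2 * ‖inner 𝕜 (rightBasis T i) x‖ ^ 2 := by
  have h : inner 𝕜 (T x) (T x)
      = ((∑ i : Fin (Module.finrank 𝕜 E), T.singularValues i ^ 2 *
        ‖inner 𝕜 (rightBasis T i) x‖ ^ 2 : ℝ) : 𝕜) := by
    have hTx : T x = ∑ i, inner 𝕜 (rightBasis T i) x • T (rightBasis T i) := by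
      conv_lhs => rw [← (rightBasis T).sum_repr' x]
      simp
    rw [hTx]
    simp only [sum_inner, inner_sum, inner_smul_left, inner_smul_right]
    push_cast
    refine Finset.sum_congr rfl fun i _ => ?_
    rw [Finset.sum_eq_single i]
    · rw [inner_self_eq_norm_sq_to_K, norm_apply_rightBasis, ← RCLike.conj_mul]
      ring
    · intro j _ hj
      rw [inner_apply_rightBasis_ne T hj]
      simp
    · simp
  rw [inner_self_eq_norm_sq_to_K] at h
  exact_mod_cast h

/-- Weyl's perturbation inequality for singular values. -/
theorem singularValues_le_add (T T' : E →ₗ[𝕜] F) {e : ℝ} (he : 0 ≤ e)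
    (h : ∀ x, ‖T x - T' x‖ ≤ e * ‖x‖) (i : ℕ) :
    T.singularValues i ≤ T'.singularValues i + e := by
  have h0 := T'.singularValues_nonneg i
  by_cases hi : Module.finrank 𝕜 E ≤ i
  · rw [T.singularValues_of_finrank_le hi]
    positivity
  rw [not_le] at hi
  let ι : Fin (i + 1) → Fin (Module.finrank 𝕜 E) := fun k => ⟨k, by omega⟩
  let ι' : Fin i → Fin (Module.finrank 𝕜 E) := fun k => ⟨k, by omega⟩
  let f : (Fin (i + 1) → 𝕜) →ₗ[𝕜] E := Fintype.linearCombination 𝕜 (fun k => rightBasis T (ι k))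
  let g : E →ₗ[𝕜] (Fin i → 𝕜) :=
    LinearMap.pi fun k => (innerSL 𝕜 (rightBasis T' (ι' k))).toLinearMap
  -- Courant-Fischer dimension count: the span of the first i + 1 right singular vectors of T
  -- contains a nonzero vector orthogonal to the first i of T'. On it T stretches by at least σ_i(T)
  -- and T' by at most σ_i(T').
  have hk : LinearMap.ker (g ∘ₗ f) ≠ ⊥ := LinearMap.ker_ne_bot_of_finrank_lt (by simp)
  obtain ⟨c, hc, hc0⟩ := (Submodule.ne_bot_iff _).1 hk
  have hli : LinearIndependent 𝕜 (fun k => rightBasis T (ι k)) :=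
    ((rightBasis T).orthonormal.comp ι
      (fun a b hab => Fin.ext (by simpa [ι] using hab))).linearIndependent
  have hx0 : f c ≠ 0 := by
    intro h0
    exact hc0 (funext (Fintype.linearIndependent_iff.1 hli c
      (by simpa [f, Fintype.linearCombination_apply] using h0)))
  set x := f c with hx
  have hT : ∀ j : Fin (Module.finrank 𝕜 E), i < j → inner 𝕜 (rightBasis T j) x = 0 := by
    intro j hj
    simp only [hx, f, Fintype.linearCombination_apply, inner_sum, inner_smul_right]
    refine Finset.sum_eq_zero fun k _ => ?_
    rw [(rightBasis T).orthonormal.2, mul_zero]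
    intro hjk
    have := congrArg Fin.val hjk
    simp only [ι] at this
    omega
  have hT' : ∀ j : Fin (Module.finrank 𝕜 E), (j : ℕ) < i → inner 𝕜 (rightBasis T' j) x = 0 := by
    intro j hj
    have := congrFun (LinearMap.mem_ker.1 hc) ⟨j, hj⟩
    simpa [g, ι', hx] using this
  have hpars : ∀ b : OrthonormalBasis (Fin (Module.finrank 𝕜 E)) 𝕜 E,
      ‖x‖ ^ 2 = ∑ j, ‖inner 𝕜 (b j) x‖ ^ 2 := fun b => (b.sum_sq_norm_inner_right x).symm
  have h1 : T.singularValues i * ‖x‖ ≤ ‖T x‖ := by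
    apply le_of_sq_le_sq _ (norm_nonneg _)
    rw [mul_pow, norm_apply_sq, hpars (rightBasis T), Finset.mul_sum]
    refine Finset.sum_le_sum fun j _ => ?_
    by_cases hj : i < j
    · simp [hT j hj]
    · have h3 := T.singularValues_antitone (not_lt.1 hj)
      have h4 := T.singularValues_nonneg i
      gcongr
  have h2 : ‖T' x‖ ≤ T'.singularValues i * ‖x‖ := by
    apply le_of_sq_le_sq _ (by positivity)
    rw [mul_pow, norm_apply_sq, hpars (rightBasis T'), Finset.mul_sum]
    refine Finset.sum_le_sum fun j _ => ?_
    by_cases hj : (j : ℕ) < i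
    · simp [hT' j hj]
    · have h3 := T'.singularValues_antitone (not_lt.1 hj)
      have h4 := T'.singularValues_nonneg j
      gcongr
  have h3 : ‖T x‖ ≤ ‖T' x‖ + e * ‖x‖ := by
    calc ‖T x‖ = ‖T' x + (T x - T' x)‖ := by congr 1; abel
      _ ≤ _ := (norm_add_le _ _).trans (by gcongr; exact h x)
  have hxp : 0 < ‖x‖ := norm_pos_iff.2 hx0
  nlinarith

end SingularValues

section Sing

variable {𝕜 p n : Type} [RCLike 𝕜] [Fintype p] [Fintype n] [DecidableEq n]

theorem sing_nonneg (M : Matrix p n 𝕜) (i : ℕ) : 0 ≤ sing M i :=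
  LinearMap.singularValues_nonneg _ _

theorem sing_antitone (M : Matrix p n 𝕜) : Antitone (sing M) :=
  LinearMap.singularValues_antitone _

theorem norm_toEuclideanLin_le (M : Matrix p n 𝕜) (x : EuclideanSpace 𝕜 n) :
    ‖Matrix.toEuclideanLin M x‖ ≤ ‖M‖ * ‖x‖ :=
  Matrix.l2_opNorm_mulVec M x

theorem opNorm_le_of_forall (M : Matrix p n 𝕜) {c : ℝ} (hc : 0 ≤ c)
    (h : ∀ x, ‖Matrix.toEuclideanLin M x‖ ≤ c * ‖x‖) : ‖M‖ ≤ c := by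
  rw [Matrix.l2_opNorm_def]
  exact ContinuousLinearMap.opNorm_le_bound _ hc h

theorem sing_le_add (M M' : Matrix p n 𝕜) (i : ℕ) :
    sing M i ≤ sing M' i + ‖M - M'‖ := by
  refine singularValues_le_add _ _ (norm_nonneg _) (fun x => ?_) i
  rw [← LinearMap.sub_apply, ← map_sub]
  exact norm_toEuclideanLin_le _ _

theorem sing_le_norm (M : Matrix p n 𝕜) (i : ℕ) : sing M i ≤ ‖M‖ := by
  have h := sing_le_add M 0 i
  simpa [sing] using h

theorem finrank_range_toEuclideanLin (M : Matrix p n 𝕜) :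
    Module.finrank 𝕜 (LinearMap.range (Matrix.toEuclideanLin M)) = M.rank := by
  classical
  rw [Matrix.rank_eq_finrank_range_toLin M (PiLp.basisFun 2 𝕜 p) (PiLp.basisFun 2 𝕜 n)]
  rfl

theorem sing_pos_iff (M : Matrix p n 𝕜) (i : ℕ) : 0 < sing M i ↔ i < M.rank := by
  rw [← finrank_range_toEuclideanLin]
  exact LinearMap.singularValues_pos_iff_lt_finrank_range _

theorem sing_eq_zero (M : Matrix p n 𝕜) {i : ℕ} (h : M.rank ≤ i) : sing M i = 0 :=
  le_antisymm (not_lt.1 fun h' => absurd ((sing_pos_iff M i).1 h') (not_lt.2 h)) (sing_nonneg M i)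

/-- Perturbing a matrix by less than the threshold and less than the gap does not change the
number of singular values above the threshold. -/
theorem thresholdRank_eq (M M' : Matrix p n ℝ) {η : ℝ} (h1 : ‖M - M'‖ < η)
    (h2 : η + ‖M - M'‖ ≤ sing M' (M'.rank - 1)) : thresholdRank η M = M'.rank := by
  have key : ∀ i, (i < min (Fintype.card p) (Fintype.card n) ∧ η ≤ sing M i) ↔ i < M'.rank := by
    intro i
    constructor
    · rintro ⟨-, h⟩
      by_contra hi
      have h3 := sing_le_add M M' i
      rw [sing_eq_zero M' (not_lt.1 hi)] at h3
      linarith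
    · intro hi
      refine ⟨hi.trans_le (le_min M'.rank_le_card_height M'.rank_le_card_width), ?_⟩
      have h3 := sing_le_add M' M i
      rw [norm_sub_rev] at h3
      have h4 := sing_antitone M' (Nat.le_sub_one_of_lt hi)
      linarith
  unfold thresholdRank
  simp only [key]
  rw [Nat.card_congr Fin.equivSubtype.symm, Nat.card_fin]

end Sing

/-! ### The Hilbert-Schmidt norm -/

section HS

variable {𝕜 p n o : Type*} [RCLike 𝕜] [Fintype p] [Fintype n] [Fintype o]

/-- The Hilbert-Schmidt norm. -/
noncomputable def hsNorm (M : Matrix p n 𝕜) : ℝ := √(∑ i, ∑ j, ‖M i j‖ ^ 2)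

theorem hsNorm_sq (M : Matrix p n 𝕜) : hsNorm M ^ 2 = ∑ i, ∑ j, ‖M i j‖ ^ 2 :=
  Real.sq_sqrt (by positivity)

theorem hsNorm_nonneg (M : Matrix p n 𝕜) : 0 ≤ hsNorm M := Real.sqrt_nonneg _

theorem hsNorm_eq_norm (M : Matrix p n 𝕜) :
    hsNorm M = ‖(WithLp.toLp 2 fun x : p × n => M x.1 x.2 : EuclideanSpace 𝕜 (p × n))‖ := by
  rw [EuclideanSpace.norm_eq, hsNorm, Fintype.sum_prod_type]

theorem hsNorm_add_le (M M' : Matrix p n 𝕜) : hsNorm (M + M') ≤ hsNorm M + hsNorm M' := by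
  rw [hsNorm_eq_norm, hsNorm_eq_norm, hsNorm_eq_norm]
  exact norm_add_le (WithLp.toLp 2 fun x : p × n => M x.1 x.2)
    (WithLp.toLp 2 fun x : p × n => M' x.1 x.2)

theorem hsNorm_transpose (M : Matrix p n 𝕜) : hsNorm Mᵀ = hsNorm M := by
  unfold hsNorm
  rw [Finset.sum_comm]
  rfl

theorem hsNorm_conjTranspose (M : Matrix p n 𝕜) : hsNorm Mᴴ = hsNorm M := by
  rw [← hsNorm_transpose M]
  simp [hsNorm]

theorem hsNorm_sq_eq_sum_col (M : Matrix p n 𝕜) :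
    hsNorm M ^ 2 = ∑ j, ‖(WithLp.toLp 2 (M.col j) : EuclideanSpace 𝕜 p)‖ ^ 2 := by
  rw [hsNorm_sq, Finset.sum_comm]
  simp [EuclideanSpace.norm_sq_eq]

theorem hsNorm_mul_le_left [DecidableEq n] (G : Matrix p n 𝕜) (M : Matrix n o 𝕜) :
    hsNorm (G * M) ≤ ‖G‖ * hsNorm M := by
  refine le_of_sq_le_sq ?_ (mul_nonneg (norm_nonneg _) (hsNorm_nonneg _))
  rw [mul_pow, hsNorm_sq_eq_sum_col, hsNorm_sq_eq_sum_col, Finset.mul_sum]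
  refine Finset.sum_le_sum fun j _ => ?_
  rw [← mul_pow]
  gcongr
  exact Matrix.l2_opNorm_mulVec G (WithLp.toLp 2 (M.col j))

theorem hsNorm_mul_le_right [DecidableEq n] [DecidableEq o] (M : Matrix p n 𝕜) (G : Matrix n o 𝕜) :
    hsNorm (M * G) ≤ hsNorm M * ‖G‖ := by
  classical
  rw [← hsNorm_conjTranspose, Matrix.conjTranspose_mul, ← hsNorm_conjTranspose M,
    ← Matrix.l2_opNorm_conjTranspose G, mul_comm]
  exact hsNorm_mul_le_left _ _

theorem opNorm_le_hsNorm [DecidableEq n] (M : Matrix p n 𝕜) : ‖M‖ ≤ hsNorm M := by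
  rw [Matrix.l2_opNorm_def]
  refine ContinuousLinearMap.opNorm_le_bound _ (hsNorm_nonneg _) fun x => ?_
  refine le_of_sq_le_sq ?_ (mul_nonneg (hsNorm_nonneg _) (norm_nonneg _))
  rw [mul_pow, EuclideanSpace.norm_sq_eq, EuclideanSpace.norm_sq_eq, hsNorm_sq, Finset.sum_mul]
  refine Finset.sum_le_sum fun i _ => ?_
  have h : ‖∑ j, M i j * x j‖ ≤ ∑ j, ‖M i j‖ * ‖x j‖ :=
    (norm_sum_le _ _).trans (by simp)
  calc ‖∑ j, M i j * x j‖ ^ 2 ≤ (∑ j, ‖M i j‖ * ‖x j‖) ^ 2 := by gcongr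
    _ ≤ _ := Finset.sum_mul_sq_le_sq_mul_sq _ _ _

theorem trace_conjTranspose_mul_self (M : Matrix p n 𝕜) :
    (Mᴴ * M).trace = ((hsNorm M ^ 2 : ℝ) : 𝕜) := by
  rw [hsNorm_sq, Finset.sum_comm, Matrix.trace]
  push_cast
  refine Finset.sum_congr rfl fun j _ => ?_
  simp [Matrix.mul_apply, RCLike.conj_mul]

theorem norm_trace_mul_le (M : Matrix p n 𝕜) (T : Matrix n p 𝕜) :
    ‖(M * T).trace‖ ≤ hsNorm M * hsNorm T := by
  refine le_of_sq_le_sq ?_ (mul_nonneg (hsNorm_nonneg _) (hsNorm_nonneg _))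
  rw [mul_pow, ← hsNorm_transpose T, hsNorm_sq, hsNorm_sq]
  simp only [Matrix.trace, Matrix.diag, Matrix.mul_apply, ← Fintype.sum_prod_type']
  calc ‖∑ x : p × n, M x.1 x.2 * T x.2 x.1‖ ^ 2
      ≤ (∑ x : p × n, ‖M x.1 x.2‖ * ‖T x.2 x.1‖) ^ 2 := by
        gcongr
        exact (norm_sum_le _ _).trans (by simp)
    _ ≤ _ := Finset.sum_mul_sq_le_sq_mul_sq _ _ _

theorem hsNorm_le_sqrt_card_mul [DecidableEq n] (M : Matrix p n 𝕜) :
    hsNorm M ≤ √(Fintype.card n) * ‖M‖ := by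
  refine le_of_sq_le_sq ?_ (by positivity)
  rw [mul_pow, hsNorm_sq_eq_sum_col, Real.sq_sqrt (by positivity)]
  calc ∑ j, ‖(WithLp.toLp 2 (M.col j) : EuclideanSpace 𝕜 p)‖ ^ 2 ≤ ∑ _j : n, ‖M‖ ^ 2 := by
        refine Finset.sum_le_sum fun j _ => ?_
        gcongr
        have h := Matrix.l2_opNorm_mulVec M (EuclideanSpace.single j 1)
        simpa using h
    _ = _ := by simp

end HS

/-- If `Hᵀ` is bounded below by `c > 0`, then `pinv H` is a right inverse of norm at most `c⁻¹`. -/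
theorem pinv_of_bounded_below {p n : Type} [Fintype p] [Fintype n] [DecidableEq p] [DecidableEq n]
    (H : Matrix p n ℝ) {c : ℝ} (hc : 0 < c)
    (h : ∀ y : EuclideanSpace ℝ p, c * ‖y‖ ≤ ‖Matrix.toEuclideanLin Hᵀ y‖) :
    H * pinv H = 1 ∧ ‖pinv H‖ ≤ c⁻¹ := by
  obtain ⟨h1, h2, h3, h4⟩ := pinv_spec H
  set P := pinv H
  have hinj : ∀ v : p → ℝ, Hᵀ *ᵥ v = 0 → v = 0 := by
    intro v hv
    have := h (WithLp.toLp 2 v)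
    rw [Matrix.toLpLin_toLp, Matrix.toLin'_apply, hv, WithLp.toLp_zero, norm_zero] at this
    have h0 : ‖(WithLp.toLp 2 v : EuclideanSpace ℝ p)‖ = 0 :=
      le_antisymm (by by_contra hh; rw [not_le] at hh; nlinarith) (norm_nonneg _)
    simpa using h0
  refine ⟨?_, ?_⟩
  -- The Penrose equations put the columns of H P − 1 into the kernel of Hᵀ, which is trivial by the
  -- lower bound.
  · have e : Hᵀ * (H * P - 1) = 0 := by
      have e1 : (H * P - 1)ᵀ * H = 0 := by
        rw [Matrix.transpose_sub, h3, Matrix.transpose_one, Matrix.sub_mul, h1, Matrix.one_mul,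
          sub_self]
      have e2 : (H * P - 1)ᵀ = H * P - 1 := by
        rw [Matrix.transpose_sub, h3, Matrix.transpose_one]
      have := congrArg Matrix.transpose e1
      rwa [Matrix.transpose_mul, Matrix.transpose_transpose, Matrix.transpose_zero] at this
    rw [← sub_eq_zero]
    ext i j
    have := hinj ((H * P - 1).col j) (by
      ext k
      exact congrFun (congrFun e k) j)
    exact congrFun this i
  · have e : P = Hᵀ * (Pᵀ * P) := by
      calc P = (P * H) * P := h2.symm
        _ = (P * H)ᵀ * P := by rw [h4]
        _ = _ := by rw [Matrix.transpose_mul, Matrix.mul_assoc]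
    -- Since P = Hᵀ(PᵀP), the lower bound on Hᵀ controls PᵀP by P; the C⋆-identity then cancels one
    -- factor ‖P‖.
    have e2 : ‖Pᵀ * P‖ = ‖P‖ * ‖P‖ := by
      rw [← Matrix.conjTranspose_eq_transpose_of_trivial, Matrix.l2_opNorm_conjTranspose_mul_self]
    have e3 : ‖Pᵀ * P‖ ≤ c⁻¹ * ‖P‖ := by
      refine opNorm_le_of_forall _ (by positivity) fun x => ?_
      have h5 := h (Matrix.toEuclideanLin (Pᵀ * P) x)
      have h6 : Matrix.toEuclideanLin Hᵀ (Matrix.toEuclideanLin (Pᵀ * P) x)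
          = Matrix.toEuclideanLin P x := by
        conv_rhs => rw [e]
        simp [Matrix.toLpLin_apply, Matrix.mulVec_mulVec]
      rw [h6] at h5
      have h7 := h5.trans (norm_toEuclideanLin_le P x)
      rw [mul_assoc, inv_mul_eq_div, le_div_iff₀ hc]
      linarith
    rw [e2] at e3
    rcases (norm_nonneg P).eq_or_lt with h0 | h0
    · rw [← h0]; positivity
    · exact le_of_mul_le_mul_right e3 h0

/-! ### The trace norm and its duality with the operator norm. -/

section TraceNorm

set_option linter.unusedSectionVars false

variable {n n' : Type} [Fintype n] [DecidableEq n] [Fintype n'] [DecidableEq n']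

theorem traceNorm_eq_sum (M : Matrix n n ℂ) :
    traceNorm M = ∑ i : Fin (Module.finrank ℂ (EuclideanSpace ℂ n)), sing M i := by
  rw [traceNorm, Fin.sum_univ_eq_sum_range (fun i => sing M i), finrank_euclideanSpace]

theorem traceNorm_nonneg (M : Matrix n n ℂ) : 0 ≤ traceNorm M :=
  Finset.sum_nonneg fun i _ => sing_nonneg M i

theorem trace_eq_sum_inner {ι : Type*} [Fintype ι] (M : Matrix n n ℂ)
    (b : OrthonormalBasis ι ℂ (EuclideanSpace ℂ n)) :
    M.trace = ∑ i, inner ℂ (b i) (Matrix.toEuclideanLin M (b i)) := by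
  rw [← LinearMap.trace_eq_sum_inner]
  have h : Matrix.toEuclideanLin M
      = Matrix.toLin (PiLp.basisFun 2 ℂ n) (PiLp.basisFun 2 ℂ n) M := rfl
  rw [h, Matrix.trace_toLin_eq]

/-- The left singular vectors of `M`, normalised, or zero. -/
noncomputable def leftVec (M : Matrix n n ℂ)
    (i : Fin (Module.finrank ℂ (EuclideanSpace ℂ n))) : EuclideanSpace ℂ n :=
  ((sing M i)⁻¹ : ℂ) • Matrix.toEuclideanLin M (rightBasis (Matrix.toEuclideanLin M) i)

theorem norm_leftVec_le (M : Matrix n n ℂ)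
    (i : Fin (Module.finrank ℂ (EuclideanSpace ℂ n))) : ‖leftVec M i‖ ≤ 1 := by
  have h := norm_apply_rightBasis (Matrix.toEuclideanLin M) i
  rw [leftVec, norm_smul, h]
  change ‖((sing M i)⁻¹ : ℂ)‖ * sing M i ≤ 1
  rw [norm_inv, Complex.norm_real, Real.norm_of_nonneg (sing_nonneg M i)]
  -- Also valid for a vanishing singular value, because 0⁻¹ = 0.
  exact inv_mul_le_one

theorem sing_smul_leftVec (M : Matrix n n ℂ)
    (i : Fin (Module.finrank ℂ (EuclideanSpace ℂ n))) :
    (sing M i : ℂ) • leftVec M i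
      = Matrix.toEuclideanLin M (rightBasis (Matrix.toEuclideanLin M) i) := by
  have h := norm_apply_rightBasis (Matrix.toEuclideanLin M) i
  rw [leftVec, smul_smul]
  by_cases h0 : sing M i = 0
  · have h1 : Matrix.toEuclideanLin M (rightBasis (Matrix.toEuclideanLin M) i) = 0 := by
      rw [← norm_eq_zero, h]
      exact h0
    rw [h1, smul_zero]
  · rw [mul_inv_cancel₀ (by exact_mod_cast h0), one_smul]

/-- A singular value decomposition as a sum of operators of rank one. -/
theorem exists_eq_sum_vecMulVec (M : Matrix n n ℂ) :
    ∃ u v : Fin (Module.finrank ℂ (EuclideanSpace ℂ n)) → EuclideanSpace ℂ n,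
      (∀ i, ‖u i‖ ≤ 1) ∧ (∀ i, ‖v i‖ ≤ 1) ∧
      M = ∑ i : Fin (Module.finrank ℂ (EuclideanSpace ℂ n)),
        (sing M i : ℂ) • Matrix.vecMulVec (u i).ofLp (star (v i).ofLp) := by
  refine ⟨leftVec M, rightBasis (Matrix.toEuclideanLin M), norm_leftVec_le M,
    fun i => ((rightBasis _).orthonormal.1 i).le, ?_⟩
  set b := rightBasis (Matrix.toEuclideanLin M) with hb
  ext x y
  have h1 : M x y = (Matrix.toEuclideanLin M (EuclideanSpace.single y 1)) x := by
    simp [Matrix.toLpLin_apply]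
  rw [h1, ← b.sum_repr' (EuclideanSpace.single y 1)]
  have he : ∀ i, Matrix.toEuclideanLin M (b i) = (sing M i : ℂ) • leftVec M i :=
    fun i => (sing_smul_leftVec M i).symm
  simp only [map_sum, map_smul, he]
  simp only [WithLp.ofLp_sum, Finset.sum_apply, Matrix.sum_apply, Matrix.smul_apply,
    Matrix.vecMulVec_apply, WithLp.ofLp_smul, Pi.smul_apply, smul_eq_mul, Pi.star_apply,
    EuclideanSpace.inner_single_right]
  refine Finset.sum_congr rfl fun i _ => ?_
  simp
  ring

theorem norm_trace_vecMulVec_mul_le (u v : EuclideanSpace ℂ n) (T : Matrix n n ℂ) :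
    ‖(Matrix.vecMulVec u.ofLp (star v.ofLp) * T).trace‖ ≤ ‖u‖ * ‖v‖ * ‖T‖ := by
  have h : (Matrix.vecMulVec u.ofLp (star v.ofLp) * T).trace
      = inner ℂ v (Matrix.toEuclideanLin T u) := by
    rw [Matrix.trace_mul_comm, Matrix.mul_vecMulVec, Matrix.trace_vecMulVec]
    rfl
  rw [h]
  calc _ ≤ ‖v‖ * ‖Matrix.toEuclideanLin T u‖ := norm_inner_le_norm _ _
    _ ≤ ‖v‖ * (‖T‖ * ‖u‖) := by gcongr; exact norm_toEuclideanLin_le T u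
    _ = _ := by ring

theorem norm_trace_sum_vecMulVec_mul_le {ι : Type*} [Fintype ι] (s : ι → ℝ) (hs : ∀ i, 0 ≤ s i)
    (u v : ι → EuclideanSpace ℂ n) (hu : ∀ i, ‖u i‖ ≤ 1) (hv : ∀ i, ‖v i‖ ≤ 1)
    (T : Matrix n n ℂ) :
    ‖((∑ i, (s i : ℂ) • Matrix.vecMulVec (u i).ofLp (star (v i).ofLp)) * T).trace‖
      ≤ (∑ i, s i) * ‖T‖ := by
  rw [Matrix.sum_mul, Matrix.trace_sum, Finset.sum_mul]
  refine (norm_sum_le _ _).trans (Finset.sum_le_sum fun i _ => ?_)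
  rw [Matrix.smul_mul, Matrix.trace_smul, norm_smul, Complex.norm_real,
    Real.norm_of_nonneg (hs i)]
  refine mul_le_mul_of_nonneg_left ?_ (hs i)
  refine (norm_trace_vecMulVec_mul_le _ _ _).trans ?_
  have : ‖u i‖ * ‖v i‖ ≤ 1 := mul_le_one₀ (hu i) (norm_nonneg _) (hv i)
  calc _ ≤ 1 * ‖T‖ := by gcongr
    _ = _ := one_mul _

theorem norm_trace_mul_le_traceNorm (M T : Matrix n n ℂ) :
    ‖(M * T).trace‖ ≤ traceNorm M * ‖T‖ := by
  obtain ⟨u, v, hu, hv, h⟩ := exists_eq_sum_vecMulVec M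
  conv_lhs => rw [h]
  rw [traceNorm_eq_sum]
  exact norm_trace_sum_vecMulVec_mul_le
    (fun i : Fin (Module.finrank ℂ (EuclideanSpace ℂ n)) => sing M i)
    (fun i => sing_nonneg M i) u v hu hv T

/-- The maximiser is the adjoint of the partial isometry W in the polar decomposition, which sends
right to left singular vectors. It is a contraction since the left singular vectors are orthogonal
of length at most 1. -/
theorem exists_trace_mul_eq_traceNorm (M : Matrix n n ℂ) :
    ∃ T : Matrix n n ℂ, ‖T‖ ≤ 1 ∧ (M * T).trace = traceNorm M := by
  set b := rightBasis (Matrix.toEuclideanLin M) with hb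
  set W : Matrix n n ℂ :=
    Matrix.toEuclideanLin.symm (b.toBasis.constr ℂ (leftVec M)) with hW
  have hWb : ∀ i, Matrix.toEuclideanLin W (b i) = leftVec M i := by
    intro i
    rw [hW, LinearEquiv.apply_symm_apply, ← b.coe_toBasis, Module.Basis.constr_basis]
  have horth : ∀ i j, i ≠ j → inner ℂ (leftVec M i) (leftVec M j) = 0 := by
    intro i j hij
    rw [leftVec, leftVec, inner_smul_left, inner_smul_right, inner_apply_rightBasis_ne _ hij]
    simp
  refine ⟨Wᴴ, ?_, ?_⟩
  · rw [Matrix.l2_opNorm_conjTranspose]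
    refine opNorm_le_of_forall _ zero_le_one fun x => ?_
    rw [one_mul]
    refine le_of_sq_le_sq ?_ (norm_nonneg _)
    rw [← b.sum_sq_norm_inner_right x]
    have e : Matrix.toEuclideanLin W x = ∑ i, inner ℂ (b i) x • leftVec M i := by
      conv_lhs => rw [← b.sum_repr' x]
      simp [hWb]
    have e2 : inner ℂ (Matrix.toEuclideanLin W x) (Matrix.toEuclideanLin W x)
        = ((∑ i, ‖inner ℂ (b i) x‖ ^ 2 * ‖leftVec M i‖ ^ 2 : ℝ) : ℂ) := by
      rw [e]
      simp only [sum_inner, inner_sum, inner_smul_left, inner_smul_right]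
      push_cast
      refine Finset.sum_congr rfl fun i _ => ?_
      rw [Finset.sum_eq_single i]
      · rw [inner_self_eq_norm_sq_to_K, ← Complex.conj_mul']
        simp
        ring
      · intro j _ hj
        rw [horth _ _ hj]
        simp
      · simp
    rw [inner_self_eq_norm_sq_to_K] at e2
    have e3 : ‖Matrix.toEuclideanLin W x‖ ^ 2
        = ∑ i, ‖inner ℂ (b i) x‖ ^ 2 * ‖leftVec M i‖ ^ 2 := Complex.ofReal_injective (by simpa using e2)
    rw [e3]
    refine Finset.sum_le_sum fun i _ => ?_
    exact mul_le_of_le_one_right (by positivity)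
      (pow_le_one₀ (norm_nonneg _) (norm_leftVec_le M i))
  · rw [Matrix.trace_mul_comm, trace_eq_sum_inner _ b, traceNorm_eq_sum]
    push_cast
    refine Finset.sum_congr rfl fun i _ => ?_
    have e : inner ℂ (b i) (Matrix.toEuclideanLin (Wᴴ * M) (b i))
        = inner ℂ (Matrix.toEuclideanLin W (b i)) (Matrix.toEuclideanLin M (b i)) := by
      rw [← LinearMap.adjoint_inner_right, ← Matrix.toEuclideanLin_conjTranspose_eq_adjoint]
      simp [Matrix.toLpLin_apply, Matrix.mulVec_mulVec]
    rw [e, hWb, leftVec, inner_smul_left, ← hb, inner_self_eq_norm_sq_to_K]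
    have h := norm_apply_rightBasis (Matrix.toEuclideanLin M) i
    rw [← hb] at h
    rw [h]
    change (starRingEnd ℂ) ((sing M i : ℂ)⁻¹) * (sing M i : ℂ) ^ 2 = sing M i
    by_cases h0 : (sing M i : ℂ) = 0
    · simp [h0]
    · rw [map_inv₀, Complex.conj_ofReal]
      field_simp

/-- The working form of duality: a trace norm is bounded by testing against contractions.
Subadditivity, contractivity of the partial trace and the bounds on prefixes and tails all come from
it. -/
theorem traceNorm_le_of_forall (M : Matrix n n ℂ) {c : ℝ}
    (h : ∀ T : Matrix n n ℂ, ‖T‖ ≤ 1 → ‖(M * T).trace‖ ≤ c) : traceNorm M ≤ c := by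
  obtain ⟨T, hT, e⟩ := exists_trace_mul_eq_traceNorm M
  have := h T hT
  rwa [e, Complex.norm_real, Real.norm_of_nonneg (traceNorm_nonneg M)] at this

theorem traceNorm_add_le (M M' : Matrix n n ℂ) :
    traceNorm (M + M') ≤ traceNorm M + traceNorm M' := by
  refine traceNorm_le_of_forall _ fun T hT => ?_
  rw [Matrix.add_mul, Matrix.trace_add]
  refine (norm_add_le _ _).trans ?_
  gcongr
  · exact (norm_trace_mul_le_traceNorm M T).trans
      (mul_le_of_le_one_right (traceNorm_nonneg M) hT)
  · exact (norm_trace_mul_le_traceNorm M' T).trans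
      (mul_le_of_le_one_right (traceNorm_nonneg M') hT)

theorem traceNorm_zero : traceNorm (0 : Matrix n n ℂ) = 0 :=
  le_antisymm (traceNorm_le_of_forall _ fun T _ => by simp) (traceNorm_nonneg _)

theorem traceNorm_sum_le {ι : Type*} (s : Finset ι) (f : ι → Matrix n n ℂ) :
    traceNorm (∑ i ∈ s, f i) ≤ ∑ i ∈ s, traceNorm (f i) :=
  Finset.le_sum_of_subadditive traceNorm traceNorm_zero.le traceNorm_add_le s f

theorem traceNorm_neg (M : Matrix n n ℂ) : traceNorm (-M) = traceNorm M := by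
  have key : ∀ M : Matrix n n ℂ, traceNorm (-M) ≤ traceNorm M := fun M =>
    traceNorm_le_of_forall _ fun T hT => by
      rw [Matrix.neg_mul, Matrix.trace_neg, norm_neg]
      exact (norm_trace_mul_le_traceNorm M T).trans
        (mul_le_of_le_one_right (traceNorm_nonneg M) hT)
  refine le_antisymm (key M) ?_
  simpa using key (-M)

theorem opNorm_submatrix_equiv (e : n ≃ n') (T : Matrix n' n' ℂ) : ‖T.submatrix e e‖ = ‖T‖ := by
  have key : ∀ {n n' : Type} [Fintype n] [DecidableEq n] [Fintype n'] [DecidableEq n']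
      (e : n ≃ n') (T : Matrix n' n' ℂ), ‖T.submatrix e e‖ ≤ ‖T‖ := by
    intro n n' _ _ _ _ e T
    refine opNorm_le_of_forall _ (norm_nonneg _) fun x => ?_
    have h1 : ‖x‖ = ‖(WithLp.toLp 2 (x.ofLp ∘ e.symm) : EuclideanSpace ℂ n')‖ := by
      rw [EuclideanSpace.norm_eq, EuclideanSpace.norm_eq]
      congr 1
      exact Fintype.sum_equiv e _ _ (by simp)
    have h2 : ‖Matrix.toEuclideanLin (T.submatrix e e) x‖
        = ‖Matrix.toEuclideanLin T (WithLp.toLp 2 (x.ofLp ∘ e.symm))‖ := by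
      rw [EuclideanSpace.norm_eq, EuclideanSpace.norm_eq]
      congr 1
      refine Fintype.sum_equiv e _ _ fun i => ?_
      rw [Matrix.toLpLin_apply, Matrix.toLpLin_apply, Matrix.submatrix_mulVec_equiv]
      simp
    rw [h1, h2]
    exact norm_toEuclideanLin_le _ _
  refine le_antisymm (key e T) ?_
  simpa using key e.symm (T.submatrix e e)

theorem trace_submatrix_equiv (e : n ≃ n') (T : Matrix n' n' ℂ) :
    (T.submatrix e e).trace = T.trace :=
  Fintype.sum_equiv e _ _ (by simp)

theorem traceNorm_submatrix_equiv (e : n ≃ n') (M : Matrix n' n' ℂ) :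
    traceNorm (M.submatrix e e) = traceNorm M := by
  have key : ∀ {n n' : Type} [Fintype n] [DecidableEq n] [Fintype n'] [DecidableEq n']
      (e : n ≃ n') (M : Matrix n' n' ℂ), traceNorm (M.submatrix e e) ≤ traceNorm M := by
    intro n n' _ _ _ _ e M
    refine traceNorm_le_of_forall _ fun T hT => ?_
    have h : (M.submatrix e e * T) = (M * T.submatrix e.symm e.symm).submatrix e e := by
      rw [← Matrix.submatrix_mul_equiv _ _ _ e]
      simp
    rw [h, trace_submatrix_equiv]
    refine (norm_trace_mul_le_traceNorm _ _).trans ?_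
    rw [opNorm_submatrix_equiv]
    exact mul_le_of_le_one_right (traceNorm_nonneg M) hT
  refine le_antisymm (key e M) ?_
  simpa using key e.symm (M.submatrix e e)

theorem norm_toLp_mul (u : EuclideanSpace ℂ n) (v : EuclideanSpace ℂ n') :
    ‖(WithLp.toLp 2 fun x : n × n' => u x.1 * v x.2 : EuclideanSpace ℂ (n × n'))‖
      = ‖u‖ * ‖v‖ := by
  rw [EuclideanSpace.norm_eq, EuclideanSpace.norm_eq, EuclideanSpace.norm_eq, ← Real.sqrt_mul
    (by positivity), Finset.sum_mul_sum, Fintype.sum_prod_type]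
  simp [mul_pow]

/-- Tensoring the two singular value decompositions gives a sum of rank-one operators whose weights
are the products of singular values. -/
theorem traceNorm_kronecker_le (P : Matrix n n ℂ) (C : Matrix n' n' ℂ) :
    traceNorm (P ⊗ₖ C) ≤ traceNorm P * traceNorm C := by
  obtain ⟨u, v, hu, hv, h⟩ := exists_eq_sum_vecMulVec P
  obtain ⟨u', v', hu', hv', h'⟩ := exists_eq_sum_vecMulVec C
  refine traceNorm_le_of_forall _ fun T hT => ?_
  have e : P ⊗ₖ C = ∑ x : Fin (Module.finrank ℂ (EuclideanSpace ℂ n)) ×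
        Fin (Module.finrank ℂ (EuclideanSpace ℂ n')),
      ((sing P x.1 * sing C x.2 : ℝ) : ℂ) •
        Matrix.vecMulVec
          (WithLp.toLp 2 fun y : n × n' => u x.1 y.1 * u' x.2 y.2 : EuclideanSpace ℂ _).ofLp
          (star
            (WithLp.toLp 2 fun y : n × n' => v x.1 y.1 * v' x.2 y.2 : EuclideanSpace ℂ _).ofLp) := by
    conv_lhs => rw [h, h']
    ext ⟨a, b⟩ ⟨a', b'⟩
    simp only [Matrix.kronecker_apply, Matrix.sum_apply, Matrix.smul_apply,
      Matrix.vecMulVec_apply, Pi.star_apply, smul_eq_mul, Finset.sum_mul_sum,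
      Fintype.sum_prod_type]
    refine Finset.sum_congr rfl fun i _ => Finset.sum_congr rfl fun j _ => ?_
    simp
    ring
  rw [e]
  refine (norm_trace_sum_vecMulVec_mul_le _
    (fun x => mul_nonneg (sing_nonneg P _) (sing_nonneg C _)) _ _ ?_ ?_ T).trans ?_
  · intro x
    rw [norm_toLp_mul]
    exact mul_le_one₀ (hu _) (norm_nonneg _) (hu' _)
  · intro x
    rw [norm_toLp_mul]
    exact mul_le_one₀ (hv _) (norm_nonneg _) (hv' _)
  · rw [traceNorm_eq_sum, traceNorm_eq_sum, Finset.sum_mul_sum, ← Fintype.sum_prod_type']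
    exact mul_le_of_le_one_right
      (Finset.sum_nonneg fun x _ => mul_nonneg (sing_nonneg P _) (sing_nonneg C _)) hT

/-- On each slice with fixed second index the operator acts as T. -/
theorem opNorm_kronecker_one (T : Matrix n n ℂ) : ‖T ⊗ₖ (1 : Matrix n' n' ℂ)‖ ≤ ‖T‖ := by
  refine opNorm_le_of_forall _ (norm_nonneg _) fun x => ?_
  refine le_of_sq_le_sq ?_ (by positivity)
  rw [mul_pow, EuclideanSpace.norm_sq_eq, EuclideanSpace.norm_sq_eq, Fintype.sum_prod_type_right,
    Fintype.sum_prod_type_right, Finset.mul_sum]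
  refine Finset.sum_le_sum fun z _ => ?_
  have h := norm_toEuclideanLin_le T (WithLp.toLp 2 fun i => x (i, z))
  have h2 := pow_le_pow_left₀ (norm_nonneg _) h 2
  rw [mul_pow, EuclideanSpace.norm_sq_eq, EuclideanSpace.norm_sq_eq] at h2
  convert h2 using 4 with i
  simp [Matrix.toLpLin_apply, Matrix.mulVec, dotProduct, Fintype.sum_prod_type, Matrix.one_apply]

theorem opNorm_kronecker_le (T : Matrix n n ℂ) (T' : Matrix n' n' ℂ) :
    ‖T ⊗ₖ T'‖ ≤ ‖T‖ * ‖T'‖ := by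
  have e : T ⊗ₖ T' = (T ⊗ₖ (1 : Matrix n' n' ℂ)) *
      ((T' ⊗ₖ (1 : Matrix n n ℂ)).submatrix (Equiv.prodComm n n') (Equiv.prodComm n n')) := by
    have : ((T' ⊗ₖ (1 : Matrix n n ℂ)).submatrix (Equiv.prodComm n n') (Equiv.prodComm n n'))
        = (1 : Matrix n n ℂ) ⊗ₖ T' := by
      ext ⟨a, b⟩ ⟨c, d⟩
      simp [mul_comm]
    rw [this, ← Matrix.mul_kronecker_mul, Matrix.mul_one, Matrix.one_mul]
  rw [e]
  refine (Matrix.l2_opNorm_mul _ _).trans ?_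
  rw [opNorm_submatrix_equiv]
  gcongr
  · exact opNorm_kronecker_one T
  · exact opNorm_kronecker_one T'

/-- Testing M against its own adjoint gives ‖M‖₂² ≤ ‖M‖₁ ‖M‖ ≤ ‖M‖₁ ‖M‖₂. -/
theorem hsNorm_le_traceNorm (M : Matrix n n ℂ) : hsNorm M ≤ traceNorm M := by
  have h1 := norm_trace_mul_le_traceNorm M Mᴴ
  rw [Matrix.trace_mul_comm, trace_conjTranspose_mul_self, Matrix.l2_opNorm_conjTranspose] at h1
  have h2 := opNorm_le_hsNorm M
  have h3 := traceNorm_nonneg M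
  have h4 := hsNorm_nonneg M
  have h5 : ‖((hsNorm M ^ 2 : ℝ) : ℂ)‖ = hsNorm M ^ 2 := by
    rw [Complex.norm_real, Real.norm_of_nonneg (by positivity)]
  have h6 : ‖(RCLike.ofReal (hsNorm M ^ 2) : ℂ)‖ = hsNorm M ^ 2 := h5
  rw [h6] at h1
  rcases h4.eq_or_lt with h0 | h0
  · rw [← h0]; exact h3
  · have : hsNorm M * hsNorm M ≤ traceNorm M * hsNorm M := by nlinarith
    exact le_of_mul_le_mul_right this h0

theorem traceNorm_le_sqrt_card_mul_hsNorm (M : Matrix n n ℂ) :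
    traceNorm M ≤ √(Fintype.card n) * hsNorm M := by
  refine traceNorm_le_of_forall _ fun T hT => (norm_trace_mul_le M T).trans ?_
  rw [mul_comm]
  have := hsNorm_le_sqrt_card_mul T
  have h2 := hsNorm_nonneg M
  gcongr
  calc hsNorm T ≤ √(Fintype.card n) * ‖T‖ := this
    _ ≤ √(Fintype.card n) * 1 := by gcongr
    _ = _ := mul_one _

theorem traceNorm_posSemidef_le {ρ : Matrix n n ℂ} (h : ρ.PosSemidef) :
    traceNorm ρ ≤ ρ.trace.re := by
  obtain ⟨k, S, rfl⟩ := Matrix.posSemidef_iff_eq_sum_vecMulVec.1 h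
  refine traceNorm_le_of_forall _ fun T hT => ?_
  rw [Matrix.sum_mul, Matrix.trace_sum, Matrix.trace_sum, Complex.re_sum]
  refine (norm_sum_le _ _).trans (Finset.sum_le_sum fun i _ => ?_)
  refine (norm_trace_vecMulVec_mul_le (WithLp.toLp 2 (S i)) (WithLp.toLp 2 (S i)) T).trans ?_
  refine (mul_le_of_le_one_right (by positivity) hT).trans ?_
  rw [← sq, EuclideanSpace.norm_sq_eq, Matrix.trace_vecMulVec, dotProduct, Complex.re_sum]
  refine Finset.sum_le_sum fun j _ => ?_
  simp [Complex.mul_conj, Complex.normSq_eq_norm_sq, -Complex.ofReal_pow]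

theorem opNorm_one_le {𝕜 : Type} [RCLike 𝕜] : ‖(1 : Matrix n n 𝕜)‖ ≤ 1 :=
  opNorm_le_of_forall _ zero_le_one fun x => by simp

/-- A traceless self-adjoint operator satisfies `√2 ‖M‖₂ ≤ ‖M‖₁`. -/
theorem two_mul_hsNorm_sq_le {M : Matrix n n ℂ} (hM : M.IsHermitian) (h0 : M.trace = 0) :
    2 * hsNorm M ^ 2 ≤ traceNorm M ^ 2 := by
  set lam := hM.eigenvalues
  set V : Matrix n n ℂ := (hM.eigenvectorUnitary : Matrix n n ℂ) with hV
  have hVV : star V * V = 1 := Unitary.coe_star_mul_self hM.eigenvectorUnitary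
  have hVV' : V * star V = 1 := Unitary.coe_mul_star_self hM.eigenvectorUnitary
  have hspec : M = V * Matrix.diagonal (fun i => (lam i : ℂ)) * star V := by
    have h := hM.spectral_theorem
    rw [Unitary.conjStarAlgAut_apply] at h
    exact h
  have hVn : ‖V‖ ≤ 1 := by
    have h := CStarRing.norm_star_mul_self (x := V)
    rw [hVV] at h
    have h2 := opNorm_one_le (n := n) (𝕜 := ℂ)
    nlinarith [norm_nonneg V]
  have hsum : ∑ i, lam i = 0 := by
    have h := hM.trace_eq_sum_eigenvalues
    rw [h0] at h
    exact Complex.ofReal_injective (by simpa [lam] using h.symm)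
  have hs2 : hsNorm M ^ 2 = ∑ i, lam i ^ 2 := by
    have h1 := trace_conjTranspose_mul_self M
    have h2 : (Mᴴ * M).trace = ((∑ i, lam i ^ 2 : ℝ) : ℂ) := by
      rw [hM.eq]
      have : M * M = V * Matrix.diagonal (fun i => (lam i : ℂ) * lam i) * star V := by
        conv_lhs => rw [hspec]
        calc V * Matrix.diagonal (fun i => (lam i : ℂ)) * star V *
              (V * Matrix.diagonal (fun i => (lam i : ℂ)) * star V)
            = V * Matrix.diagonal (fun i => (lam i : ℂ)) * (star V * V) *
              Matrix.diagonal (fun i => (lam i : ℂ)) * star V := by simp only [Matrix.mul_assoc]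
          _ = _ := by rw [hVV, Matrix.mul_one, Matrix.mul_assoc V, Matrix.diagonal_mul_diagonal]
      rw [this, Matrix.trace_mul_comm, ← Matrix.mul_assoc, hVV, Matrix.one_mul,
        Matrix.trace_diagonal]
      push_cast
      simp [sq]
    rw [h2] at h1
    exact Complex.ofReal_injective h1.symm
  -- M is tested against its sign, a contraction.
  have hs1 : ∑ i, |lam i| ≤ traceNorm M := by
    set T : Matrix n n ℂ :=
      V * Matrix.diagonal (fun i => ((SignType.sign (lam i) : ℝ) : ℂ)) * star V with hT
    have hTn : ‖T‖ ≤ 1 := by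
      have hd : ‖Matrix.diagonal (fun i => ((SignType.sign (lam i) : ℝ) : ℂ))‖ ≤ 1 := by
        rw [Matrix.l2_opNorm_diagonal, pi_norm_le_iff_of_nonneg zero_le_one]
        intro i
        rcases lt_trichotomy (lam i) 0 with h | h | h <;> simp [h]
      calc ‖T‖ ≤ ‖V‖ * ‖Matrix.diagonal (fun i => ((SignType.sign (lam i) : ℝ) : ℂ))‖ * ‖star V‖ := by
            refine (norm_mul_le _ _).trans ?_
            gcongr
            exact norm_mul_le _ _
        _ ≤ 1 * 1 * 1 := by
            rw [norm_star]
            gcongr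
        _ = 1 := by norm_num
    have h1 := norm_trace_mul_le_traceNorm M T
    have h2 : (M * T).trace = ((∑ i, |lam i| : ℝ) : ℂ) := by
      have : M * T = V * Matrix.diagonal
          (fun i => (lam i : ℂ) * ((SignType.sign (lam i) : ℝ) : ℂ)) * star V := by
        conv_lhs => rw [hspec, hT]
        calc V * Matrix.diagonal (fun i => (lam i : ℂ)) * star V *
              (V * Matrix.diagonal (fun i => ((SignType.sign (lam i) : ℝ) : ℂ)) * star V)
            = V * Matrix.diagonal (fun i => (lam i : ℂ)) * (star V * V) *
              Matrix.diagonal (fun i => ((SignType.sign (lam i) : ℝ) : ℂ)) * star V := by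
                simp only [Matrix.mul_assoc]
          _ = _ := by rw [hVV, Matrix.mul_one, Matrix.mul_assoc V, Matrix.diagonal_mul_diagonal]
      rw [this, Matrix.trace_mul_comm, ← Matrix.mul_assoc, hVV, Matrix.one_mul,
        Matrix.trace_diagonal]
      push_cast
      refine Finset.sum_congr rfl fun i _ => ?_
      rw [← Complex.ofReal_mul, self_mul_sign]
    rw [h2, Complex.norm_real, Real.norm_of_nonneg (by positivity)] at h1
    exact h1.trans (mul_le_of_le_one_right (traceNorm_nonneg M) hTn)
  -- The eigenvalues sum to zero, so each one is balanced by the others and carries at most half of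
  -- the total absolute weight.
  have hmax : ∀ i, 2 * |lam i| ≤ ∑ j, |lam j| := by
    intro i
    rw [← Finset.add_sum_erase _ _ (Finset.mem_univ i)] at hsum ⊢
    have h1 : |lam i| = |∑ j ∈ Finset.univ.erase i, lam j| := by
      rw [eq_neg_of_add_eq_zero_left hsum, abs_neg]
    have h2 := Finset.abs_sum_le_sum_abs lam (Finset.univ.erase i)
    linarith
  calc 2 * hsNorm M ^ 2 = ∑ i, 2 * |lam i| * |lam i| := by
        rw [hs2, Finset.mul_sum]
        refine Finset.sum_congr rfl fun i _ => ?_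
        rw [mul_assoc, abs_mul_abs_self, sq]
    _ ≤ ∑ i, (∑ j, |lam j|) * |lam i| := by
        gcongr with i
        exact hmax i
    _ = (∑ j, |lam j|) ^ 2 := by rw [← Finset.mul_sum, sq]
    _ ≤ _ := by gcongr

end TraceNorm

/-! ### Product operators -/

section ProdOp

set_option linter.unusedSectionVars false

variable {S : Type} [Fintype S] [DecidableEq S] {d : ℕ}

theorem conjTranspose_prodOp (X : S → Matrix (Fin d) (Fin d) ℂ) :
    (prodOp X)ᴴ = prodOp (fun i => (X i)ᴴ) := by
  ext x y
  simp [prodOp, Matrix.conjTranspose_apply]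

theorem prodOp_mul (X Y : S → Matrix (Fin d) (Fin d) ℂ) :
    prodOp X * prodOp Y = prodOp (fun i => X i * Y i) := by
  ext x y
  simp only [prodOp, Matrix.mul_apply, ← Finset.prod_mul_distrib]
  rw [Fintype.prod_sum]

theorem trace_prodOp (X : S → Matrix (Fin d) (Fin d) ℂ) :
    (prodOp X).trace = ∏ i, (X i).trace := by
  simp only [prodOp, Matrix.trace, Matrix.diag]
  rw [Fintype.prod_sum]

theorem prodOp_sum {q : ℕ} (Z : Fin q → Matrix (Fin d) (Fin d) ℂ) (t : S → Fin q → ℂ) :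
    prodOp (fun i => ∑ c, t i c • Z c)
      = ∑ w : S → Fin q, (∏ i, t i (w i)) • prodOp (fun i => Z (w i)) := by
  ext x y
  simp only [prodOp, Matrix.sum_apply, Matrix.smul_apply, smul_eq_mul, ← Finset.prod_mul_distrib]
  rw [Fintype.prod_sum]

theorem prod_one_apply {α : Type*} [DecidableEq α] (x y : S → α) :
    ∏ i, (1 : Matrix α α ℂ) (x i) (y i) = if x = y then 1 else 0 := by
  simp only [Matrix.one_apply]
  rw [Finset.prod_ite_zero]
  simp [funext_iff]

theorem single_eq_prodOp (x y : S → Fin d) :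
    Matrix.single x y (1 : ℂ) = prodOp fun i => Matrix.single (x i) (y i) 1 := by
  ext x' y'
  simp only [prodOp, Matrix.single_apply]
  rw [Finset.prod_ite_zero]
  simp [funext_iff, forall_and]

/-- Product operators span all operators. -/
theorem linearMap_ext_prodOp {V : Type*} [AddCommGroup V] [Module ℂ V] {f g : Op S d →ₗ[ℂ] V}
    (h : ∀ X, f (prodOp X) = g (prodOp X)) : f = g := by
  refine LinearMap.ext fun T => ?_
  rw [Matrix.matrix_eq_sum_single T]
  simp only [map_sum]
  refine Finset.sum_congr rfl fun x _ => Finset.sum_congr rfl fun y _ => ?_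
  have e : Matrix.single x y (T x y) = T x y • Matrix.single x y (1 : ℂ) := by
    simp
  rw [e, map_smul, map_smul, single_eq_prodOp, h]

end ProdOp

/-! ### Product bases -/

section Basis

set_option linter.unusedSectionVars false

variable {S : Type} [Fintype S] [DecidableEq S] {d q : ℕ}
  {A : StarSubalgebra ℂ (Matrix (Fin d) (Fin d) ℂ)} {Z : Fin q → Matrix (Fin d) (Fin d) ℂ}

/-- The basis product indexed by the word `w`. -/
def basisOp (Z : Fin q → Matrix (Fin d) (Fin d) ℂ) (w : S → Fin q) : Op S d :=
  prodOp fun i => Z (w i)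

/-- The coefficient of `τ` at the basis product indexed by `w`. -/
noncomputable def coef (Z : Fin q → Matrix (Fin d) (Fin d) ℂ) (τ : Op S d) (w : S → Fin q) : ℝ :=
  (τ * basisOp Z w).trace.re

theorem conjTranspose_basisOp (hZ : IsSelfAdjointONB A Z) (w : S → Fin q) :
    (basisOp Z w)ᴴ = basisOp Z w := by
  rw [basisOp, conjTranspose_prodOp]
  congr 1
  funext i
  exact (hZ.isHermitian _).eq

theorem trace_basisOp_mul (hZ : IsSelfAdjointONB A Z) (w w' : S → Fin q) :
    (basisOp Z w * basisOp Z w').trace = if w = w' then 1 else 0 := by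
  rw [basisOp, basisOp, prodOp_mul, trace_prodOp]
  simp only [hZ.trace_mul]
  rw [Finset.prod_ite_zero]
  simp [funext_iff]

theorem hsNorm_sum_basisOp_sq (hZ : IsSelfAdjointONB A Z) (t : (S → Fin q) → ℝ) :
    hsNorm (∑ w, (t w : ℂ) • basisOp Z w) ^ 2 = ∑ w, t w ^ 2 := by
  have h := trace_conjTranspose_mul_self (∑ w, (t w : ℂ) • basisOp Z w)
  have h2 : ((∑ w, (t w : ℂ) • basisOp Z w)ᴴ * ∑ w, (t w : ℂ) • basisOp Z w).trace
      = ((∑ w, t w ^ 2 : ℝ) : ℂ) := by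
    simp only [Matrix.conjTranspose_sum, Matrix.conjTranspose_smul, conjTranspose_basisOp hZ,
      Matrix.sum_mul, Matrix.mul_sum, Matrix.trace_sum, Matrix.smul_mul, Matrix.mul_smul,
      Matrix.trace_smul, trace_basisOp_mul hZ]
    push_cast
    simp [sq]
  rw [h2] at h
  exact Complex.ofReal_injective h.symm

/-- Bessel's inequality for the product basis. -/
theorem sum_coef_sq_le (hZ : IsSelfAdjointONB A Z) (τ : Op S d) :
    ∑ w, coef Z τ w ^ 2 ≤ hsNorm τ ^ 2 := by
  -- Pairing τ with this real combination of basis products gives the sum of the squared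
  -- coefficients, which is also ‖T‖₂²; Cauchy-Schwarz concludes.
  set T : Op S d := ∑ w, (coef Z τ w : ℂ) • basisOp Z w with hT
  have h1 := hsNorm_sum_basisOp_sq hZ (coef Z τ)
  rw [← hT] at h1
  have h2 : (τ * T).trace.re = ∑ w, coef Z τ w ^ 2 := by
    rw [hT, Matrix.mul_sum, Matrix.trace_sum, Complex.re_sum]
    refine Finset.sum_congr rfl fun w _ => ?_
    rw [Matrix.mul_smul, Matrix.trace_smul, smul_eq_mul, Complex.re_ofReal_mul, sq]
    rfl
  have h3 := (Complex.re_le_norm _).trans (norm_trace_mul_le τ T)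
  rw [h2, ← h1] at h3
  rw [← h1]
  have h4 := hsNorm_nonneg T
  have h5 := hsNorm_nonneg τ
  rcases h4.eq_or_lt with h0 | h0
  · rw [← h0, zero_pow two_ne_zero]; positivity
  · have : hsNorm T ≤ hsNorm τ := le_of_mul_le_mul_right (by rw [← sq]; exact h3) h0
    gcongr

theorem coef_sub (τ τ' : Op S d) (w : S → Fin q) :
    coef Z (τ - τ') w = coef Z τ w - coef Z τ' w := by
  simp [coef, Matrix.sub_mul]

theorem eq_sum_trace_smul (hZ : IsSelfAdjointONB A Z) {X : Matrix (Fin d) (Fin d) ℂ}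
    (hX : X ∈ A) : X = ∑ c, (X * Z c).trace • Z c := by
  have hX' : X ∈ Submodule.span ℂ (Set.range Z) := by
    rw [hZ.span_eq]
    exact hX
  obtain ⟨t, rfl⟩ := (Submodule.mem_span_range_iff_exists_fun ℂ).1 hX'
  refine Finset.sum_congr rfl fun c _ => ?_
  congr 1
  simp [Matrix.sum_mul, Matrix.trace_sum, hZ.trace_mul]

theorem prodOp_eq_sum (hZ : IsSelfAdjointONB A Z) {X : S → Matrix (Fin d) (Fin d) ℂ}
    (hX : ∀ i, X i ∈ A) :
    prodOp X = ∑ w : S → Fin q, (∏ i, (X i * Z (w i)).trace) • basisOp Z w := by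
  have h := prodOp_sum Z (fun i c => (X i * Z c).trace)
  rw [← show X = fun i => ∑ c, (X i * Z c).trace • Z c from
    funext fun i => eq_sum_trace_smul hZ (hX i)] at h
  exact h

theorem eq_sum_trace_basisOp (hZ : IsSelfAdjointONB A Z) {τ : Op S d} (hτ : τ ∈ localAlg A S) :
    τ = ∑ w, (τ * basisOp Z w).trace • basisOp Z w := by
  refine Submodule.span_induction ?_ ?_ ?_ ?_ hτ
  · rintro _ ⟨X, hX, rfl⟩
    conv_lhs => rw [prodOp_eq_sum hZ hX]
    refine Finset.sum_congr rfl fun w _ => ?_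
    rw [basisOp, prodOp_mul, trace_prodOp]
  · simp
  · intro x y _ _ hx hy
    conv_lhs => rw [hx, hy]
    rw [← Finset.sum_add_distrib]
    simp [Matrix.add_mul, add_smul]
  · intro a x _ hx
    conv_lhs => rw [hx]
    rw [Finset.smul_sum]
    simp [smul_smul]

/-- The trace of a product of two self-adjoint operators is real, so the real part taken in `coef`
loses nothing. -/
theorem trace_mul_basisOp (hZ : IsSelfAdjointONB A Z) {τ : Op S d} (hτ : τ.IsHermitian)
    (w : S → Fin q) : (τ * basisOp Z w).trace = (coef Z τ w : ℂ) := by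
  have h : (starRingEnd ℂ) (τ * basisOp Z w).trace = (τ * basisOp Z w).trace := by
    have h2 := Matrix.trace_conjTranspose (τ * basisOp Z w)
    rw [Matrix.conjTranspose_mul, conjTranspose_basisOp hZ, hτ.eq, Matrix.trace_mul_comm] at h2
    exact h2.symm
  exact (Complex.conj_eq_iff_re.1 h).symm

theorem eq_sum_coef_basisOp (hZ : IsSelfAdjointONB A Z) {τ : Op S d} (hτ : τ ∈ localAlg A S)
    (hτ' : τ.IsHermitian) : τ = ∑ w, (coef Z τ w : ℂ) • basisOp Z w := by
  conv_lhs => rw [eq_sum_trace_basisOp hZ hτ]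
  simp only [trace_mul_basisOp hZ hτ']

end Basis

/-! ### Extension by the identity and marginals -/

section Extension

set_option linter.unusedSectionVars false

theorem kronecker_apply_prod {n n' : Type*} (M : Matrix n n ℂ) (M' : Matrix n' n' ℂ)
    (x y : n × n') : (M ⊗ₖ M') x y = M x.1 y.1 * M' x.2 y.2 := rfl

variable {S : Type} [Fintype S] [DecidableEq S] {d : ℕ}

/-- The operator `T ⊗ 1` on `S`, where `T` acts on the sites satisfying `p`. -/
def extOp (p : S → Prop) [DecidablePred p] (T : Op {i // p i} d) : Op S d :=
  (T ⊗ₖ (1 : Op {i // ¬ p i} d)).submatrix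
    (Equiv.piEquivPiSubtypeProd p fun _ => Fin d) (Equiv.piEquivPiSubtypeProd p fun _ => Fin d)

theorem opNorm_extOp_le (p : S → Prop) [DecidablePred p] (T : Op {i // p i} d) :
    ‖extOp p T‖ ≤ ‖T‖ := by
  rw [extOp, opNorm_submatrix_equiv]
  exact opNorm_kronecker_one T

theorem extOp_one (p : S → Prop) [DecidablePred p] : extOp p (1 : Op {i // p i} d) = 1 := by
  rw [extOp, Matrix.one_kronecker_one, Matrix.submatrix_one_equiv]

theorem extOp_prodOp (p : S → Prop) [DecidablePred p] (g : {i // p i} → Matrix (Fin d) (Fin d) ℂ) :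
    extOp p (prodOp g) = prodOp fun i => if h : p i then g ⟨i, h⟩ else 1 := by
  ext x y
  rw [extOp, Matrix.submatrix_apply, kronecker_apply_prod, Matrix.one_apply,
    ← prod_one_apply, prodOp, prodOp, ← Fintype.prod_subtype_mul_prod_subtype p]
  congr 1
  · refine Finset.prod_congr rfl fun i _ => ?_
    rw [dif_pos i.2]
    rfl
  · refine Finset.prod_congr rfl fun i _ => ?_
    rw [dif_neg i.2]
    rfl

/-- `extOp` as a linear map. -/
def extLin (p : S → Prop) [DecidablePred p] : Op {i // p i} d →ₗ[ℂ] Op S d where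
  toFun := extOp p
  map_add' T T' := by
    ext x y
    simp [extOp, add_mul]
  map_smul' t T := by
    ext x y
    simp [extOp, mul_assoc]

end Extension

/-! ### Partial traces and inclusions of windows. -/

section Marginal

variable {d N : ℕ}

theorem marginal_sub (a b : ℕ) (ρ ρ' : Op (Fin N) d) :
    marginal a b (ρ - ρ') = marginal a b ρ - marginal a b ρ' := by
  ext x y
  simp [marginal]

theorem isHermitian_marginal (a b : ℕ) {ρ : Op (Fin N) d} (h : ρ.IsHermitian) :
    (marginal a b ρ).IsHermitian := by
  ext x y
  simp only [Matrix.conjTranspose_apply, marginal, star_sum]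
  refine Finset.sum_congr rfl fun z _ => ?_
  exact h.apply _ _

/-- The partial trace is dual to T ↦ T ⊗ 1, which turns bounds on extensions into bounds on
marginals. -/
theorem trace_marginal_mul (a b : ℕ) (ρ : Op (Fin N) d) (T : Op (Win N a b) d) :
    (marginal a b ρ * T).trace
      = (ρ * extOp (fun i : Fin N => a ≤ i.1 ∧ i.1 < b) T).trace := by
  set e := Equiv.piEquivPiSubtypeProd (fun i : Fin N => a ≤ i.1 ∧ i.1 < b) (fun _ => Fin d) with he
  have h : (ρ * extOp (fun i : Fin N => a ≤ i.1 ∧ i.1 < b) T).trace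
      = ((ρ.submatrix e.symm e.symm) *
        (T ⊗ₖ (1 : Op {i : Fin N // ¬ (a ≤ i.1 ∧ i.1 < b)} d))).trace := by
    rw [← trace_submatrix_equiv e, ← Matrix.submatrix_mul_equiv _ _ _ e]
    congr 2
    ext x y
    simp
  rw [h]
  simp only [Matrix.trace, Matrix.diag, Matrix.mul_apply, Fintype.sum_prod_type, marginal,
    Matrix.submatrix_apply, kronecker_apply_prod, Matrix.one_apply]
  refine Finset.sum_congr rfl fun x _ => ?_
  rw [Finset.sum_comm]
  refine Finset.sum_congr rfl fun y _ => ?_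
  rw [Finset.sum_mul]
  refine Finset.sum_congr rfl fun z _ => ?_
  simp [he]

theorem trace_marginal (a b : ℕ) (ρ : Op (Fin N) d) : (marginal a b ρ).trace = ρ.trace := by
  have h := trace_marginal_mul a b ρ 1
  rwa [extOp_one, Matrix.mul_one, Matrix.mul_one] at h

theorem traceNorm_marginal_le (a b : ℕ) (ρ : Op (Fin N) d) :
    traceNorm (marginal a b ρ) ≤ traceNorm ρ := by
  refine traceNorm_le_of_forall _ fun T hT => ?_
  rw [trace_marginal_mul]
  exact (norm_trace_mul_le_traceNorm _ _).trans
    (mul_le_of_le_one_right (traceNorm_nonneg _) ((opNorm_extOp_le _ _).trans hT))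

theorem marginal_prodOp (a b : ℕ) (X : Fin N → Matrix (Fin d) (Fin d) ℂ) :
    marginal a b (prodOp X)
      = (∏ i : {i : Fin N // ¬ (a ≤ i.1 ∧ i.1 < b)}, (X i).trace) •
        prodOp (fun i : Win N a b => X i) := by
  ext x y
  rw [Matrix.smul_apply, smul_eq_mul, ← trace_prodOp, Matrix.trace, Finset.sum_mul, marginal]
  refine Finset.sum_congr rfl fun z _ => ?_
  rw [prodOp, ← Fintype.prod_subtype_mul_prod_subtype (fun i : Fin N => a ≤ i.1 ∧ i.1 < b),
    mul_comm]
  congr 1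
  · refine Finset.prod_congr rfl fun i _ => ?_
    have := i.2
    simp [Equiv.piEquivPiSubtypeProd, this]
  · refine Finset.prod_congr rfl fun i _ => ?_
    have := i.2
    simp [Equiv.piEquivPiSubtypeProd, this]

theorem marginal_mem_localAlg {A : StarSubalgebra ℂ (Matrix (Fin d) (Fin d) ℂ)} (a b : ℕ)
    {ρ : Op (Fin N) d} (h : ρ ∈ localAlg A (Fin N)) : marginal a b ρ ∈ localAlg A (Win N a b) := by
  refine Submodule.span_induction ?_ ?_ ?_ ?_ h
  · rintro _ ⟨X, hX, rfl⟩
    rw [marginal_prodOp]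
    exact Submodule.smul_mem _ _ (Submodule.subset_span ⟨_, fun i => hX i, rfl⟩)
  · have : marginal a b (0 : Op (Fin N) d) = 0 := by ext; simp [marginal]
    rw [this]
    exact Submodule.zero_mem _
  · intro x y _ _ hx hy
    have : marginal a b (x + y) = marginal a b x + marginal a b y := by
      ext; simp [marginal, Finset.sum_add_distrib]
    rw [this]
    exact Submodule.add_mem _ hx hy
  · intro t x _ hx
    have : marginal a b (t • x) = t • marginal a b x := by
      ext; simp [marginal, Finset.mul_sum]
    rw [this]
    exact Submodule.smul_mem _ _ hx

/-- Extension of an operator on `[a, b)` by the identity to the window `[a', b')`. -/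
def extWin {a b a' b' : ℕ} (h : ∀ i : Fin N, (a ≤ i.1 ∧ i.1 < b) → (a' ≤ i.1 ∧ i.1 < b'))
    (T : Op (Win N a b) d) : Op (Win N a' b') d :=
  extOp (fun i : Win N a' b' => a ≤ i.1.1 ∧ i.1.1 < b)
    (T.submatrix (Equiv.arrowCongr (Equiv.subtypeSubtypeEquivSubtype fun {i} => h i) (Equiv.refl _))
      (Equiv.arrowCongr (Equiv.subtypeSubtypeEquivSubtype fun {i} => h i) (Equiv.refl _)))

variable {a b a' b' : ℕ}

theorem opNorm_extWin_le (h : ∀ i : Fin N, (a ≤ i.1 ∧ i.1 < b) → (a' ≤ i.1 ∧ i.1 < b'))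
    (T : Op (Win N a b) d) : ‖extWin h T‖ ≤ ‖T‖ := by
  refine (opNorm_extOp_le _ _).trans ?_
  rw [opNorm_submatrix_equiv]

theorem extWin_prodOp (h : ∀ i : Fin N, (a ≤ i.1 ∧ i.1 < b) → (a' ≤ i.1 ∧ i.1 < b'))
    (g : Win N a b → Matrix (Fin d) (Fin d) ℂ) :
    extWin h (prodOp g)
      = prodOp fun i : Win N a' b' => if h : a ≤ i.1.1 ∧ i.1.1 < b then g ⟨i.1, h⟩ else 1 := by
  have e : (prodOp g).submatrix
      (Equiv.arrowCongr (Equiv.subtypeSubtypeEquivSubtype fun {i} => h i) (Equiv.refl _))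
      (Equiv.arrowCongr (Equiv.subtypeSubtypeEquivSubtype fun {i} => h i) (Equiv.refl _))
      = prodOp (fun i : {i : Win N a' b' // a ≤ i.1.1 ∧ i.1.1 < b} => g ⟨i.1.1, i.2⟩) := by
    ext x y
    refine (Fintype.prod_equiv (Equiv.subtypeSubtypeEquivSubtype fun {i} => h i) _ _ ?_).symm
    intro i
    rfl
  rw [extWin, e, extOp_prodOp]

/-- `extWin` as a linear map. -/
def extWinLin (h : ∀ i : Fin N, (a ≤ i.1 ∧ i.1 < b) → (a' ≤ i.1 ∧ i.1 < b'))
    : Op (Win N a b) d →ₗ[ℂ] Op (Win N a' b') d where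
  toFun := extWin h
  map_add' _ _ := (extLin _).map_add _ _
  map_smul' _ _ := (extLin _).map_smul _ _

theorem trace_marginal_mul_prodOp (a b : ℕ) (ρ : Op (Fin N) d)
    (g : Win N a b → Matrix (Fin d) (Fin d) ℂ) :
    (marginal a b ρ * prodOp g).trace
      = (ρ * prodOp fun i => if h : a ≤ i.1 ∧ i.1 < b then g ⟨i, h⟩ else 1).trace := by
  rw [trace_marginal_mul, extOp_prodOp]

theorem trace_marginal_mul_prodOp_of_le (h : ∀ i : Fin N, (a ≤ i.1 ∧ i.1 < b) → (a' ≤ i.1 ∧ i.1 < b'))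
    (ρ : Op (Fin N) d)
    (g : Win N a b → Matrix (Fin d) (Fin d) ℂ) :
    (marginal a b ρ * prodOp g).trace
      = (marginal a' b' ρ * prodOp fun i : Win N a' b' =>
          if h : a ≤ i.1.1 ∧ i.1.1 < b then g ⟨i.1, h⟩ else 1).trace := by
  rw [trace_marginal_mul_prodOp, trace_marginal_mul_prodOp]
  congr 3
  funext i
  by_cases h1 : a ≤ i.1 ∧ i.1 < b
  · simp [h1, h i h1]
  · simp [h1]

/-- Both sides are linear in T, so product operators suffice; on those the identity factors can be
inserted site by site. -/
theorem trace_marginal_mul_of_le (h : ∀ i : Fin N, (a ≤ i.1 ∧ i.1 < b) → (a' ≤ i.1 ∧ i.1 < b'))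
    (ρ : Op (Fin N) d) (T : Op (Win N a b) d) :
    (marginal a b ρ * T).trace = (marginal a' b' ρ * extWin h T).trace := by
  have e : (Matrix.traceLinearMap _ ℂ ℂ) ∘ₗ (LinearMap.mulLeft ℂ (marginal a b ρ))
      = (Matrix.traceLinearMap _ ℂ ℂ) ∘ₗ (LinearMap.mulLeft ℂ (marginal a' b' ρ)) ∘ₗ
        (extWinLin h) := by
    refine linearMap_ext_prodOp fun X => ?_
    change (marginal a b ρ * prodOp X).trace = (marginal a' b' ρ * extWin h (prodOp X)).trace
    rw [extWin_prodOp, trace_marginal_mul_prodOp_of_le h]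
  exact LinearMap.congr_fun e T

theorem traceNorm_marginal_le_of_le (h : ∀ i : Fin N, (a ≤ i.1 ∧ i.1 < b) → (a' ≤ i.1 ∧ i.1 < b'))
    (ρ : Op (Fin N) d) :
    traceNorm (marginal a b ρ) ≤ traceNorm (marginal a' b' ρ) := by
  refine traceNorm_le_of_forall _ fun T hT => ?_
  rw [trace_marginal_mul_of_le h]
  exact (norm_trace_mul_le_traceNorm _ _).trans
    (mul_le_of_le_one_right (traceNorm_nonneg _) ((opNorm_extWin_le _ _).trans hT))

/-- The bijection between words on the whole chain and words on `[0, N)`. -/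
def fullEquiv (N : ℕ) (α : Type) : (Win N 0 N → α) ≃ (Fin N → α) :=
  Equiv.arrowCongr (Equiv.subtypeUnivEquiv fun i => ⟨Nat.zero_le _, i.2⟩) (Equiv.refl _)

theorem marginal_full (ρ : Op (Fin N) d) :
    marginal 0 N ρ = ρ.submatrix (fullEquiv N (Fin d)) (fullEquiv N (Fin d)) := by
  ext x y
  have hemp : IsEmpty {i : Fin N // ¬ (0 ≤ i.1 ∧ i.1 < N)} :=
    ⟨fun i => i.2 ⟨Nat.zero_le _, i.1.2⟩⟩
  rw [marginal, Fintype.sum_unique]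
  have key : ∀ x : Win N 0 N → Fin d, (Equiv.piEquivPiSubtypeProd
      (fun i : Fin N => 0 ≤ i.1 ∧ i.1 < N) (fun _ => Fin d)).symm (x, default)
      = fullEquiv N (Fin d) x := by
    intro x
    funext i
    have := i.2
    simp [Equiv.piEquivPiSubtypeProd, fullEquiv, Equiv.subtypeUnivEquiv]
  rw [key, key]
  rfl

theorem traceNorm_marginal_full (ρ : Op (Fin N) d) : traceNorm (marginal 0 N ρ) = traceNorm ρ := by
  rw [marginal_full, traceNorm_submatrix_equiv]

end Marginal

/-! ### Adjacent windows -/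

section Windows

variable {d q N a j b : ℕ}

/-- The concatenation of words on adjacent windows. -/
def glue {α : Type} (u : Win N a j → α) (v : Win N j b → α) : Win N a b → α :=
  fun i => if h : i.1.1 < j then u ⟨i.1, i.2.1, h⟩ else v ⟨i.1, Nat.le_of_not_lt h, i.2.2⟩

/-- The decomposition of words on `[a, b)` into words on `[a, j)` and `[j, b)`. -/
def splitEquiv (α : Type) (haj : a ≤ j) (hjb : j ≤ b) :
    (Win N a b → α) ≃ (Win N a j → α) × (Win N j b → α) where
  toFun x := (fun i => x ⟨i.1, i.2.1, i.2.2.trans_le hjb⟩, fun i => x ⟨i.1, haj.trans i.2.1, i.2.2⟩)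
  invFun y := glue y.1 y.2
  left_inv x := by
    funext i
    by_cases h : i.1.1 < j <;> simp [glue, h]
  right_inv y := by
    refine Prod.ext (funext fun i => ?_) (funext fun i => ?_)
    · have := i.2.2
      simp [glue, this]
    · have := i.2.1
      simp [glue, not_lt.2 this]

/-- The union of the adjacent windows `[a, j)` and `[j, b)`. -/
def winSum (haj : a ≤ j) (hjb : j ≤ b) : Win N a j ⊕ Win N j b ≃ Win N a b where
  toFun := Sum.elim (fun i => ⟨i.1, i.2.1, i.2.2.trans_le hjb⟩)
    (fun i => ⟨i.1, haj.trans i.2.1, i.2.2⟩)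
  invFun i := if h : i.1.1 < j then Sum.inl ⟨i.1, i.2.1, h⟩
    else Sum.inr ⟨i.1, Nat.le_of_not_lt h, i.2.2⟩
  left_inv i := by
    rcases i with i | i
    · have := i.2.2
      simp [this]
    · have := i.2.1
      simp [not_lt.2 this]
  right_inv i := by
    by_cases h : i.1.1 < j <;> simp [h]

theorem prod_win {M : Type*} [CommMonoid M] (haj : a ≤ j) (hjb : j ≤ b) (f : Win N a b → M) :
    ∏ i, f i = (∏ i : Win N a j, f ⟨i.1, i.2.1, i.2.2.trans_le hjb⟩) *
      ∏ i : Win N j b, f ⟨i.1, haj.trans i.2.1, i.2.2⟩ := by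
  rw [← Fintype.prod_equiv (winSum haj hjb) (fun i => f (winSum haj hjb i)) f (fun _ => rfl),
    Fintype.prod_sum_type]
  rfl

theorem sum_glue {M α : Type} [AddCommMonoid M] [Fintype α] (haj : a ≤ j) (hjb : j ≤ b)
    (f : (Win N a b → α) → M) : ∑ w, f w = ∑ u : Win N a j → α, ∑ v : Win N j b → α, f (glue u v) := by
  rw [← Fintype.sum_prod_type']
  exact Fintype.sum_equiv (splitEquiv α haj hjb) _ _ fun x => by
    conv_lhs => rw [← (splitEquiv α haj hjb).symm_apply_apply x]
    rfl

theorem glue_left {α : Type} (u : Win N a j → α) (v : Win N j b → α) (i : Win N a j)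
    (h : a ≤ i.1.1 ∧ i.1.1 < b) : glue u v ⟨i.1, h⟩ = u i := by
  have := i.2.2
  simp [glue, this]

theorem glue_right {α : Type} (u : Win N a j → α) (v : Win N j b → α) (i : Win N j b)
    (h : a ≤ i.1.1 ∧ i.1.1 < b) : glue u v ⟨i.1, h⟩ = v i := by
  have := i.2.1
  simp [glue, not_lt.2 this]

/-- The tensor product of operators on adjacent windows. -/
def tens (haj : a ≤ j) (hjb : j ≤ b) (P : Op (Win N a j) d) (C : Op (Win N j b) d) :
    Op (Win N a b) d :=
  (P ⊗ₖ C).submatrix (splitEquiv (Fin d) haj hjb) (splitEquiv (Fin d) haj hjb)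

variable (haj : a ≤ j) (hjb : j ≤ b)

theorem tens_mul_tens (P P' : Op (Win N a j) d) (C C' : Op (Win N j b) d) :
    tens haj hjb P C * tens haj hjb P' C' = tens haj hjb (P * P') (C * C') := by
  rw [tens, tens, Matrix.submatrix_mul_equiv, ← Matrix.mul_kronecker_mul]
  rfl

theorem trace_tens (P : Op (Win N a j) d) (C : Op (Win N j b) d) :
    (tens haj hjb P C).trace = P.trace * C.trace := by
  rw [tens, trace_submatrix_equiv, Matrix.trace_kronecker]

theorem traceNorm_tens_le (P : Op (Win N a j) d) (C : Op (Win N j b) d) :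
    traceNorm (tens haj hjb P C) ≤ traceNorm P * traceNorm C := by
  rw [tens, traceNorm_submatrix_equiv]
  exact traceNorm_kronecker_le P C

theorem opNorm_tens_le (P : Op (Win N a j) d) (C : Op (Win N j b) d) :
    ‖tens haj hjb P C‖ ≤ ‖P‖ * ‖C‖ := by
  rw [tens, opNorm_submatrix_equiv]
  exact opNorm_kronecker_le P C

theorem tens_sum_left {ι : Type*} (s : Finset ι) (P : ι → Op (Win N a j) d)
    (C : Op (Win N j b) d) :
    tens haj hjb (∑ i ∈ s, P i) C = ∑ i ∈ s, tens haj hjb (P i) C := by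
  ext x y
  simp [tens, Matrix.sum_apply, Finset.sum_mul]

theorem tens_sum_right {ι : Type*} (s : Finset ι) (P : Op (Win N a j) d)
    (C : ι → Op (Win N j b) d) :
    tens haj hjb P (∑ i ∈ s, C i) = ∑ i ∈ s, tens haj hjb P (C i) := by
  ext x y
  simp [tens, Matrix.sum_apply, Finset.mul_sum]

theorem tens_smul_left (t : ℂ) (P : Op (Win N a j) d) (C : Op (Win N j b) d) :
    tens haj hjb (t • P) C = t • tens haj hjb P C := by
  ext x y
  simp [tens, mul_assoc]

theorem tens_smul_right (t : ℂ) (P : Op (Win N a j) d) (C : Op (Win N j b) d) :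
    tens haj hjb P (t • C) = t • tens haj hjb P C := by
  ext x y
  simp [tens, mul_left_comm]

theorem tens_sub_right (P : Op (Win N a j) d) (C C' : Op (Win N j b) d) :
    tens haj hjb P (C - C') = tens haj hjb P C - tens haj hjb P C' := by
  ext x y
  simp [tens, mul_sub]

theorem tens_assoc {k : ℕ} (hjk : j ≤ k) (hkb : k ≤ b) (P : Op (Win N a j) d)
    (Q : Op (Win N j k) d) (C : Op (Win N k b) d) :
    tens haj (hjk.trans hkb) P (tens hjk hkb Q C)
      = tens (haj.trans hjk) hkb (tens haj hjk P Q) C := by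
  ext x y
  simp only [tens, Matrix.submatrix_apply, kronecker_apply_prod, mul_assoc]
  rfl

theorem tens_prodOp (f : Win N a j → Matrix (Fin d) (Fin d) ℂ)
    (g : Win N j b → Matrix (Fin d) (Fin d) ℂ) :
    tens haj hjb (prodOp f) (prodOp g) = prodOp (glue f g) := by
  ext x y
  rw [tens, Matrix.submatrix_apply, kronecker_apply_prod, prodOp, prodOp, prodOp,
    prod_win haj hjb]
  congr 1
  · refine Finset.prod_congr rfl fun i _ => ?_
    rw [glue_left]
    rfl
  · refine Finset.prod_congr rfl fun i _ => ?_
    rw [glue_right]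
    rfl

theorem tens_basisOp (Z : Fin q → Matrix (Fin d) (Fin d) ℂ) (u : Win N a j → Fin q)
    (v : Win N j b → Fin q) :
    tens haj hjb (basisOp Z u) (basisOp Z v) = basisOp Z (glue u v) := by
  rw [basisOp, basisOp, tens_prodOp, basisOp]
  congr 1
  funext i
  by_cases h : i.1.1 < j <;> simp [glue, h]

end Windows

/-! ### Correlation maps -/

section Corr

variable {d q N : ℕ} {A : StarSubalgebra ℂ (Matrix (Fin d) (Fin d) ℂ)}
  {Z : Fin q → Matrix (Fin d) (Fin d) ℂ}

theorem corr_apply (a j b : ℕ) (τ : Op (Win N a b) d) (Y : Win N a j → Fin q)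
    (X : Win N j b → Fin q) : corr Z a j b τ Y X = coef Z τ (glue Y X) := by
  rw [corr, coef, basisOp]
  congr 4
  funext i
  by_cases h : i.1.1 < j <;> simp [glue, h]

/-- Fixing the letter at s selects rows of the correlation map across the cut s + 1. The site maps
thereby inherit the factorization of the cut maps. -/
theorem corrAt_eq (a s b : ℕ) (τ : Op (Win N a b) d) (c : Fin q) :
    corrAt Z a s b τ c = (corr Z a (s + 1) b τ).submatrix
      (fun Y => glue Y fun _ : Win N s (s + 1) => c) id := by
  ext Y X
  rw [Matrix.submatrix_apply, corr_apply, corrAt, coef, basisOp]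
  congr 4
  funext i
  rcases lt_trichotomy i.1.1 s with h | h | h
  · simp [glue, h, h.trans (Nat.lt_succ_self s)]
  · simp [glue, h]
  · have h1 : ¬ i.1.1 < s := by omega
    have h2 : ¬ i.1.1 = s := by omega
    have h3 : ¬ i.1.1 < s + 1 := by omega
    simp [glue, h1, h2, h3]

/-- Words on `[a, j)`, extended by the identity, in the basis of words on `[0, j)`. -/
noncomputable def extendLeft (Z : Fin q → Matrix (Fin d) (Fin d) ℂ) (N a j : ℕ) :
    Matrix (Win N a j → Fin q) (Win N 0 j → Fin q) ℝ :=
  fun Y W => ∏ i : Win N 0 j,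
    ((if h : a ≤ i.1.1 then Z (Y ⟨i.1, h, i.2.2⟩) else 1) * Z (W i)).trace.re

/-- Words on `[j, b)`, extended by the identity, in the basis of words on `[j, N)`. -/
noncomputable def extendRight (Z : Fin q → Matrix (Fin d) (Fin d) ℂ) (N j b : ℕ) :
    Matrix (Win N j N → Fin q) (Win N j b → Fin q) ℝ :=
  fun W X => ∏ i : Win N j N,
    ((if h : i.1.1 < b then Z (X ⟨i.1, i.2.1, h⟩) else 1) * Z (W i)).trace.re

theorem extendRight_self (hZ : IsSelfAdjointONB A Z) (j : ℕ) : extendRight Z N j N = 1 := by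
  ext W X
  have h : ∀ i : Win N j N, ((if h : i.1.1 < N then Z (X ⟨i.1, i.2.1, h⟩) else 1) *
      Z (W i)).trace.re = if X i = W i then 1 else 0 := by
    intro i
    rw [dif_pos i.2.2, hZ.trace_mul]
    split_ifs <;> simp
  rw [extendRight, Finset.prod_congr rfl fun i _ => h i, Finset.prod_ite_zero, Matrix.one_apply]
  simp [funext_iff, eq_comm]

theorem trace_mul_eq_ofReal_re {n : Type*} [Fintype n] {G H : Matrix n n ℂ} (hG : G.IsHermitian)
    (hH : H.IsHermitian) : (G * H).trace = ((G * H).trace.re : ℂ) := by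
  have h : (starRingEnd ℂ) (G * H).trace = (G * H).trace := by
    have h2 := Matrix.trace_conjTranspose (G * H)
    rw [Matrix.conjTranspose_mul, hH.eq, hG.eq, Matrix.trace_mul_comm] at h2
    exact h2.symm
  exact (Complex.conj_eq_iff_re.1 h).symm

theorem IsSelfAdjointONB.mem (hZ : IsSelfAdjointONB A Z) (c : Fin q) : Z c ∈ A := by
  have h : Z c ∈ Submodule.span ℂ (Set.range Z) := Submodule.subset_span ⟨c, rfl⟩
  rw [hZ.span_eq] at h
  exact h

/-- The algebra contains 1, so words padded with identities expand in the product basis, and the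
coefficients split into a left and a right factor. Thus all windows around one cut see the same full
map, between matrices that do not depend on the state. -/
theorem corr_marginal (hZ : IsSelfAdjointONB A Z) {a j b : ℕ} (haj : a ≤ j) (hjb : j ≤ b)
    (hjN : j ≤ N) (ρ : Op (Fin N) d) :
    corr Z a j b (marginal a b ρ)
      = extendLeft Z N a j * corr Z 0 j N (marginal 0 N ρ) * extendRight Z N j b := by
  ext Y X
  set g : Win N 0 N → Matrix (Fin d) (Fin d) ℂ := fun i =>
    if h : a ≤ i.1.1 ∧ i.1.1 < b then Z (glue Y X ⟨i.1, h⟩) else 1 with hg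
  have hgA : ∀ i, g i ∈ A := by
    intro i
    simp only [hg]
    split_ifs
    · exact hZ.mem _
    · exact one_mem A
  have hgH : ∀ i, (g i).IsHermitian := by
    intro i
    simp only [hg]
    split_ifs
    · exact hZ.isHermitian _
    · exact Matrix.isHermitian_one
  have hprod : ∀ (W : Win N 0 j → Fin q) (W' : Win N j N → Fin q),
      ∏ i, (g i * Z (glue W W' i)).trace
        = ((extendLeft Z N a j Y W * extendRight Z N j b W' X : ℝ) : ℂ) := by
    intro W W'
    rw [prod_win (Nat.zero_le j) hjN, extendLeft, extendRight]
    push_cast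
    congr 1
    · refine Finset.prod_congr rfl fun i _ => ?_
      have e : g ⟨i.1, i.2.1, i.2.2.trans_le hjN⟩
          = if h : a ≤ i.1.1 then Z (Y ⟨i.1, h, i.2.2⟩) else 1 := by
        have h2 := i.2.2
        by_cases h : a ≤ i.1.1
        · simp [hg, h, h2.trans_le hjb, glue, h2]
        · simp [hg, h]
      rw [trace_mul_eq_ofReal_re (hgH _) (hZ.isHermitian _), glue_left, e]
    · refine Finset.prod_congr rfl fun i _ => ?_
      have e : g ⟨i.1, (Nat.zero_le j).trans i.2.1, i.2.2⟩
          = if h : i.1.1 < b then Z (X ⟨i.1, i.2.1, h⟩) else 1 := by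
        have h2 := i.2.1
        by_cases h : i.1.1 < b
        · simp [hg, h, haj.trans h2, glue, not_lt.2 h2]
        · simp [hg, h]
      rw [trace_mul_eq_ofReal_re (hgH _) (hZ.isHermitian _), glue_right, e]
  have h1 : corr Z a j b (marginal a b ρ) Y X = (marginal 0 N ρ * prodOp g).trace.re := by
    rw [corr_apply, coef, basisOp,
      trace_marginal_mul_prodOp_of_le (fun i _ => ⟨Nat.zero_le _, i.2⟩)]
  rw [h1, prodOp_eq_sum hZ hgA, Matrix.mul_sum, Matrix.trace_sum, Complex.re_sum,
    sum_glue (Nat.zero_le j) hjN, Matrix.mul_apply, Finset.sum_comm]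
  refine Finset.sum_congr rfl fun W' _ => ?_
  rw [Matrix.mul_apply, Finset.sum_mul]
  refine Finset.sum_congr rfl fun W _ => ?_
  rw [hprod, Matrix.mul_smul, Matrix.trace_smul, smul_eq_mul, Complex.re_ofReal_mul, corr_apply,
    coef]
  ring

/-- The entries are the product-basis coefficients, each occurring once, so Bessel's inequality
applies. -/
theorem hsNorm_corr_sub_le (hZ : IsSelfAdjointONB A Z) {a j b : ℕ} (haj : a ≤ j) (hjb : j ≤ b)
    (τ τ' : Op (Win N a b) d) : hsNorm (corr Z a j b τ - corr Z a j b τ') ≤ hsNorm (τ - τ') := by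
  refine le_of_sq_le_sq ?_ (hsNorm_nonneg _)
  refine le_trans (le_of_eq ?_) (sum_coef_sq_le hZ (τ - τ'))
  rw [hsNorm_sq, sum_glue haj hjb]
  simp [corr_apply, coef_sub]

theorem hsNorm_corr_le (hZ : IsSelfAdjointONB A Z) {a j b : ℕ} (haj : a ≤ j) (hjb : j ≤ b)
    (τ : Op (Win N a b) d) : hsNorm (corr Z a j b τ) ≤ hsNorm τ := by
  refine le_of_sq_le_sq ?_ (hsNorm_nonneg _)
  refine le_trans (le_of_eq ?_) (sum_coef_sq_le hZ τ)
  rw [hsNorm_sq, sum_glue haj hjb]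
  simp [corr_apply]

end Corr

/-- If `V F C` has a right inverse `P` and as many rows as the rank of `F`, then `F` is recovered
from `V F` and `F C`. -/
theorem mul_eq_of_right_inverse {p n n' : Type*} {k : ℕ} [Fintype p] [Fintype n] [Fintype n']
    (F : Matrix p n ℝ) (C : Matrix n n' ℝ) (V : Matrix (Fin k) p ℝ) (P : Matrix n' (Fin k) ℝ)
    (hP : V * F * C * P = 1) (hk : F.rank = k) : F * C * P * (V * F) = F := by
  classical
  have h1 : k ≤ (V * F).rank := by
    calc k = (1 : Matrix (Fin k) (Fin k) ℝ).rank := by rw [Matrix.rank_one, Fintype.card_fin]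
      _ = (V * F * (C * P)).rank := by rw [← Matrix.mul_assoc, hP]
      _ ≤ _ := Matrix.rank_mul_le_left _ _
  have h2 : (V * F).rank = F.rank := le_antisymm (Matrix.rank_mul_le_right _ _) (hk ▸ h1)
  -- One inclusion is clear, and equal ranks force equality. Hence whatever V F annihilates, F
  -- annihilates too.
  have hker : LinearMap.ker F.mulVecLin = LinearMap.ker (V * F).mulVecLin := by
    refine Submodule.eq_of_le_of_finrank_eq ?_ ?_
    · intro x hx
      rw [LinearMap.mem_ker, Matrix.mulVecLin_apply] at hx ⊢
      rw [← Matrix.mulVec_mulVec, hx, Matrix.mulVec_zero]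
    · have e1 := LinearMap.finrank_range_add_finrank_ker F.mulVecLin
      have e2 := LinearMap.finrank_range_add_finrank_ker (V * F).mulVecLin
      change F.rank + _ = _ at e1
      change (V * F).rank + _ = _ at e2
      omega
  have hE : V * F * (C * P * (V * F) - 1) = 0 := by
    rw [Matrix.mul_sub, ← Matrix.mul_assoc (V * F), ← Matrix.mul_assoc (V * F), hP, Matrix.one_mul,
      Matrix.mul_one, sub_self]
  have hE2 : F * (C * P * (V * F) - 1) = 0 := by
    ext i x
    have hx : (C * P * (V * F) - 1).col x ∈ LinearMap.ker (V * F).mulVecLin := by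
      rw [LinearMap.mem_ker, Matrix.mulVecLin_apply]
      ext y
      exact congrFun (congrFun hE y) x
    rw [← hker, LinearMap.mem_ker, Matrix.mulVecLin_apply] at hx
    exact congrFun hx i
  rw [Matrix.mul_sub, Matrix.mul_one, sub_eq_zero] at hE2
  rw [Matrix.mul_assoc F, Matrix.mul_assoc F, hE2]

theorem glue_assoc {N a j k b : ℕ} {α : Type} (hjk : j ≤ k) (u : Win N a j → α)
    (v : Win N j k → α) (w : Win N k b → α) : glue (glue u v) w = glue u (glue v w) := by
  funext i
  by_cases h1 : i.1.1 < j
  · simp [glue, h1, h1.trans_le hjk]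
  · by_cases h2 : i.1.1 < k <;> simp [glue, h1, h2]

theorem sum_single_word {N s : ℕ} (hs : s < N) {α M : Type} [Fintype α] [AddCommMonoid M]
    (f : (Win N s (s + 1) → α) → M) : ∑ w, f w = ∑ c, f (fun _ => c) := by
  have hu : ∀ i : Win N s (s + 1), i = ⟨⟨s, hs⟩, le_rfl, Nat.lt_succ_self s⟩ := fun i =>
    Subtype.ext (Fin.ext (Nat.le_antisymm (Nat.le_of_lt_succ i.2.2) i.2.1))
  let e : (Win N s (s + 1) → α) ≃ α :=
    { toFun := fun w => w ⟨⟨s, hs⟩, le_rfl, Nat.lt_succ_self s⟩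
      invFun := fun c _ => c
      left_inv := fun w => funext fun i => by rw [hu i]
      right_inv := fun c => rfl }
  exact (Fintype.sum_equiv e.symm (fun c => f fun _ => c) f fun _ => rfl).symm

theorem card_single_word {N s : ℕ} (hs : s < N) (α : Type) [Fintype α] :
    Fintype.card (Win N s (s + 1) → α) = Fintype.card α := by
  have h := sum_single_word hs (α := α) (fun _ => 1)
  simpa using h

/-! ### Stacks of matrices -/

section Stack

set_option linter.unusedSectionVars false

variable {q : ℕ} {κ κ' κ'' : Type*} [Fintype κ] [Fintype κ'] [Fintype κ'']

/-- The matrix with the blocks `K c` on top of each other. -/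
def stack (K : Fin q → Matrix κ κ' ℝ) : Matrix (Fin q × κ) κ' ℝ := fun x b => K x.1 x.2 b

theorem hsNorm_stack_sq (K : Fin q → Matrix κ κ' ℝ) :
    hsNorm (stack K) ^ 2 = ∑ c, hsNorm (K c) ^ 2 := by
  simp only [hsNorm_sq, Fintype.sum_prod_type, stack]

theorem stack_mul (K : Fin q → Matrix κ κ' ℝ) (G : Matrix κ' κ'' ℝ) :
    stack K * G = stack fun c => K c * G := rfl

theorem hsNorm_stack_mul_le [DecidableEq κ] (V : Matrix κ'' κ ℝ)
    (hV : ‖V‖ ≤ 1) (K : Fin q → Matrix κ κ' ℝ) :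
    hsNorm (stack fun c => V * K c) ≤ hsNorm (stack K) := by
  refine le_of_sq_le_sq ?_ (hsNorm_nonneg _)
  rw [hsNorm_stack_sq, hsNorm_stack_sq]
  refine Finset.sum_le_sum fun c _ => ?_
  have h := hsNorm_nonneg (V * K c)
  have h2 := hsNorm_nonneg (K c)
  have : hsNorm (V * K c) ≤ hsNorm (K c) :=
    (hsNorm_mul_le_left V (K c)).trans (mul_le_of_le_one_left (hsNorm_nonneg _) hV)
  gcongr

/-- The sum of the lengths of the columns in the stacking direction. -/
theorem sum_sqrt_le_mul_hsNorm_stack (K : Fin q → Matrix κ κ' ℝ) :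
    ∑ a, ∑ b, √(∑ c, K c a b ^ 2)
      ≤ √(Fintype.card κ * Fintype.card κ') * hsNorm (stack K) := by
  rw [← Fintype.sum_prod_type']
  -- Cauchy-Schwarz over the pairs of row and column indices.
  refine le_of_sq_le_sq ?_ (mul_nonneg (Real.sqrt_nonneg _) (hsNorm_nonneg _))
  have h := sq_sum_le_card_mul_sum_sq (s := (Finset.univ : Finset (κ × κ')))
    (f := fun x => √(∑ c, K c x.1 x.2 ^ 2))
  refine h.trans (le_of_eq ?_)
  rw [mul_pow, Real.sq_sqrt (by positivity), hsNorm_stack_sq, Finset.card_univ, Fintype.card_prod]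
  push_cast
  congr 1
  simp only [hsNorm_sq, Real.norm_eq_abs, sq_abs]
  have e : ∀ x : κ × κ', √(∑ c, K c x.1 x.2 ^ 2) ^ 2 = ∑ c, K c x.1 x.2 ^ 2 :=
    fun x => Real.sq_sqrt (by positivity)
  rw [Finset.sum_congr rfl fun x _ => e x, Fintype.sum_prod_type, Finset.sum_comm (γ := Fin q)]
  exact Finset.sum_congr rfl fun a _ => Finset.sum_comm

end Stack

/-! ### One step of the reconstruction -/

section Step

variable {d N a j b : ℕ} {κ : Type*} [Fintype κ] [DecidableEq κ]

/-- If the operators `L x` are dual to `B x`, replacing `B x` by `C x` in a sum of tensor products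
increases the trace norm at most by the factor `lam * ∑ ‖C x‖₁`. -/
theorem traceNorm_sum_tens_le (haj : a ≤ j) (hjb : j ≤ b) (P : κ → Op (Win N a j) d)
    (B C L : κ → Op (Win N j b) d) {lam : ℝ} (hL : ∀ x, ‖L x‖ ≤ lam)
    (hBL : ∀ x y, (B x * L y).trace = if x = y then 1 else 0) :
    traceNorm (∑ x, tens haj hjb (P x) (C x))
      ≤ lam * (∑ x, traceNorm (C x)) * traceNorm (∑ x, tens haj hjb (P x) (B x)) := by
  set Θ := ∑ x, tens haj hjb (P x) (B x) with hΘ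
  -- Pairing the right tensor factor with L y isolates P y inside the whole sum Θ.
  have hP : ∀ y, traceNorm (P y) ≤ lam * traceNorm Θ := by
    intro y
    refine traceNorm_le_of_forall _ fun T hT => ?_
    have e : (P y * T).trace = (Θ * tens haj hjb T (L y)).trace := by
      rw [hΘ, Matrix.sum_mul, Matrix.trace_sum]
      simp only [tens_mul_tens, trace_tens, hBL]
      simp
    rw [e]
    refine (norm_trace_mul_le_traceNorm _ _).trans ?_
    rw [mul_comm]
    refine mul_le_mul_of_nonneg_right ?_ (traceNorm_nonneg _)
    refine (opNorm_tens_le haj hjb T (L y)).trans ?_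
    calc ‖T‖ * ‖L y‖ ≤ 1 * ‖L y‖ := by gcongr
      _ ≤ lam := by rw [one_mul]; exact hL y
  refine (traceNorm_sum_le _ _).trans ?_
  calc ∑ x, traceNorm (tens haj hjb (P x) (C x))
      ≤ ∑ x, lam * traceNorm Θ * traceNorm (C x) := by
        refine Finset.sum_le_sum fun x _ => (traceNorm_tens_le haj hjb _ _).trans ?_
        exact mul_le_mul_of_nonneg_right (hP x) (traceNorm_nonneg _)
    _ = _ := by rw [← Finset.mul_sum]; ring

end Step

/-! ### The exact realization -/

section Realization

variable {d q N l r : ℕ} {k : ℕ → ℕ} {A : StarSubalgebra ℂ (Matrix (Fin d) (Fin d) ℂ)}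
  {Z : Fin q → Matrix (Fin d) (Fin d) ℂ} {ω : Op (Fin N) d}
  {U : ∀ j, Matrix (Win N (j - l) j → Fin q) (Fin (k j)) ℝ}

/-- The compressed correlation map between the last `l` sites before the cut `s` and all the sites
after it. -/
noncomputable def tail (Z : Fin q → Matrix (Fin d) (Fin d) ℂ) (ω : Op (Fin N) d)
    (U : ∀ j, Matrix (Win N (j - l) j → Fin q) (Fin (k j)) ℝ) (s : ℕ) :
    Matrix (Fin (bondDim k s)) (Win N s N → Fin q) ℝ :=
  (leftMap U s)ᵀ * corr Z (s - l) s N (marginal (s - l) N ω)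

/-- The operators on the sites after the cut `s` with coefficients `tail`. -/
noncomputable def tailOp (Z : Fin q → Matrix (Fin d) (Fin d) ℂ) (ω : Op (Fin N) d)
    (U : ∀ j, Matrix (Win N (j - l) j → Fin q) (Fin (k j)) ℝ) (s : ℕ)
    (b : Fin (bondDim k s)) : Op (Win N s N) d :=
  ∑ X, (tail Z ω U s b X : ℂ) • basisOp Z X

/-- The compressed correlation map of `ω` at the cut `s`. -/
noncomputable def compCut (Z : Fin q → Matrix (Fin d) (Fin d) ℂ) (r : ℕ) (ω : Op (Fin N) d)
    (U : ∀ j, Matrix (Win N (j - l) j → Fin q) (Fin (k j)) ℝ) (s : ℕ) :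
    Matrix (Fin (bondDim k s)) (Win N s (s + r) → Fin q) ℝ :=
  (leftMap U s)ᵀ * corr Z (s - l) s (s + r) (marginal (s - l) (s + r) ω)

/-- The site matrices computed from the exact marginals of `ω`. -/
noncomputable def exactMat (Z : Fin q → Matrix (Fin d) (Fin d) ℂ) (r : ℕ) (ω : Op (Fin N) d)
    (U : ∀ j, Matrix (Win N (j - l) j → Fin q) (Fin (k j)) ℝ) (s : ℕ) (c : Fin q) :
    Matrix (Fin (bondDim k s)) (Fin (bondDim k (s + 1))) ℝ :=
  (leftMap U s)ᵀ * corrAt Z (s - l) s (s + 1 + r) (marginal (s - l) (s + 1 + r) ω) c *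
    pinv (compCut Z r ω U (s + 1))

/-- The operator `Z c` on the site `s`. -/
def siteOp (Z : Fin q → Matrix (Fin d) (Fin d) ℂ) (N s : ℕ) (c : Fin q) :
    Op (Win N s (s + 1)) d := basisOp Z fun _ => c

theorem corrAt_marginal (hZ : IsSelfAdjointONB A Z) {s b : ℕ} (hs : s < N) (hb : s + 1 ≤ b)
    (c : Fin q) :
    corrAt Z (s - l) s b (marginal (s - l) b ω) c
      = (extendLeft Z N (s - l) (s + 1)).submatrix
          (fun Y => glue Y fun _ : Win N s (s + 1) => c) id *
        corr Z 0 (s + 1) N (marginal 0 N ω) * extendRight Z N (s + 1) b := by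
  rw [corrAt_eq, corr_marginal hZ (by omega) hb hs]
  rfl

theorem compCut_eq (hZ : IsSelfAdjointONB A Z) {s : ℕ} (hs : s ≤ N) :
    compCut Z r ω U s = (leftMap U s)ᵀ * extendLeft Z N (s - l) s *
      corr Z 0 s N (marginal 0 N ω) * extendRight Z N s (s + r) := by
  rw [compCut, corr_marginal hZ (Nat.sub_le _ _) (Nat.le_add_right _ _) hs]
  simp only [Matrix.mul_assoc]

theorem tail_eq (hZ : IsSelfAdjointONB A Z) {s : ℕ} (hs : s ≤ N) :
    tail Z ω U s = (leftMap U s)ᵀ * extendLeft Z N (s - l) s *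
      corr Z 0 s N (marginal 0 N ω) := by
  rw [tail, corr_marginal hZ (Nat.sub_le _ _) hs hs, extendRight_self hZ, Matrix.mul_one,
    Matrix.mul_assoc]

theorem tail_mul_extendRight (hZ : IsSelfAdjointONB A Z) {s : ℕ} (hs : s ≤ N) :
    tail Z ω U s * extendRight Z N s (s + r) = compCut Z r ω U s := by
  rw [tail_eq hZ hs, compCut_eq hZ hs]

/-- The compressed map has as many rows as the full map has rank and is right invertible, so the
full map is recovered from its restriction to r sites on the right and its compression on the left.
-/
theorem full_eq (hZ : IsSelfAdjointONB A Z) {s : ℕ} (hs : s + 1 < N)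
    (hrank : (fullCutMap Z ω (s + 1)).rank = k (s + 1))
    (hH : compCut Z r ω U (s + 1) * pinv (compCut Z r ω U (s + 1)) = 1) :
    corr Z 0 (s + 1) N (marginal 0 N ω) * extendRight Z N (s + 1) (s + 1 + r) *
        pinv (compCut Z r ω U (s + 1)) * tail Z ω U (s + 1)
      = corr Z 0 (s + 1) N (marginal 0 N ω) := by
  rw [tail_eq hZ hs.le]
  refine mul_eq_of_right_inverse _ _ _ _ ?_ hrank
  rw [← compCut_eq hZ hs.le]
  exact hH

/-- The site map is a row transformation of the full map at the cut s + 1, so `full_eq` may be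
multiplied from the left by that transformation. -/
theorem exactMat_mul_tail (hZ : IsSelfAdjointONB A Z) {s : ℕ} (hs : s + 1 < N)
    (hrank : (fullCutMap Z ω (s + 1)).rank = k (s + 1))
    (hH : compCut Z r ω U (s + 1) * pinv (compCut Z r ω U (s + 1)) = 1) (c : Fin q) :
    exactMat Z r ω U s c * tail Z ω U (s + 1)
      = (leftMap U s)ᵀ * corrAt Z (s - l) s N (marginal (s - l) N ω) c := by
  have h := full_eq hZ hs hrank hH
  rw [exactMat, corrAt_marginal hZ (Nat.lt_of_succ_lt hs) (Nat.le_add_right _ _),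
    corrAt_marginal hZ (Nat.lt_of_succ_lt hs) hs.le, extendRight_self hZ, Matrix.mul_one]
  conv_rhs => rw [← h]
  simp only [Matrix.mul_assoc]

/-- The identity K H = Vᵀ Ω_A behind the perturbation formula for the site matrices. It is
`exactMat_mul_tail` restricted to r sites on the right. -/
theorem exactMat_mul_compCut (hZ : IsSelfAdjointONB A Z) {s : ℕ} (hs : s + 1 < N)
    (hrank : (fullCutMap Z ω (s + 1)).rank = k (s + 1))
    (hH : compCut Z r ω U (s + 1) * pinv (compCut Z r ω U (s + 1)) = 1) (c : Fin q) :
    exactMat Z r ω U s c * compCut Z r ω U (s + 1)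
      = (leftMap U s)ᵀ *
        corrAt Z (s - l) s (s + 1 + r) (marginal (s - l) (s + 1 + r) ω) c := by
  rw [← tail_mul_extendRight hZ hs.le, ← Matrix.mul_assoc, exactMat_mul_tail hZ hs hrank hH,
    corrAt_marginal hZ (Nat.lt_of_succ_lt hs) hs.le,
    corrAt_marginal hZ (Nat.lt_of_succ_lt hs) (Nat.le_add_right _ _), extendRight_self hZ,
    Matrix.mul_one]
  simp only [Matrix.mul_assoc]

theorem tail_glue {s : ℕ} (c : Fin q) (X : Win N (s + 1) N → Fin q) (a : Fin (bondDim k s)) :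
    tail Z ω U s a (glue (fun _ : Win N s (s + 1) => c) X)
      = ((leftMap U s)ᵀ * corrAt Z (s - l) s N (marginal (s - l) N ω) c) a X := by
  rw [tail, Matrix.mul_apply, Matrix.mul_apply]
  refine Finset.sum_congr rfl fun Y _ => ?_
  rw [corrAt_eq, Matrix.submatrix_apply, corr_apply, corr_apply, glue_assoc (Nat.le_succ s)]
  rfl

/-- The matrix product recursion for `ω`: peeling one site off a tail is exact for the matrices
`exactMat`. -/
theorem tailOp_eq (hZ : IsSelfAdjointONB A Z) {s : ℕ} (hs : s + 1 < N)
    (hrank : (fullCutMap Z ω (s + 1)).rank = k (s + 1))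
    (hH : compCut Z r ω U (s + 1) * pinv (compCut Z r ω U (s + 1)) = 1) (a : Fin (bondDim k s)) :
    tailOp Z ω U s a = ∑ b, tens (Nat.le_succ s) hs.le
      (∑ c, (exactMat Z r ω U s c a b : ℂ) • siteOp Z N s c) (tailOp Z ω U (s + 1) b) := by
  rw [tailOp, sum_glue (Nat.le_succ s) hs.le, sum_single_word (Nat.lt_of_succ_lt hs)]
  have h : ∀ c X, tail Z ω U s a (glue (fun _ : Win N s (s + 1) => c) X)
      = ∑ b, exactMat Z r ω U s c a b * tail Z ω U (s + 1) b X := fun c X => by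
    rw [tail_glue, ← exactMat_mul_tail hZ hs hrank hH, Matrix.mul_apply]
  simp only [h, tailOp, tens_sum_left, tens_sum_right, tens_smul_left, tens_smul_right, siteOp,
    tens_basisOp]
  push_cast
  simp only [Finset.sum_smul, Finset.smul_sum, smul_smul]
  rw [Finset.sum_comm]
  conv_rhs => rw [Finset.sum_comm]
  refine Finset.sum_congr rfl fun X _ => ?_
  rw [Finset.sum_comm]
  exact Finset.sum_congr rfl fun b _ => Finset.sum_congr rfl fun c _ => by rw [mul_comm]

end Realization

/-! ### Bounds on the tails and their dual operators. -/

section Bounds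

variable {d q N l r : ℕ} {k : ℕ → ℕ} {A : StarSubalgebra ℂ (Matrix (Fin d) (Fin d) ℂ)}
  {Z : Fin q → Matrix (Fin d) (Fin d) ℂ} {ω : Op (Fin N) d}
  {U : ∀ j, Matrix (Win N (j - l) j → Fin q) (Fin (k j)) ℝ}

theorem IsState.traceNorm_le (hω : IsState A ω) : traceNorm ω ≤ 1 := by
  have h := traceNorm_posSemidef_le hω.posSemidef
  rwa [hω.trace_eq_one, Complex.one_re] at h

theorem opNorm_transpose_le_one {p n : Type} [Fintype p] [DecidableEq p] [Fintype n]
    [DecidableEq n] {V : Matrix p n ℝ} (hV : Vᵀ * V = 1) : ‖Vᵀ‖ ≤ 1 := by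
  have h := Matrix.l2_opNorm_conjTranspose_mul_self V
  have h2 := Matrix.l2_opNorm_conjTranspose V
  rw [Matrix.conjTranspose_eq_transpose_of_trivial] at h h2
  rw [hV] at h
  have h3 := opNorm_one_le (n := n) (𝕜 := ℝ)
  rw [h2]
  nlinarith [norm_nonneg V]

/-- A tail operator is a marginal of `ω` contracted on the left with the operator Y given by one
column of the compression. That column is a unit vector, so Y has Hilbert-Schmidt norm 1 and
operator norm at most 1. -/
theorem traceNorm_tailOp_le (hZ : IsSelfAdjointONB A Z) (hω : IsState A ω) {s : ℕ} (hs : s ≤ N)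
    (hV : (leftMap U s)ᵀ * leftMap U s = 1) (b : Fin (bondDim k s)) :
    traceNorm (tailOp Z ω U s b) ≤ 1 := by
  refine traceNorm_le_of_forall _ fun T hT => ?_
  set V := leftMap U s with hVd
  set τ := marginal (s - l) N ω with hτ
  set Y : Op (Win N (s - l) s) d := ∑ y, (V y b : ℂ) • basisOp Z y with hY
  have hYn : ‖Y‖ ≤ 1 := by
    refine (opNorm_le_hsNorm Y).trans ?_
    have h1 := hsNorm_sum_basisOp_sq hZ fun y => V y b
    have h2 : ∑ y, V y b ^ 2 = 1 := by
      have := congrFun (congrFun hV b) b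
      rw [Matrix.mul_apply, Matrix.one_apply_eq] at this
      rw [← this]
      exact Finset.sum_congr rfl fun y _ => by rw [Matrix.transpose_apply, sq]
    rw [h2] at h1
    exact ((pow_eq_one_iff_of_nonneg (hsNorm_nonneg _) two_ne_zero).1 h1).le
  have hexp : τ = ∑ y, ∑ X, (coef Z τ (glue y X) : ℂ) •
      tens (Nat.sub_le s l) hs (basisOp Z y) (basisOp Z X) := by
    conv_lhs => rw [hτ, eq_sum_coef_basisOp hZ (marginal_mem_localAlg _ _ hω.mem)
      (isHermitian_marginal (s - l) N hω.posSemidef.isHermitian), sum_glue (Nat.sub_le s l) hs]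
    simp only [tens_basisOp, hτ]
  have e : (tailOp Z ω U s b * T).trace = (τ * tens (Nat.sub_le s l) hs Y T).trace := by
    have hy : ∀ y, (basisOp Z y * Y).trace = V y b := by
      intro y
      rw [hY, Matrix.mul_sum, Matrix.trace_sum]
      simp [trace_basisOp_mul hZ]
    conv_rhs => rw [hexp]
    simp only [Matrix.sum_mul, Matrix.trace_sum, Matrix.smul_mul, Matrix.trace_smul, smul_eq_mul,
      tens_mul_tens, trace_tens, hy]
    rw [Finset.sum_comm, tailOp, Matrix.sum_mul, Matrix.trace_sum]
    refine Finset.sum_congr rfl fun X _ => ?_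
    rw [Matrix.smul_mul, Matrix.trace_smul, tail, Matrix.mul_apply, smul_eq_mul]
    push_cast
    rw [Finset.sum_mul]
    refine Finset.sum_congr rfl fun y _ => ?_
    rw [Matrix.transpose_apply, corr_apply]
    ring
  rw [e]
  refine (norm_trace_mul_le_traceNorm _ _).trans ?_
  refine mul_le_one₀ ((traceNorm_marginal_le _ _ _).trans hω.traceNorm_le) (norm_nonneg _) ?_
  exact (opNorm_tens_le _ _ Y T).trans (mul_le_one₀ hYn (norm_nonneg _) hT)

theorem trace_basisOp_mul_extWin (hZ : IsSelfAdjointONB A Z) {s b : ℕ}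
    (h : ∀ i : Fin N, (s ≤ i.1 ∧ i.1 < b) → (s ≤ i.1 ∧ i.1 < N)) (W : Win N s N → Fin q)
    (X : Win N s b → Fin q) :
    (basisOp Z W * extWin h (basisOp Z X)).trace = (extendRight Z N s b W X : ℂ) := by
  rw [basisOp, basisOp, extWin_prodOp, prodOp_mul, trace_prodOp, extendRight]
  push_cast
  refine Finset.prod_congr rfl fun i _ => ?_
  rw [Matrix.trace_mul_comm]
  have h1 := i.2.1
  by_cases hi : i.1.1 < b
  · simp only [h1, hi, and_self, dif_pos]
    exact trace_mul_eq_ofReal_re (hZ.isHermitian _) (hZ.isHermitian _)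
  · simp only [hi, and_false, dif_neg, not_false_iff]
    exact trace_mul_eq_ofReal_re Matrix.isHermitian_one (hZ.isHermitian _)

/-- The dual operators have the columns of H⁺ as coefficients on the r sites after the cut and are
the identity further right; their pairings with the tails are the entries of H H⁺. -/
theorem exists_lift (hZ : IsSelfAdjointONB A Z) {s : ℕ} (hs : s ≤ N) {C : ℝ}
    (hH : compCut Z r ω U s * pinv (compCut Z r ω U s) = 1)
    (hC : ‖pinv (compCut Z r ω U s)‖ ≤ C) :
    ∃ L : Fin (bondDim k s) → Op (Win N s N) d, (∀ x, ‖L x‖ ≤ C) ∧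
      ∀ x y, (tailOp Z ω U s x * L y).trace = if x = y then 1 else 0 := by
  set P := pinv (compCut Z r ω U s) with hP
  have h : ∀ i : Fin N, (s ≤ i.1 ∧ i.1 < s + r) → (s ≤ i.1 ∧ i.1 < N) :=
    fun i hi => ⟨hi.1, i.2⟩
  refine ⟨fun y => extWin h (∑ X, (P X y : ℂ) • basisOp Z X), fun y => ?_, fun x y => ?_⟩
  -- The passage to the Hilbert-Schmidt norm takes place on the small window, after the identity
  -- factors, which cost nothing in operator norm, have been removed.
  · refine (opNorm_extWin_le h _).trans ((opNorm_le_hsNorm _).trans (le_trans ?_ hC))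
    refine le_of_sq_le_sq ?_ (norm_nonneg _)
    rw [hsNorm_sum_basisOp_sq hZ fun X => P X y]
    have h2 := norm_toEuclideanLin_le P (EuclideanSpace.single y 1)
    have h3 := pow_le_pow_left₀ (norm_nonneg _) h2 2
    rw [EuclideanSpace.norm_sq_eq] at h3
    simpa using h3
  · have e : extWin h (∑ X, (P X y : ℂ) • basisOp Z X)
        = ∑ X, (P X y : ℂ) • extWin h (basisOp Z X) := by
      change extWinLin h _ = _
      simp only [map_sum, map_smul]
      rfl
    have e2 : (tailOp Z ω U s x * extWin h (∑ X, (P X y : ℂ) • basisOp Z X)).trace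
        = (((compCut Z r ω U s * P) x y : ℝ) : ℂ) := by
      rw [e, tailOp, ← tail_mul_extendRight hZ hs, Matrix.mul_assoc]
      simp only [Matrix.sum_mul, Matrix.mul_sum, Matrix.trace_sum, Matrix.smul_mul,
        Matrix.mul_smul, Matrix.trace_smul, smul_eq_mul, trace_basisOp_mul_extWin hZ,
        Matrix.mul_apply]
      push_cast
      simp only [Finset.mul_sum]
      rw [Finset.sum_comm]
      refine Finset.sum_congr rfl fun W _ => Finset.sum_congr rfl fun X _ => ?_
      ring
    rw [e2, hH, Matrix.one_apply]
    split_ifs <;> simp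

theorem tail_zero_apply (a : Fin (bondDim k 0)) (X : Win N 0 N → Fin q) :
    tail Z ω U 0 a X = coef Z (marginal 0 N ω) X := by
  -- The left end 0 − l is only propositionally 0, so it is generalised to t before being replaced.
  have key : ∀ (t : ℕ) (_ : t = 0) (i : Fin 1),
      ((fun _ _ => 1 : Matrix (Win N t 0 → Fin q) (Fin 1) ℝ)ᵀ *
        corr Z t 0 N (marginal t N ω)) i X = coef Z (marginal 0 N ω) X := by
    rintro _ rfl i
    have : IsEmpty (Win N 0 0) := ⟨fun i => absurd i.2.2 (Nat.not_lt_zero _)⟩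
    rw [Matrix.mul_apply, Fintype.sum_unique]
    change (1 : ℝ) * _ = _
    rw [one_mul, corr_apply]
    congr 1
  exact key (0 - l) (Nat.zero_sub l) a

theorem tailOp_zero (hZ : IsSelfAdjointONB A Z) (hω : IsState A ω) (a : Fin (bondDim k 0)) :
    tailOp Z ω U 0 a = marginal 0 N ω := by
  conv_rhs => rw [eq_sum_coef_basisOp hZ (marginal_mem_localAlg _ _ hω.mem)
      (isHermitian_marginal 0 N hω.posSemidef.isHermitian)]
  simp only [tailOp, tail_zero_apply]

/-- At the left end the only tail is `ω` itself, and the identity is dual to it because `ω` has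
trace 1. -/
theorem exists_lift_zero (hZ : IsSelfAdjointONB A Z) (hω : IsState A ω) {C : ℝ} (hC : 1 ≤ C) :
    ∃ L : Fin (bondDim k 0) → Op (Win N 0 N) d, (∀ x, ‖L x‖ ≤ C) ∧
      ∀ x y, (tailOp Z ω U 0 x * L y).trace = if x = y then 1 else 0 := by
  refine ⟨fun _ => 1, fun _ => opNorm_one_le.trans hC, fun x y => ?_⟩
  have hxy : x = y := by
    change Fin 1 at x y
    exact Subsingleton.elim x y
  rw [tailOp_zero hZ hω, Matrix.mul_one, trace_marginal, hω.trace_eq_one, if_pos hxy]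

/-! ### The error of the site matrices -/

theorem corrAt_sub (a s b : ℕ) (τ τ' : Op (Win N a b) d) (c : Fin q) :
    corrAt Z a s b τ c - corrAt Z a s b τ' c = corrAt Z a s b (τ - τ') c := by
  ext Y X
  simp [corrAt_eq, corr_apply, coef_sub]

/-- Stacking over the letter at s lists every product-basis coefficient exactly once. Treating all
letters together thus avoids a factor depending on q. -/
theorem hsNorm_stack_corrAt_le (hZ : IsSelfAdjointONB A Z) {a s b : ℕ} (hs : s < N) (has : a ≤ s)
    (hsb : s + 1 ≤ b) (τ : Op (Win N a b) d) :
    hsNorm (stack fun c => corrAt Z a s b τ c) ≤ hsNorm τ := by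
  refine le_of_sq_le_sq ?_ (hsNorm_nonneg _)
  refine le_trans (le_of_eq ?_) (sum_coef_sq_le hZ τ)
  rw [hsNorm_stack_sq, sum_glue (has.trans (Nat.le_succ s)) hsb, sum_glue has (Nat.le_succ s)]
  simp only [sum_single_word hs, hsNorm_sq]
  rw [Finset.sum_comm]
  simp [corrAt_eq, corr_apply]

theorem hsNorm_stack_siteMat_sub_le (hZ : IsSelfAdjointONB A Z) (hω : IsState A ω)
    {cutEst : ∀ j : ℕ, Op (Win N (j - l) (j + r)) d}
    {siteEst : ∀ s : ℕ, Op (Win N (s - l) (s + 1 + r)) d} {s : ℕ} (hs : s + 1 < N)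
    {E C : ℝ}
    (hV : (leftMap U s)ᵀ * leftMap U s = 1)
    (hV' : (leftMap U (s + 1))ᵀ * leftMap U (s + 1) = 1)
    (hrank : (fullCutMap Z ω (s + 1)).rank = k (s + 1))
    (hH : compCut Z r ω U (s + 1) * pinv (compCut Z r ω U (s + 1)) = 1)
    (hC : ‖pinv (compCut Z r ω U (s + 1))‖ ≤ C)
    (hH' : (leftMap U (s + 1))ᵀ * corr Z (s + 1 - l) (s + 1) (s + 1 + r) (cutEst (s + 1)) *
      pinv ((leftMap U (s + 1))ᵀ * corr Z (s + 1 - l) (s + 1) (s + 1 + r) (cutEst (s + 1))) = 1)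
    (hC' : ‖pinv ((leftMap U (s + 1))ᵀ *
      corr Z (s + 1 - l) (s + 1) (s + 1 + r) (cutEst (s + 1)))‖ ≤ C)
    (hcut : hsNorm (cutEst (s + 1) - marginal (s + 1 - l) (s + 1 + r) ω) ≤ E)
    (hsite : hsNorm (siteEst s - marginal (s - l) (s + 1 + r) ω) ≤ E) :
    hsNorm (stack fun c => siteMat Z cutEst siteEst U s c - exactMat Z r ω U s c)
      ≤ E * C * (1 + C) := by
  have hs' : s < N := Nat.lt_of_succ_lt hs
  set V := leftMap U s
  set V' := leftMap U (s + 1)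
  set H := compCut Z r ω U (s + 1) with hHd
  set H' := V'ᵀ * corr Z (s + 1 - l) (s + 1) (s + 1 + r) (cutEst (s + 1)) with hH'd
  set τ := marginal (s - l) (s + 1 + r) ω with hτ
  have hE : 0 ≤ E := (hsNorm_nonneg _).trans hcut
  have hC0 : 0 ≤ C := (norm_nonneg _).trans hC
  -- K H = Vᵀ Ω_A and Ĥ Ĥ⁺ = 1 give a perturbation formula in which no difference of pseudoinverses
  -- appears.
  have e : ∀ c, siteMat Z cutEst siteEst U s c - exactMat Z r ω U s c
      = (Vᵀ * corrAt Z (s - l) s (s + 1 + r) (siteEst s - τ) c) * pinv H'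
        + exactMat Z r ω U s c * ((H - H') * pinv H') := by
    intro c
    rw [Matrix.sub_mul, hH', Matrix.mul_sub, Matrix.mul_one, ← Matrix.mul_assoc,
      exactMat_mul_compCut hZ hs hrank hH, ← corrAt_sub, siteMat, Matrix.mul_sub, Matrix.sub_mul]
    abel
  have hHH : ‖H - H'‖ ≤ E := by
    have h1 : H - H' = V'ᵀ * (corr Z (s + 1 - l) (s + 1) (s + 1 + r)
        (marginal (s + 1 - l) (s + 1 + r) ω) -
          corr Z (s + 1 - l) (s + 1) (s + 1 + r) (cutEst (s + 1))) := by
      rw [Matrix.mul_sub]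
      rfl
    rw [h1]
    refine (Matrix.l2_opNorm_mul _ _).trans ?_
    refine (mul_le_of_le_one_left (norm_nonneg _) (opNorm_transpose_le_one hV')).trans ?_
    rw [norm_sub_rev]
    exact (opNorm_le_hsNorm _).trans
      ((hsNorm_corr_sub_le hZ (Nat.sub_le _ _) (Nat.le_add_right _ _) _ _).trans hcut)
  -- The stacked site maps of a state have Hilbert-Schmidt norm at most 1; only the pseudoinverse
  -- contributes.
  have hK : hsNorm (stack fun c => exactMat Z r ω U s c) ≤ C := by
    have h1 : (stack fun c => exactMat Z r ω U s c)
        = (stack fun c => Vᵀ * corrAt Z (s - l) s (s + 1 + r) τ c) * pinv H := rfl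
    rw [h1]
    refine (hsNorm_mul_le_right _ _).trans ?_
    have h2 : hsNorm (stack fun c => Vᵀ * corrAt Z (s - l) s (s + 1 + r) τ c) ≤ 1 :=
      (hsNorm_stack_mul_le _ (opNorm_transpose_le_one hV) _).trans
        ((hsNorm_stack_corrAt_le hZ hs' (Nat.sub_le _ _) (Nat.le_add_right _ _) τ).trans
          ((hsNorm_le_traceNorm τ).trans
            ((traceNorm_marginal_le _ _ _).trans hω.traceNorm_le)))
    exact (mul_le_of_le_one_left (norm_nonneg _) h2).trans hC
  have hD : hsNorm (stack fun c => Vᵀ * corrAt Z (s - l) s (s + 1 + r) (siteEst s - τ) c) ≤ E :=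
    (hsNorm_stack_mul_le _ (opNorm_transpose_le_one hV) _).trans
        ((hsNorm_stack_corrAt_le hZ hs' (Nat.sub_le _ _) (Nat.le_add_right _ _) _).trans hsite)
  have e2 : (stack fun c => siteMat Z cutEst siteEst U s c - exactMat Z r ω U s c)
      = (stack fun c => Vᵀ * corrAt Z (s - l) s (s + 1 + r) (siteEst s - τ) c) * pinv H'
        + (stack fun c => exactMat Z r ω U s c) * ((H - H') * pinv H') := by
    rw [stack_mul, stack_mul]
    ext x b
    exact congrFun (congrFun (e x.1) x.2) b
  rw [e2]
  refine (hsNorm_add_le _ _).trans ?_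
  have h1 : hsNorm ((stack fun c => Vᵀ * corrAt Z (s - l) s (s + 1 + r) (siteEst s - τ) c) *
      pinv H') ≤ E * C :=
    (hsNorm_mul_le_right _ _).trans (mul_le_mul hD hC' (norm_nonneg _) hE)
  have h2 : hsNorm ((stack fun c => exactMat Z r ω U s c) * ((H - H') * pinv H')) ≤ C * (E * C) :=
    (hsNorm_mul_le_right _ _).trans (mul_le_mul hK ((Matrix.l2_opNorm_mul _ _).trans
      (mul_le_mul hHH hC' (norm_nonneg _) hE)) (norm_nonneg _) hC0)
  calc _ ≤ E * C + C * (E * C) := add_le_add h1 h2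
    _ = _ := by ring

/-- Passing from the Hilbert-Schmidt to the trace norm on a single site is the source of the factor
√d. -/
theorem traceNorm_sum_siteOp_le (hZ : IsSelfAdjointONB A Z) {s : ℕ} (hs : s < N)
    (t : Fin q → ℝ) :
    traceNorm (∑ c, (t c : ℂ) • siteOp Z N s c) ≤ √d * √(∑ c, t c ^ 2) := by
  refine (traceNorm_le_sqrt_card_mul_hsNorm _).trans (le_of_eq ?_)
  rw [card_single_word hs, Fintype.card_fin]
  congr 1
  rw [eq_comm, Real.sqrt_eq_iff_eq_sq (by positivity) (hsNorm_nonneg _)]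
  have h := hsNorm_sum_basisOp_sq hZ
    fun w : Win N s (s + 1) → Fin q => t (w ⟨⟨s, hs⟩, le_rfl, Nat.lt_succ_self s⟩)
  rw [sum_single_word hs, sum_single_word hs] at h
  exact h.symm

end Bounds

/-! ### Replacing the site matrices one at a time. -/

section Reconstruction

variable {d q N l r : ℕ} {k : ℕ → ℕ} {A : StarSubalgebra ℂ (Matrix (Fin d) (Fin d) ℂ)}
  {Z : Fin q → Matrix (Fin d) (Fin d) ℂ} {ω : Op (Fin N) d}
  {U : ∀ j, Matrix (Win N (j - l) j → Fin q) (Fin (k j)) ℝ}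
  {cutEst : ∀ j : ℕ, Op (Win N (j - l) (j + r)) d}
  {siteEst : ∀ s : ℕ, Op (Win N (s - l) (s + 1 + r)) d}

/-- `prefixMat` for words on the first `s` sites. -/
noncomputable def prefixWord (Z : Fin q → Matrix (Fin d) (Fin d) ℂ)
    (cutEst : ∀ j : ℕ, Op (Win N (j - l) (j + r)) d)
    (siteEst : ∀ s : ℕ, Op (Win N (s - l) (s + 1 + r)) d)
    (U : ∀ j, Matrix (Win N (j - l) j → Fin q) (Fin (k j)) ℝ) :
    (s : ℕ) → s < N → (Win N 0 s → Fin q) → Matrix (Fin 1) (Fin (bondDim k s)) ℝ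
  | 0, _, _ => fun _ _ => 1
  | s + 1, h, u => prefixWord Z cutEst siteEst U s (Nat.lt_of_succ_lt h)
        (fun i => u ⟨i.1, i.2.1, Nat.lt_succ_of_lt i.2.2⟩) *
      siteMat Z cutEst siteEst U s
        (u ⟨⟨s, Nat.lt_of_succ_lt h⟩, Nat.zero_le _, Nat.lt_succ_self s⟩)

theorem prefixMat_eq (w : Fin N → Fin q) (s : ℕ) (hs : s < N) :
    prefixMat Z cutEst siteEst U w s hs
      = prefixWord Z cutEst siteEst U s hs fun i => w i.1 := by
  induction s with
  | zero => rfl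
  | succ s ih => rw [prefixMat, prefixWord, ih]

/-- The operators on the first `s` sites with coefficients `prefixWord`. -/
noncomputable def prefixOp (Z : Fin q → Matrix (Fin d) (Fin d) ℂ)
    (cutEst : ∀ j : ℕ, Op (Win N (j - l) (j + r)) d)
    (siteEst : ∀ s : ℕ, Op (Win N (s - l) (s + 1 + r)) d)
    (U : ∀ j, Matrix (Win N (j - l) j → Fin q) (Fin (k j)) ℝ) (s : ℕ) (hs : s < N)
    (a : Fin (bondDim k s)) : Op (Win N 0 s) d :=
  ∑ u, (prefixWord Z cutEst siteEst U s hs u 0 a : ℂ) • basisOp Z u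

theorem prefixOp_succ (s : ℕ) (hs : s + 1 < N) (b : Fin (bondDim k (s + 1))) :
    prefixOp Z cutEst siteEst U (s + 1) hs b
      = ∑ a, tens (Nat.zero_le s) (Nat.le_succ s)
          (prefixOp Z cutEst siteEst U s (Nat.lt_of_succ_lt hs) a)
          (∑ c, (siteMat Z cutEst siteEst U s c a b : ℂ) • siteOp Z N s c) := by
  have h : ∀ (u : Win N 0 s → Fin q) (c : Fin q),
      prefixWord Z cutEst siteEst U (s + 1) hs (glue u fun _ : Win N s (s + 1) => c)
        = prefixWord Z cutEst siteEst U s (Nat.lt_of_succ_lt hs) u *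
          siteMat Z cutEst siteEst U s c := by
    intro u c
    rw [prefixWord]
    congr 2
    · funext i
      exact glue_left u _ i _
    · simp [glue]
  rw [prefixOp, sum_glue (Nat.zero_le s) (Nat.le_succ s)]
  simp only [sum_single_word (Nat.lt_of_succ_lt hs), h, Matrix.mul_apply, prefixOp, tens_sum_left,
    tens_sum_right, tens_smul_left, tens_smul_right, siteOp, tens_basisOp]
  push_cast
  simp only [Finset.sum_smul, Finset.smul_sum, smul_smul]
  rw [Finset.sum_comm]
  conv_rhs => rw [Finset.sum_comm]
  refine Finset.sum_congr rfl fun c _ => ?_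
  rw [Finset.sum_comm]
  exact Finset.sum_congr rfl fun a _ => Finset.sum_congr rfl fun u _ => by rw [mul_comm]

/-- The reconstruction up to the cut `s`, completed by the exact tail of `ω`. -/
noncomputable def hybrid (Z : Fin q → Matrix (Fin d) (Fin d) ℂ) (ω : Op (Fin N) d)
    (cutEst : ∀ j : ℕ, Op (Win N (j - l) (j + r)) d)
    (siteEst : ∀ s : ℕ, Op (Win N (s - l) (s + 1 + r)) d)
    (U : ∀ j, Matrix (Win N (j - l) j → Fin q) (Fin (k j)) ℝ) (s : ℕ) (hs : s < N) :
    Op (Win N 0 N) d :=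
  ∑ a, tens (Nat.zero_le s) hs.le (prefixOp Z cutEst siteEst U s hs a) (tailOp Z ω U s a)

theorem hybrid_zero (hZ : IsSelfAdjointONB A Z) (hω : IsState A ω) (h0 : 0 < N) :
    hybrid Z ω cutEst siteEst U 0 h0 = marginal 0 N ω := by
  have : IsEmpty (Win N 0 0) := ⟨fun i => absurd i.2.2 (Nat.not_lt_zero _)⟩
  have key : ∀ a : Fin (bondDim k 0), tens (Nat.zero_le 0) h0.le
      (prefixOp Z cutEst siteEst U 0 h0 a) (tailOp Z ω U 0 a) = marginal 0 N ω := by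
    intro a
    conv_rhs => rw [← tailOp_zero (U := U) hZ hω a]
    rw [prefixOp, Fintype.sum_unique, tens_smul_left, tailOp, tens_sum_right]
    simp only [tens_smul_right, tens_basisOp]
    have h1 : prefixWord Z cutEst siteEst U 0 h0 default 0 a = 1 := rfl
    rw [h1, Complex.ofReal_one, one_smul]
    rfl
  rw [hybrid]
  simp only [key]
  change ∑ _a : Fin 1, _ = _
  simp

/-- Once the exact tail at s is unfolded by one site, the two hybrids share their prefix and their
remaining tail and differ only in the matrix at s. -/
theorem hybrid_succ_sub (hZ : IsSelfAdjointONB A Z) {s : ℕ} (hs : s + 1 < N)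
    (hrank : (fullCutMap Z ω (s + 1)).rank = k (s + 1))
    (hH : compCut Z r ω U (s + 1) * pinv (compCut Z r ω U (s + 1)) = 1) :
    hybrid Z ω cutEst siteEst U (s + 1) hs
        - hybrid Z ω cutEst siteEst U s (Nat.lt_of_succ_lt hs)
      = ∑ a, tens (Nat.zero_le s) (Nat.lt_of_succ_lt hs).le
          (prefixOp Z cutEst siteEst U s (Nat.lt_of_succ_lt hs) a)
          (∑ b, tens (Nat.le_succ s) hs.le
            (∑ c, (((siteMat Z cutEst siteEst U s c - exactMat Z r ω U s c) a b : ℝ) : ℂ) •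
              siteOp Z N s c)
            (tailOp Z ω U (s + 1) b)) := by
  have e1 : hybrid Z ω cutEst siteEst U (s + 1) hs
      = ∑ a, tens (Nat.zero_le s) (Nat.lt_of_succ_lt hs).le
          (prefixOp Z cutEst siteEst U s (Nat.lt_of_succ_lt hs) a)
          (∑ b, tens (Nat.le_succ s) hs.le
            (∑ c, ((siteMat Z cutEst siteEst U s c a b : ℝ) : ℂ) • siteOp Z N s c)
            (tailOp Z ω U (s + 1) b)) := by
    rw [hybrid]
    simp only [prefixOp_succ, tens_sum_left (Nat.zero_le (s + 1)), ← tens_assoc]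
    rw [Finset.sum_comm]
    simp only [← tens_sum_right (Nat.zero_le s)]
  rw [e1, hybrid, ← Finset.sum_sub_distrib]
  refine Finset.sum_congr rfl fun a _ => ?_
  rw [tailOp_eq hZ hs hrank hH, ← tens_sub_right, ← Finset.sum_sub_distrib]
  congr 1
  refine Finset.sum_congr rfl fun b _ => ?_
  have hsub : ∀ P P' : Op (Win N s (s + 1)) d,
      tens (Nat.le_succ s) hs.le P (tailOp Z ω U (s + 1) b)
        - tens (Nat.le_succ s) hs.le P' (tailOp Z ω U (s + 1) b)
      = tens (Nat.le_succ s) hs.le (P - P') (tailOp Z ω U (s + 1) b) := by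
    intro P P'
    ext x y
    simp [tens, sub_mul]
  rw [hsub, ← Finset.sum_sub_distrib]
  congr 1
  refine Finset.sum_congr rfl fun c _ => ?_
  rw [Matrix.sub_apply, Complex.ofReal_sub, sub_smul]

/-- C is the norm of the dual operators, √d comes from one-site operators, and m from Cauchy-Schwarz
over at most m² entries; the tails contribute at most 1. -/
theorem traceNorm_hybrid_succ_sub_le (hZ : IsSelfAdjointONB A Z) (hω : IsState A ω) {s : ℕ}
    (hs : s + 1 < N) {C F : ℝ} {m : ℕ}
    (hV' : (leftMap U (s + 1))ᵀ * leftMap U (s + 1) = 1)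
    (hrank : (fullCutMap Z ω (s + 1)).rank = k (s + 1))
    (hH : compCut Z r ω U (s + 1) * pinv (compCut Z r ω U (s + 1)) = 1)
    (hlift : ∃ L : Fin (bondDim k s) → Op (Win N s N) d, (∀ x, ‖L x‖ ≤ C) ∧
      ∀ x y, (tailOp Z ω U s x * L y).trace = if x = y then 1 else 0)
    (hC0 : 0 ≤ C) (hm : bondDim k s ≤ m) (hm' : bondDim k (s + 1) ≤ m)
    (hF : hsNorm (stack fun c => siteMat Z cutEst siteEst U s c - exactMat Z r ω U s c) ≤ F) :
    traceNorm (hybrid Z ω cutEst siteEst U (s + 1) hs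
        - hybrid Z ω cutEst siteEst U s (Nat.lt_of_succ_lt hs))
      ≤ C * (m * √d * F) *
        traceNorm (hybrid Z ω cutEst siteEst U s (Nat.lt_of_succ_lt hs)) := by
  obtain ⟨L, hL, hBL⟩ := hlift
  have hF0 : 0 ≤ F := (hsNorm_nonneg _).trans hF
  rw [hybrid_succ_sub hZ hs hrank hH]
  refine (traceNorm_sum_tens_le _ _ _ (tailOp Z ω U s) _ L hL hBL).trans ?_
  refine mul_le_mul_of_nonneg_right (mul_le_mul_of_nonneg_left ?_ hC0) (traceNorm_nonneg _)
  set Δ : Fin q → Matrix (Fin (bondDim k s)) (Fin (bondDim k (s + 1))) ℝ :=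
    fun c => siteMat Z cutEst siteEst U s c - exactMat Z r ω U s c with hΔ
  have h1 : ∀ a b, traceNorm (tens (Nat.le_succ s) hs.le
      (∑ c, ((Δ c a b : ℝ) : ℂ) • siteOp Z N s c) (tailOp Z ω U (s + 1) b))
      ≤ √d * √(∑ c, Δ c a b ^ 2) := by
    intro a b
    refine (traceNorm_tens_le _ _ _ _).trans ?_
    refine (mul_le_of_le_one_right (traceNorm_nonneg _)
      (traceNorm_tailOp_le hZ hω hs.le hV' b)).trans ?_
    exact traceNorm_sum_siteOp_le hZ (Nat.lt_of_succ_lt hs) fun c => Δ c a b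
  calc ∑ a, traceNorm (∑ b, tens (Nat.le_succ s) hs.le
          (∑ c, ((Δ c a b : ℝ) : ℂ) • siteOp Z N s c) (tailOp Z ω U (s + 1) b))
      ≤ ∑ a, ∑ b, √d * √(∑ c, Δ c a b ^ 2) :=
        Finset.sum_le_sum fun a _ => (traceNorm_sum_le _ _).trans
          (Finset.sum_le_sum fun b _ => h1 a b)
    _ = √d * ∑ a, ∑ b, √(∑ c, Δ c a b ^ 2) := by simp only [Finset.mul_sum]
    _ ≤ √d * (m * F) := by
        refine mul_le_mul_of_nonneg_left ?_ (Real.sqrt_nonneg _)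
        refine (sum_sqrt_le_mul_hsNorm_stack Δ).trans ?_
        refine mul_le_mul ?_ hF (hsNorm_nonneg _) (Nat.cast_nonneg m)
        rw [Fintype.card_fin, Fintype.card_fin]
        refine Real.sqrt_le_iff.2 ⟨Nat.cast_nonneg m, ?_⟩
        rw [sq]
        gcongr
    _ = _ := by ring

end Reconstruction

/-! ### The last site, which has no pseudoinverse. -/

section LastSite

variable {d q n l r : ℕ} {k : ℕ → ℕ} {A : StarSubalgebra ℂ (Matrix (Fin d) (Fin d) ℂ)}
  {Z : Fin q → Matrix (Fin d) (Fin d) ℂ} {ω : Op (Fin (n + 1)) d}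
  {U : ∀ j, Matrix (Win (n + 1) (j - l) j → Fin q) (Fin (k j)) ℝ}
  {cutEst : ∀ j : ℕ, Op (Win (n + 1) (j - l) (j + r)) d}
  {siteEst : ∀ s : ℕ, Op (Win (n + 1) (s - l) (s + 1 + r)) d}

/-- The matrices of the last site, as columns. -/
noncomputable def lastCol (Z : Fin q → Matrix (Fin d) (Fin d) ℂ)
    (τ : Op (Win (n + 1) (n - l) (n + 1 + r)) d)
    (U : ∀ j, Matrix (Win (n + 1) (j - l) j → Fin q) (Fin (k j)) ℝ) (c : Fin q) :
    Matrix (Fin (bondDim k n)) (Fin 1) ℝ :=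
  ((leftMap U n)ᵀ * corrAt Z (n - l) n (n + 1 + r) τ c).submatrix id fun _ => emptyWord (r := r)

theorem reconstructedValue_eq [NeZero (n + 1)] (w : Fin (n + 1) → Fin q) :
    reconstructedValue Z cutEst siteEst U w
      = (prefixMat Z cutEst siteEst U w n (Nat.lt_succ_self n) *
          lastCol Z (siteEst n) U (w ⟨n, Nat.lt_succ_self n⟩)) 0 0 := rfl

theorem reconstructedValue_glue [NeZero (n + 1)] (u : Win (n + 1) 0 n → Fin q) (c : Fin q) :
    reconstructedValue Z cutEst siteEst U
        (fullEquiv (n + 1) (Fin q) (glue u fun _ : Win (n + 1) n (n + 1) => c))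
      = ∑ a, prefixWord Z cutEst siteEst U n (Nat.lt_succ_self n) u 0 a *
          lastCol Z (siteEst n) U c a 0 := by
  set w := fullEquiv (n + 1) (Fin q) (glue u fun _ : Win (n + 1) n (n + 1) => c) with hw
  have e1 : (fun i : Win (n + 1) 0 n => w i.1) = u := by
    funext i
    exact glue_left u (fun _ : Win (n + 1) n (n + 1) => c) i ⟨Nat.zero_le _, i.1.2⟩
  have e2 : w ⟨n, Nat.lt_succ_self n⟩ = c := by
    simp [hw, fullEquiv, Equiv.arrowCongr, Equiv.subtypeUnivEquiv, glue]
  rw [reconstructedValue_eq, prefixMat_eq, e1, e2, Matrix.mul_apply]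

theorem submatrix_fullEquiv_prodOp {N : ℕ} (w : Fin N → Fin q) :
    (prodOp fun i => Z (w i)).submatrix (fullEquiv N (Fin d)) (fullEquiv N (Fin d))
      = basisOp Z ((fullEquiv N (Fin q)).symm w) := by
  ext x y
  exact (Fintype.prod_equiv (Equiv.subtypeUnivEquiv (p := fun i : Fin N => 0 ≤ i.1 ∧ i.1 < N)
    fun i => ⟨Nat.zero_le _, i.2⟩) _ _ fun i => rfl).symm

theorem marginal_reconstruct [NeZero (n + 1)] :
    marginal 0 (n + 1) (reconstruct Z cutEst siteEst U)
      = ∑ a, tens (Nat.zero_le n) (Nat.le_succ n)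
          (prefixOp Z cutEst siteEst U n (Nat.lt_succ_self n) a)
          (∑ c, (lastCol Z (siteEst n) U c a 0 : ℂ) • siteOp Z (n + 1) n c) := by
  have h1 : marginal 0 (n + 1) (reconstruct Z cutEst siteEst U)
      = ∑ w : Win (n + 1) 0 (n + 1) → Fin q,
        ((reconstructedValue Z cutEst siteEst U (fullEquiv (n + 1) (Fin q) w) : ℝ) : ℂ) •
          basisOp Z w := by
    rw [marginal_full, reconstruct]
    have e : ∀ f : (Fin (n + 1) → Fin q) → Op (Fin (n + 1)) d, (∑ w, f w).submatrix
        (fullEquiv (n + 1) (Fin d)) (fullEquiv (n + 1) (Fin d))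
        = ∑ w, (f w).submatrix (fullEquiv (n + 1) (Fin d)) (fullEquiv (n + 1) (Fin d)) := by
      intro f
      ext x y
      simp [Matrix.sum_apply]
    rw [e]
    refine (Fintype.sum_equiv (fullEquiv (n + 1) (Fin q)) _ _ fun w => ?_).symm
    have h := submatrix_fullEquiv_prodOp (Z := Z) (fullEquiv (n + 1) (Fin q) w)
    rw [Equiv.symm_apply_apply] at h
    rw [← h]
    rfl
  rw [h1, sum_glue (Nat.zero_le n) (Nat.le_succ n)]
  simp only [sum_single_word (Nat.lt_succ_self n), reconstructedValue_glue, prefixOp,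
    tens_sum_left, tens_sum_right, tens_smul_left, tens_smul_right, siteOp, tens_basisOp]
  push_cast
  simp only [Finset.sum_smul, Finset.smul_sum, smul_smul]
  rw [Finset.sum_comm]
  conv_rhs => rw [Finset.sum_comm]
  refine Finset.sum_congr rfl fun c _ => ?_
  rw [Finset.sum_comm]
  exact Finset.sum_congr rfl fun a _ => Finset.sum_congr rfl fun u _ => by rw [mul_comm]

/-- Beyond the last site there is nothing to extend: the right extension matrices are empty products
equal to 1, whatever the nominal right end of the window. -/
theorem tailOp_last (hZ : IsSelfAdjointONB A Z) (a : Fin (bondDim k n)) :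
    tailOp Z ω U n a = ∑ c, (lastCol Z (marginal (n - l) (n + 1 + r) ω) U c a 0 : ℂ) •
      siteOp Z (n + 1) n c := by
  have hemp : IsEmpty (Win (n + 1) (n + 1) (n + 1)) :=
    ⟨fun i => absurd i.2.2 (not_lt.2 i.2.1)⟩
  have hone : ∀ (b : ℕ) (W : Win (n + 1) (n + 1) (n + 1) → Fin q)
      (X : Win (n + 1) (n + 1) b → Fin q), extendRight Z (n + 1) (n + 1) b W X = 1 :=
    fun b W X => Finset.prod_of_isEmpty _
  rw [tailOp, sum_single_word (Nat.lt_succ_self n)]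
  refine Finset.sum_congr rfl fun c _ => ?_
  have e : (fun _ => c : Win (n + 1) n (n + 1) → Fin q)
      = glue (fun _ : Win (n + 1) n (n + 1) => c) (hemp.elim : Win (n + 1) (n + 1) (n + 1) → _) := by
    funext i
    simp [glue, i.2.2]
  have h : tail Z ω U n a (fun _ => c)
      = lastCol Z (marginal (n - l) (n + 1 + r) ω) U c a 0 := by
    rw [e, tail_glue, lastCol, Matrix.submatrix_apply, corrAt_marginal hZ (Nat.lt_succ_self n) le_rfl,
      corrAt_marginal hZ (Nat.lt_succ_self n) (Nat.le_add_right _ _), ← Matrix.mul_assoc,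
      ← Matrix.mul_assoc _ _ (extendRight Z (n + 1) (n + 1) (n + 1 + r)), Matrix.mul_apply,
      Matrix.mul_apply]
    simp only [hone, id]
  rw [h]
  rfl

theorem marginal_reconstruct_sub_hybrid [NeZero (n + 1)] (hZ : IsSelfAdjointONB A Z) :
    marginal 0 (n + 1) (reconstruct Z cutEst siteEst U)
        - hybrid Z ω cutEst siteEst U n (Nat.lt_succ_self n)
      = ∑ a, tens (Nat.zero_le n) (Nat.le_succ n)
          (prefixOp Z cutEst siteEst U n (Nat.lt_succ_self n) a)
          (∑ c, (((lastCol Z (siteEst n) U c -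
            lastCol Z (marginal (n - l) (n + 1 + r) ω) U c) a 0 : ℝ) : ℂ) •
              siteOp Z (n + 1) n c) := by
  rw [marginal_reconstruct, hybrid, ← Finset.sum_sub_distrib]
  refine Finset.sum_congr rfl fun a _ => ?_
  rw [tailOp_last hZ, ← tens_sub_right, ← Finset.sum_sub_distrib]
  congr 1
  refine Finset.sum_congr rfl fun c _ => ?_
  rw [Matrix.sub_apply, Complex.ofReal_sub, sub_smul]

/-- There is a single word to the right of the last site, so selecting its column keeps the whole
matrix and the bound for stacked site maps applies. -/
theorem hsNorm_stack_lastCol_sub_le (hZ : IsSelfAdjointONB A Z)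
    (hV : (leftMap U n)ᵀ * leftMap U n = 1) (τ τ' : Op (Win (n + 1) (n - l) (n + 1 + r)) d) :
    hsNorm (stack fun c => lastCol Z τ U c - lastCol Z τ' U c) ≤ hsNorm (τ - τ') := by
  have hemp : IsEmpty (Win (n + 1) (n + 1) (n + 1 + r)) :=
    ⟨fun i => absurd i.1.2 (not_lt.2 i.2.1)⟩
  refine le_trans (le_of_eq ?_) ((hsNorm_stack_mul_le _ (opNorm_transpose_le_one hV) _).trans
    (hsNorm_stack_corrAt_le hZ (Nat.lt_succ_self n) (Nat.sub_le _ _) (Nat.le_add_right _ _)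
      (τ - τ')))
  rw [hsNorm, hsNorm]
  congr 1
  refine Finset.sum_congr rfl fun x _ => ?_
  rw [Fintype.sum_unique, Fintype.sum_unique]
  congr 2
  rw [stack, stack, ← corrAt_sub, Matrix.mul_sub]
  rw [Matrix.sub_apply, Matrix.sub_apply, lastCol, lastCol, Matrix.submatrix_apply,
    Matrix.submatrix_apply]
  have he : (emptyWord (N := n + 1) (q := q) (r := r)) = (default : Win (n + 1) (n + 1) (n + 1 + r) → Fin q) :=
    @Subsingleton.elim (Win (n + 1) (n + 1) (n + 1 + r) → Fin q) _ _ _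
  rw [he]
  rfl

theorem traceNorm_reconstruct_sub_hybrid_le [NeZero (n + 1)] (hZ : IsSelfAdjointONB A Z)
    {C E : ℝ} {m : ℕ} (hV : (leftMap U n)ᵀ * leftMap U n = 1)
    (hlift : ∃ L : Fin (bondDim k n) → Op (Win (n + 1) n (n + 1)) d, (∀ x, ‖L x‖ ≤ C) ∧
      ∀ x y, (tailOp Z ω U n x * L y).trace = if x = y then 1 else 0)
    (hC0 : 0 ≤ C) (hm : bondDim k n ≤ m)
    (hsite : hsNorm (siteEst n - marginal (n - l) (n + 1 + r) ω) ≤ E) :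
    traceNorm (marginal 0 (n + 1) (reconstruct Z cutEst siteEst U)
        - hybrid Z ω cutEst siteEst U n (Nat.lt_succ_self n))
      ≤ C * (m * √d * E) *
        traceNorm (hybrid Z ω cutEst siteEst U n (Nat.lt_succ_self n)) := by
  obtain ⟨L, hL, hBL⟩ := hlift
  rw [marginal_reconstruct_sub_hybrid hZ]
  refine (traceNorm_sum_tens_le _ _ _ (tailOp Z ω U n) _ L hL hBL).trans ?_
  refine mul_le_mul_of_nonneg_right (mul_le_mul_of_nonneg_left ?_ hC0) (traceNorm_nonneg _)
  set Δ : Fin q → Matrix (Fin (bondDim k n)) (Fin 1) ℝ := fun c =>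
    lastCol Z (siteEst n) U c - lastCol Z (marginal (n - l) (n + 1 + r) ω) U c with hΔ
  calc ∑ a, traceNorm (∑ c, ((Δ c a 0 : ℝ) : ℂ) • siteOp Z (n + 1) n c)
      ≤ ∑ a, √d * √(∑ c, Δ c a 0 ^ 2) :=
        Finset.sum_le_sum fun a _ =>
          traceNorm_sum_siteOp_le hZ (Nat.lt_succ_self n) fun c => Δ c a 0
    _ = √d * ∑ a, ∑ b : Fin 1, √(∑ c, Δ c a b ^ 2) := by simp [Finset.mul_sum]
    _ ≤ √d * (m * E) := by
        refine mul_le_mul_of_nonneg_left ?_ (Real.sqrt_nonneg _)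
        refine (sum_sqrt_le_mul_hsNorm_stack Δ).trans ?_
        refine mul_le_mul ?_ ((hsNorm_stack_lastCol_sub_le hZ hV _ _).trans hsite)
          (hsNorm_nonneg _) (Nat.cast_nonneg m)
        rw [Fintype.card_fin, Fintype.card_fin, Nat.cast_one, mul_one]
        refine Real.sqrt_le_iff.2 ⟨Nat.cast_nonneg m, ?_⟩
        have h1 : (bondDim k n : ℝ) ≤ m := by exact_mod_cast hm
        -- With one column √m would do; it is weakened to m to match the other sites.
        have h2 : (m : ℝ) ≤ (m : ℝ) ^ 2 := by exact_mod_cast Nat.le_self_pow two_ne_zero m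
        exact h1.trans h2
    _ = _ := by ring

end LastSite

/-- A step error relative to ‖X‖₁ compounds multiplicatively: x bounds one plus the error so far,
hence also ‖X‖₁, and the step multiplies it by 1 + δ. -/
theorem traceNorm_sub_le_of_step {n : Type} [Fintype n] [DecidableEq n] {X X' M : Matrix n n ℂ}
    {δ x : ℝ} (hδ : 0 ≤ δ) (hM : traceNorm M ≤ 1) (h : traceNorm (X' - X) ≤ δ * traceNorm X)
    (hX : traceNorm (X - M) ≤ x - 1) : traceNorm (X' - M) ≤ (1 + δ) * x - 1 := by
  have h1 : traceNorm X ≤ x := by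
    have := traceNorm_add_le (X - M) M
    rw [sub_add_cancel] at this
    linarith
  have h2 : traceNorm (X' - M) ≤ traceNorm (X' - X) + traceNorm (X - M) := by
    have := traceNorm_add_le (X' - X) (X - M)
    rwa [sub_add_sub_cancel] at this
  have h3 : δ * traceNorm X ≤ δ * x := by gcongr
  linarith

/-! ### Accumulating the errors along the chain. -/

section Main

variable {d q n l r : ℕ} {k : ℕ → ℕ} {A : StarSubalgebra ℂ (Matrix (Fin d) (Fin d) ℂ)}
  {Z : Fin q → Matrix (Fin d) (Fin d) ℂ} {ω : Op (Fin (n + 1)) d}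
  {U : ∀ j, Matrix (Win (n + 1) (j - l) j → Fin q) (Fin (k j)) ℝ}
  {cutEst : ∀ j : ℕ, Op (Win (n + 1) (j - l) (j + r)) d}
  {siteEst : ∀ s : ℕ, Op (Win (n + 1) (s - l) (s + 1 + r)) d}

/-- The error of the reconstruction in terms of the conditioning of the compressed correlation
maps and the error of the estimates. -/
theorem traceNorm_reconstruct_sub_le [NeZero (n + 1)] (hZ : IsSelfAdjointONB A Z)
    (hω : IsState A ω) {C E : ℝ} {m : ℕ} (hC : 1 ≤ C)
    (hV : ∀ s < n + 1, (leftMap U s)ᵀ * leftMap U s = 1)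
    (hm : ∀ s < n + 1, bondDim k s ≤ m)
    (hrank : ∀ s, s + 1 < n + 1 → (fullCutMap Z ω (s + 1)).rank = k (s + 1))
    (hH : ∀ s, s + 1 < n + 1 → compCut Z r ω U (s + 1) * pinv (compCut Z r ω U (s + 1)) = 1 ∧
      ‖pinv (compCut Z r ω U (s + 1))‖ ≤ C)
    (hH' : ∀ s, s + 1 < n + 1 →
      (leftMap U (s + 1))ᵀ * corr Z (s + 1 - l) (s + 1) (s + 1 + r) (cutEst (s + 1)) *
        pinv ((leftMap U (s + 1))ᵀ *
          corr Z (s + 1 - l) (s + 1) (s + 1 + r) (cutEst (s + 1))) = 1 ∧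
      ‖pinv ((leftMap U (s + 1))ᵀ *
        corr Z (s + 1 - l) (s + 1) (s + 1 + r) (cutEst (s + 1)))‖ ≤ C)
    (hcut : ∀ s, s + 1 < n + 1 →
      hsNorm (cutEst (s + 1) - marginal (s + 1 - l) (s + 1 + r) ω) ≤ E)
    (hsite : ∀ s < n + 1, hsNorm (siteEst s - marginal (s - l) (s + 1 + r) ω) ≤ E) :
    traceNorm (marginal 0 (n + 1) (reconstruct Z cutEst siteEst U) - marginal 0 (n + 1) ω)
      ≤ (1 + C * (m * √d * (E * C * (1 + C)))) ^ (n + 1) - 1 := by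
  have hC0 : 0 ≤ C := zero_le_one.trans hC
  have hE : 0 ≤ E := (hsNorm_nonneg _).trans (hsite 0 (Nat.succ_pos n))
  set δ := C * (m * √d * (E * C * (1 + C))) with hδ
  have hδ0 : 0 ≤ δ := by positivity
  have hM : traceNorm (marginal 0 (n + 1) ω) ≤ 1 :=
    (traceNorm_marginal_le _ _ _).trans hω.traceNorm_le
  have hlift : ∀ s < n + 1, ∃ L : Fin (bondDim k s) → Op (Win (n + 1) s (n + 1)) d,
      (∀ x, ‖L x‖ ≤ C) ∧
      ∀ x y, (tailOp Z ω U s x * L y).trace = if x = y then 1 else 0 := by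
    intro s hs
    rcases s with _ | s
    · exact exists_lift_zero hZ hω hC
    · exact exists_lift hZ hs.le (hH s hs).1 (hH s hs).2
  have hind : ∀ s (hs : s < n + 1),
      traceNorm (hybrid Z ω cutEst siteEst U s hs - marginal 0 (n + 1) ω) ≤ (1 + δ) ^ s - 1 := by
    intro s
    induction s with
    | zero =>
      intro hs
      rw [hybrid_zero hZ hω, sub_self, traceNorm_zero, pow_zero, sub_self]
    | succ s ih =>
      intro hs
      have hs' : s < n + 1 := Nat.lt_of_succ_lt hs
      rw [pow_succ, mul_comm]
      refine traceNorm_sub_le_of_step hδ0 hM ?_ (ih hs')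
      exact traceNorm_hybrid_succ_sub_le hZ hω hs (hV _ hs) (hrank s hs) (hH s hs).1
        (hlift s hs') hC0 (hm s hs') (hm _ hs)
        (hsNorm_stack_siteMat_sub_le hZ hω hs (hV s hs') (hV _ hs) (hrank s hs) (hH s hs).1
          (hH s hs).2 (hH' s hs).1 (hH' s hs).2 (hcut s hs) (hsite s hs'))
  have hn := Nat.lt_succ_self n
  rw [pow_succ, mul_comm]
  refine traceNorm_sub_le_of_step hδ0 hM ?_ (hind n hn)
  refine (traceNorm_reconstruct_sub_hybrid_le hZ (hV n hn) (hlift n hn) hC0 (hm n hn)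
    (hsite n hn)).trans ?_
  refine mul_le_mul_of_nonneg_right ?_ (traceNorm_nonneg _)
  rw [hδ]
  -- The last site has the smaller error E, which C ≥ 1 absorbs into the common δ.
  have h1 : E ≤ E * C * (1 + C) := by
    rw [mul_assoc]
    exact le_mul_of_one_le_right hE (by nlinarith)
  gcongr

end Main

/-! ### Conditioning of the truncated factors -/

section Conditioning

theorem norm_toLp_sq_eq_dotProduct {p : Type} [Fintype p] (v : p → ℝ) :
    ‖(WithLp.toLp 2 v : EuclideanSpace ℝ p)‖ ^ 2 = v ⬝ᵥ v := by
  rw [EuclideanSpace.norm_sq_eq, dotProduct]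
  exact Finset.sum_congr rfl fun i _ => by rw [Real.norm_eq_abs, sq_abs, sq]

/-- For left singular vectors, (UᵀM)(UᵀM)ᵀ is diagonal with the squared singular values as entries.
-/
theorem IsTruncatedLeftFactor.le_norm {p n : Type} [Fintype p] [Fintype n] [DecidableEq p]
    [DecidableEq n] {κ : ℕ} {M : Matrix p n ℝ} {U : Matrix p (Fin κ) ℝ}
    (h : IsTruncatedLeftFactor M U) {c : ℝ} (hc : 0 ≤ c) (hs : ∀ i : Fin κ, c ≤ sing M i)
    (y : EuclideanSpace ℝ (Fin κ)) : c * ‖y‖ ≤ ‖Matrix.toEuclideanLin (Uᵀ * M)ᵀ y‖ := by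
  refine le_of_sq_le_sq ?_ (norm_nonneg _)
  rw [Matrix.toLpLin_apply, norm_toLp_sq_eq_dotProduct, mul_pow]
  have h1 : Uᵀ * M * (Uᵀ * M)ᵀ = Matrix.diagonal fun i : Fin κ => sing M i ^ 2 := by
    rw [Matrix.transpose_mul, Matrix.transpose_transpose]
    calc Uᵀ * M * (Mᵀ * U) = Uᵀ * (M * Mᵀ * U) := by simp only [Matrix.mul_assoc]
      _ = _ := by rw [h.2, ← Matrix.mul_assoc, h.1, Matrix.one_mul]
  have h2 : ((Uᵀ * M)ᵀ *ᵥ y.ofLp) ⬝ᵥ ((Uᵀ * M)ᵀ *ᵥ y.ofLp)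
      = ∑ i : Fin κ, sing M i ^ 2 * y i ^ 2 := by
    rw [Matrix.dotProduct_mulVec, Matrix.vecMul_transpose, Matrix.mulVec_mulVec, h1, dotProduct]
    refine Finset.sum_congr rfl fun i _ => ?_
    rw [Matrix.mulVec_diagonal]
    ring
  rw [h2, EuclideanSpace.norm_sq_eq, Finset.mul_sum]
  refine Finset.sum_le_sum fun i _ => ?_
  rw [Real.norm_eq_abs, sq_abs]
  have := hs i
  gcongr

theorem le_norm_of_norm_sub_le {p n : Type} [Fintype p] [Fintype n] [DecidableEq p]
    [DecidableEq n] {H H' : Matrix p n ℝ} {c e : ℝ} (h : ‖H - H'‖ ≤ e)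
    (hc : ∀ y : EuclideanSpace ℝ p, c * ‖y‖ ≤ ‖Matrix.toEuclideanLin Hᵀ y‖)
    (y : EuclideanSpace ℝ p) : (c - e) * ‖y‖ ≤ ‖Matrix.toEuclideanLin H'ᵀ y‖ := by
  have h1 : ‖Matrix.toEuclideanLin (H - H')ᵀ y‖ ≤ e * ‖y‖ := by
    refine (norm_toEuclideanLin_le _ _).trans ?_
    have : ‖(H - H')ᵀ‖ = ‖H - H'‖ := by
      rw [← Matrix.conjTranspose_eq_transpose_of_trivial, Matrix.l2_opNorm_conjTranspose]
    rw [this]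
    gcongr
  have h2 : Matrix.toEuclideanLin Hᵀ y
      = Matrix.toEuclideanLin H'ᵀ y + Matrix.toEuclideanLin (H - H')ᵀ y := by
    rw [← LinearMap.add_apply, ← map_add, ← Matrix.transpose_add, add_sub_cancel]
  have h3 := hc y
  rw [h2] at h3
  have h4 := norm_add_le (Matrix.toEuclideanLin H'ᵀ y) (Matrix.toEuclideanLin (H - H')ᵀ y)
  linarith

theorem leftMap_zero_orthonormal {N q l : ℕ} {k : ℕ → ℕ}
    (U : ∀ j, Matrix (Win N (j - l) j → Fin q) (Fin (k j)) ℝ) :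
    (leftMap U 0)ᵀ * leftMap U 0 = 1 := by
  have : IsEmpty (Win N (0 - l) 0) := ⟨fun i => absurd i.2.2 (Nat.not_lt_zero _)⟩
  ext a b
  have hab : a = b := by
    change Fin 1 at a b
    exact Subsingleton.elim a b
  rw [Matrix.mul_apply, Fintype.sum_unique, hab, Matrix.one_apply_eq]
  exact one_mul (1 : ℝ)

end Conditioning

/-! ### Errors of the estimates -/

section Estimates

variable {d q N : ℕ} {A : StarSubalgebra ℂ (Matrix (Fin d) (Fin d) ℂ)}
  {Z : Fin q → Matrix (Fin d) (Fin d) ℂ} {ω σ : Op (Fin N) d}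

/-- A difference of states is traceless and self-adjoint, so a trace norm of 2x gives a
Hilbert-Schmidt norm of √2 x ≤ 3x/2 instead of 2x. -/
theorem hsNorm_marginal_sub_le (hω : IsState A ω) (hσ : IsState A σ) {t : ℕ} {x : ℝ} (ht : t ≤ N)
    (hx : ∀ a b : ℕ, b = a + t → b ≤ N →
      traceDist (marginal a b σ) (marginal a b ω) ≤ x) {a b : ℕ} (hab : b ≤ a + t ∨ t = N) :
    hsNorm (marginal a b σ - marginal a b ω) ≤ 3 / 2 * x := by
  -- The window may stick out of the chain; shifting its left end gives t genuine sites containing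
  -- all of its sites.
  set a' := min a (N - t) with ha'
  have hinc : ∀ i : Fin N, (a ≤ i.1 ∧ i.1 < b) → (a' ≤ i.1 ∧ i.1 < a' + t) := by
    intro i hi
    have := i.2
    omega
  have h1 := hx a' (a' + t) rfl (by omega)
  rw [traceDist, ← marginal_sub] at h1
  have hx0 : 0 ≤ x := le_trans (div_nonneg (traceNorm_nonneg _) zero_le_two) h1
  have hherm : (marginal a b (σ - ω)).IsHermitian :=
    isHermitian_marginal a b (hσ.posSemidef.isHermitian.sub hω.posSemidef.isHermitian)
  have htr : (marginal a b (σ - ω)).trace = 0 := by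
    rw [trace_marginal, Matrix.trace_sub, hσ.trace_eq_one, hω.trace_eq_one, sub_self]
  have h2 := two_mul_hsNorm_sq_le hherm htr
  have h3 := traceNorm_marginal_le_of_le hinc (σ - ω)
  have h4 : traceNorm (marginal a b (σ - ω)) ≤ 2 * x := by linarith
  have h5 := pow_le_pow_left₀ (traceNorm_nonneg _) h4 2
  rw [← marginal_sub]
  refine le_of_sq_le_sq ?_ (by positivity)
  nlinarith

theorem sing_corr_marginal_le_one (hZ : IsSelfAdjointONB A Z) (hω : IsState A ω) {a j b : ℕ}
    (haj : a ≤ j) (hjb : j ≤ b) (i : ℕ) : sing (corr Z a j b (marginal a b ω)) i ≤ 1 :=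
  (sing_le_norm _ i).trans ((opNorm_le_hsNorm _).trans ((hsNorm_corr_le hZ haj hjb _).trans
    ((hsNorm_le_traceNorm _).trans ((traceNorm_marginal_le _ _ _).trans hω.traceNorm_le))))

/-- Combines (1 + δ)^n ≤ exp(nδ) with exp(y) − 1 ≤ 2y for 0 ≤ y ≤ 1. -/
theorem one_add_pow_sub_one_le {δ e : ℝ} (hδ : 0 ≤ δ) (he : e < 1) (n : ℕ)
    (h : n * δ ≤ e / 2) : (1 + δ) ^ n - 1 ≤ e := by
  have h0 : 0 ≤ n * δ := by positivity
  have h1 : (1 + δ) ^ n ≤ Real.exp (n * δ) := by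
    rw [Real.exp_nat_mul]
    gcongr
    rw [add_comm]
    exact Real.add_one_le_exp δ
  have h2 : |Real.exp (n * δ) - 1| ≤ 2 * |n * δ| :=
    Real.abs_exp_sub_one_le (by rw [abs_of_nonneg h0]; linarith)
  rw [abs_of_nonneg h0] at h2
  have h3 := le_abs_self (Real.exp (n * δ) - 1)
  linarith

end Estimates

end FCS

/-! ### Choice of the constants and conclusion. -/

theorem mainTheorem9 :
    ∃ D : ℝ, 0 < D ∧
      ∀ (d q N l r m : ℕ) [NeZero N]
        (A : StarSubalgebra ℂ (Matrix (Fin d) (Fin d) ℂ))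
        (Z : Fin q → Matrix (Fin d) (Fin d) ℂ) (_ : IsSelfAdjointONB A Z)
        (ω σ : Op (Fin N) d) (_ : IsState A ω) (_ : IsState A σ)
        (_ : IsFinitelyCorrelated Z l r m ω)
        (ξ : ℕ → ℝ)
        (_ : ∀ a b : ℕ, a < b → b ≤ N →
          traceDist (marginal a b σ) (marginal a b ω) ≤ ξ (b - a))
        (ε : ℝ)
        (cutEst : ∀ j : ℕ, Op (Win N (j - l) (j + r)) d)
        (siteEst : ∀ s : ℕ, Op (Win N (s - l) (s + 1 + r)) d)
        (_ : ∀ j, 1 ≤ j → j < N → (cutEst j).IsHermitian ∧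
          hsDist (cutEst j) (marginal (j - l) (j + r) σ) ≤ ε)
        (_ : ∀ s, s < N → (siteEst s).IsHermitian ∧
          hsDist (siteEst s) (marginal (s - l) (s + 1 + r) σ) ≤ ε)
        (_ : ∀ j ≤ N, ξ (min (l + r) N) ≤ sigmaCut Z l r ω j / 8)
        (ϵ : ℝ) (_ : 0 < ϵ) (_ : ϵ < 1)
        (_ : ∀ j ≤ N, ε + ξ (min (l + r + 1) N) ≤
          ϵ * sigmaCut Z l r ω j ^ 3 / (20 * N * m * √d))
        (η : ℝ) (_ : 0 < η) (_ : 2 * (ε + ξ (min (l + r + 1) N)) ≤ η)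
        (_ : ∀ j ≤ N, η ≤ sigmaCut Z l r ω j / 2)
        (σ' : Op (Fin N) d) (_ : IsReconstruction Z η cutEst siteEst σ'),
        (∀ j, 1 ≤ j → j < N → keptRank Z η cutEst j = (cutMap Z l r ω j).rank) ∧
        traceDist σ σ' ≤ ξ N + traceDist ω σ' ∧
        traceDist ω σ' < D * ϵ := by
  open scoped Matrix.Norms.L2Operator in
  refine ⟨1, one_pos, ?_⟩
  intro d q N l r m hN A Z hZ ω σ hω hσ hfc ξ hξ ε cutEst siteEst hcut hsite _ ϵ hϵ0 hϵ1 hbud η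
    hη0 hη hησ σ' hσ'
  obtain ⟨U, hU, rfl⟩ := hσ'
  obtain ⟨n, rfl⟩ : ∃ n, N = n + 1 := ⟨N - 1, (Nat.succ_pred_eq_of_ne_zero (NeZero.ne N)).symm⟩
  set x := ξ (min (l + r + 1) (n + 1)) with hx
  -- Common error of all estimates relative to `ω`. Since 3/2 < 2 and η > 0, it lies strictly below
  -- the threshold, even if ε + x = 0.
  set E := 3 / 2 * (ε + x) with hE
  have hε0 : 0 ≤ ε := (Real.sqrt_nonneg _).trans (hsite 0 (Nat.succ_pos n)).2
  have hmarg : ∀ a b : ℕ, b ≤ a + (l + r + 1) →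
      hsNorm (marginal a b σ - marginal a b ω) ≤ 3 / 2 * x := by
    intro a b hab
    refine hsNorm_marginal_sub_le hω hσ (t := min (l + r + 1) (n + 1)) (min_le_right _ _) ?_
      (by omega)
    rintro a b rfl hb
    have := hξ a (a + min (l + r + 1) (n + 1)) (by omega) hb
    rwa [Nat.add_sub_cancel_left] at this
  have hest : ∀ (a b : ℕ) (τ : Op (Win (n + 1) a b) d), b ≤ a + (l + r + 1) →
      hsDist τ (marginal a b σ) ≤ ε → hsNorm (τ - marginal a b ω) ≤ E := by
    intro a b τ hab h
    have h1 := hsNorm_add_le (τ - marginal a b σ) (marginal a b σ - marginal a b ω)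
    rw [sub_add_sub_cancel] at h1
    have h2 := hmarg a b hab
    have h3 : hsNorm (τ - marginal a b σ) ≤ ε := h
    rw [hE]
    linarith
  -- Nonnegativity is read off from the bound on the empty window.
  have hx0 : 0 ≤ x := by
    have h1 := hmarg 0 0 (Nat.zero_le _)
    have h2 := hsNorm_nonneg (marginal 0 0 σ - marginal 0 0 ω)
    linarith
  have hE0 : 0 ≤ E := by positivity
  have hcutE : ∀ s, s + 1 < n + 1 →
      hsNorm (cutEst (s + 1) - marginal (s + 1 - l) (s + 1 + r) ω) ≤ E := fun s hs =>
    hest _ _ _ (by omega) (hcut (s + 1) (Nat.succ_pos s) hs).2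
  have hsiteE : ∀ s < n + 1, hsNorm (siteEst s - marginal (s - l) (s + 1 + r) ω) ≤ E :=
    fun s hs => hest _ _ _ (by omega) (hsite s hs).2
  have hcorrE : ∀ s, s + 1 < n + 1 → ‖corr Z (s + 1 - l) (s + 1) (s + 1 + r) (cutEst (s + 1))
      - cutMap Z l r ω (s + 1)‖ ≤ E := fun s hs =>
    (opNorm_le_hsNorm _).trans ((hsNorm_corr_sub_le hZ (Nat.sub_le _ _) (Nat.le_add_right _ _)
      _ _).trans (hcutE s hs))
  have hkept : ∀ j, 1 ≤ j → j < n + 1 → keptRank Z η cutEst j = (cutMap Z l r ω j).rank := by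
    intro j hj hjN
    obtain ⟨s, rfl⟩ : ∃ s, j = s + 1 := ⟨j - 1, by omega⟩
    have h1 := hcorrE s hjN
    have h2 := hησ (s + 1) hjN.le
    rw [sigmaCut] at h2
    -- E ≤ 3η/4 and η ≤ σ/2, so η + E ≤ 7σ/8 stays below the smallest nonzero singular value σ.
    refine thresholdRank_eq _ _ (lt_of_le_of_lt h1 ?_) (le_trans (add_le_add_right h1 _) ?_)
    · rw [hE]; linarith
    · rw [hE]; linarith
  obtain ⟨j₀, hj₀, hmin⟩ := Finset.exists_min_image (Finset.range (n + 2))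
    (fun j => sigmaCut Z l r ω j) ⟨0, by simp⟩
  have hj₀' : j₀ ≤ n + 1 := Nat.le_of_lt_succ (Finset.mem_range.1 hj₀)
  set μ := sigmaCut Z l r ω j₀ with hμ
  have hμmin : ∀ j ≤ n + 1, μ ≤ sigmaCut Z l r ω j := fun j hj =>
    hmin j (Finset.mem_range.2 (Nat.lt_succ_of_le hj))
  -- Follows from 0 < η ≤ μ/2, and in turn forces a positive rank, hence m ≥ 1.
  have hμ0 : 0 < μ := by
    have := hησ j₀ hj₀'
    linarith
  have hμ1 : μ ≤ 1 := sing_corr_marginal_le_one hZ hω (Nat.sub_le _ _) (Nat.le_add_right _ _) _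
  have hm1 : 1 ≤ m := by
    have h1 := (sing_pos_iff _ _).1 hμ0
    have h2 := (hfc j₀ hj₀').2
    omega
  have hd1 : 1 ≤ d := by
    by_contra hd
    obtain rfl : d = 0 := by omega
    have h1 := hω.trace_eq_one
    rw [Matrix.trace, Fintype.sum_empty] at h1
    exact zero_ne_one h1
  set K : ℝ := ((n + 1 : ℕ) : ℝ) * m * √d with hK
  have hN1 : (1 : ℝ) ≤ ((n + 1 : ℕ) : ℝ) := by exact_mod_cast Nat.succ_pos n
  have hm1' : (1 : ℝ) ≤ m := by exact_mod_cast hm1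
  have hsd1 : (1 : ℝ) ≤ √d := Real.one_le_sqrt.2 (by exact_mod_cast hd1)
  have hK1 : 1 ≤ K := one_le_mul_of_one_le_of_one_le
    (one_le_mul_of_one_le_of_one_le hN1 hm1') hsd1
  -- 3/40 is 3/2 times the 1/20 of the error budget.
  have hEK : E * K ≤ 3 / 40 * (ϵ * μ ^ 3) := by
    have h1 := hbud j₀ hj₀'
    rw [le_div_iff₀ (by positivity)] at h1
    rw [hE, hK]
    linarith
  have hEμ : E ≤ 3 / 40 * μ := by
    have h1 : E ≤ E * K := le_mul_of_one_le_right hE0 hK1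
    have h2 : μ ^ 3 ≤ μ := pow_le_of_le_one hμ0.le hμ1 (by norm_num)
    have h3 : ϵ * μ ^ 3 ≤ 1 * μ := mul_le_mul hϵ1.le h2 (by positivity) zero_le_one
    linarith
  have hlow : ∀ s, s + 1 < n + 1 →
      ∀ y : EuclideanSpace ℝ (Fin (bondDim (keptRank Z η cutEst) (s + 1))),
      (9 / 10 * μ) * ‖y‖ ≤ ‖Matrix.toEuclideanLin ((leftMap U (s + 1))ᵀ *
        corr Z (s + 1 - l) (s + 1) (s + 1 + r) (cutEst (s + 1)))ᵀ y‖ := by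
    intro s hs
    -- Weyl's inequality leaves at least μ − E ≥ 37μ/40 ≥ 9μ/10 for every kept singular value.
    refine (hU (s + 1) (Nat.succ_pos s) hs).le_norm (by positivity) fun i => ?_
    have h1 := sing_le_add (cutMap Z l r ω (s + 1))
      (corr Z (s + 1 - l) (s + 1) (s + 1 + r) (cutEst (s + 1))) i
    rw [norm_sub_rev] at h1
    have h2 := hcorrE s hs
    have h3 : sigmaCut Z l r ω (s + 1) ≤ sing (cutMap Z l r ω (s + 1)) i := by
      refine sing_antitone _ ?_
      have := i.2
      have h4 := hkept (s + 1) (Nat.succ_pos s) hs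
      omega
    have h4 := hμmin (s + 1) hs.le
    linarith
  -- One constant for both compressed maps: the estimated one is bounded below by 9μ/10, the exact
  -- one by 9μ/10 − E ≥ 33μ/40.
  have hc0 : 0 < 4 / 5 * μ := by positivity
  have hV : ∀ s < n + 1, (leftMap U s)ᵀ * leftMap U s = 1 := by
    intro s hs
    rcases s with _ | s
    · exact leftMap_zero_orthonormal U
    · exact (hU (s + 1) (Nat.succ_pos s) hs).1
  have hpinv' : ∀ s, s + 1 < n + 1 →
      (leftMap U (s + 1))ᵀ * corr Z (s + 1 - l) (s + 1) (s + 1 + r) (cutEst (s + 1)) *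
        pinv ((leftMap U (s + 1))ᵀ *
          corr Z (s + 1 - l) (s + 1) (s + 1 + r) (cutEst (s + 1))) = 1 ∧
      ‖pinv ((leftMap U (s + 1))ᵀ *
        corr Z (s + 1 - l) (s + 1) (s + 1 + r) (cutEst (s + 1)))‖ ≤ (4 / 5 * μ)⁻¹ := by
    intro s hs
    refine pinv_of_bounded_below _ hc0 fun y => le_trans ?_ (hlow s hs y)
    exact mul_le_mul_of_nonneg_right (by linarith) (norm_nonneg _)
  have hpinv : ∀ s, s + 1 < n + 1 →
      compCut Z r ω U (s + 1) * pinv (compCut Z r ω U (s + 1)) = 1 ∧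
        ‖pinv (compCut Z r ω U (s + 1))‖ ≤ (4 / 5 * μ)⁻¹ := by
    intro s hs
    have h1 : ‖(leftMap U (s + 1))ᵀ * corr Z (s + 1 - l) (s + 1) (s + 1 + r) (cutEst (s + 1))
        - compCut Z r ω U (s + 1)‖ ≤ E := by
      have h2 : (leftMap U (s + 1))ᵀ * corr Z (s + 1 - l) (s + 1) (s + 1 + r) (cutEst (s + 1))
          - compCut Z r ω U (s + 1) = (leftMap U (s + 1))ᵀ *
            (corr Z (s + 1 - l) (s + 1) (s + 1 + r) (cutEst (s + 1))
              - cutMap Z l r ω (s + 1)) := by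
        rw [Matrix.mul_sub]
        rfl
      rw [h2]
      exact (Matrix.l2_opNorm_mul _ _).trans ((mul_le_of_le_one_left (norm_nonneg _)
        (opNorm_transpose_le_one (hV (s + 1) hs))).trans (hcorrE s hs))
    refine pinv_of_bounded_below _ hc0 fun y =>
      le_trans ?_ (le_norm_of_norm_sub_le h1 (hlow s hs) y)
    exact mul_le_mul_of_nonneg_right (by linarith) (norm_nonneg _)
  have hmdim : ∀ s < n + 1, bondDim (keptRank Z η cutEst) s ≤ m := by
    intro s hs
    rcases s with _ | s
    · exact hm1
    · exact (hkept (s + 1) (Nat.succ_pos s) hs).le.trans (hfc (s + 1) hs.le).2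
  have hmain := traceNorm_reconstruct_sub_le (C := (4 / 5 * μ)⁻¹) (E := E) (m := m) hZ hω
    ((one_le_inv₀ hc0).2 (by linarith)) hV hmdim
    (fun s hs => ((hfc (s + 1) hs.le).1).trans (hkept (s + 1) (Nat.succ_pos s) hs).symm)
    hpinv hpinv' hcutE hsiteE
  rw [← marginal_sub, traceNorm_marginal_full] at hmain
  have hfin : traceNorm (reconstruct Z cutEst siteEst U - ω) ≤ ϵ := by
    refine hmain.trans (one_add_pow_sub_one_le (by positivity) hϵ1 _ ?_)
    -- As μ ≤ 1, the 1 is at most μ⁻¹, and 1 + 5/4 = 9/4. Then C²(1 + C) ≤ (225/64) μ⁻³, which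
    -- explains the cube in the budget.
    have h1 : 1 + (4 / 5 * μ)⁻¹ ≤ 9 / 4 * μ⁻¹ := by
      have : 1 ≤ μ⁻¹ := (one_le_inv₀ hμ0).2 hμ1
      rw [mul_inv]
      linarith
    calc ((n + 1 : ℕ) : ℝ) * ((4 / 5 * μ)⁻¹ * (m * √d * (E * (4 / 5 * μ)⁻¹ *
            (1 + (4 / 5 * μ)⁻¹))))
        ≤ ((n + 1 : ℕ) : ℝ) * ((4 / 5 * μ)⁻¹ * (m * √d * (E * (4 / 5 * μ)⁻¹ *
            (9 / 4 * μ⁻¹)))) := by gcongr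
      _ = 225 / 64 * (μ⁻¹) ^ 3 * (E * K) := by
          rw [hK, mul_inv]
          ring
      _ ≤ 225 / 64 * (μ⁻¹) ^ 3 * (3 / 40 * (ϵ * μ ^ 3)) := by gcongr
      _ = 225 / 64 * (3 / 40) * ϵ := by
          field_simp
      -- 225/64 · 3/40 is about 0.264.
      _ ≤ ϵ / 2 := by linarith
  have hfin' : traceNorm (ω - reconstruct Z cutEst siteEst U) ≤ ϵ := by
    rw [← traceNorm_neg, neg_sub]
    exact hfin
  refine ⟨hkept, ?_, ?_⟩
  · have h1 := hξ 0 (n + 1) (Nat.succ_pos n) le_rfl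
    rw [traceDist, ← marginal_sub, traceNorm_marginal_full, Nat.sub_zero] at h1
    have h2 := traceNorm_add_le (σ - ω) (ω - reconstruct Z cutEst siteEst U)
    rw [sub_add_sub_cancel] at h2
    rw [traceDist, traceDist]
    linarith
  · rw [traceDist]
    linarith
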